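/- Fix a set $I$ and a $*$-algebra $A$ over $\mathbb{C}$ (not necessarily unital) with an $I^2$-partial algebra structure: a grading $A=\bigoplus_{r,s,t,u\in I}A\binom{r\;s}{t\;u}$ in which $A\binom{r\;s}{t\;u}\cdot A\binom{s'\;p}{u'\;q}$ lies in $A\binom{r\;p}{t\;q}$ if $(s,u)=(s',u')$ and is $0$ otherwise. Let $\mathbf 1\binom{r}{t}\in M(A)$ be the base units, $\mathbf 1\binom{r}{t}\,a=a$ for $a\in A\binom{r\;s}{t\;u}$ and $=0$ on the other left indices, $a\,\mathbf 1\binom{s}{u}=a$ for $a\in A\binom{r\;s}{t\;u}$ and $=0$ on the other right indices; put $\mathbf 1^r=\sum_t\mathbf 1\binom rt$, $\mathbf 1_t=\sum_r\mathbf 1\binom rt$ (strict sums), $E=\sum_t\mathbf 1_t\otimes\mathbf 1^t$, and let $A\otimes^IA=E(A\otimes A)E$ with $M(A\otimes^I A)=E\,M(A\otimes A)E$. Write ${}^rA=\mathbf 1^rA$, ${}_rA=\mathbf 1_rA$, $A^r=A\mathbf 1^r$, $A_r=A\mathbf 1_r$. **(I) Partial $*$-algebraic quantum groups of compact type.** These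 are pairs $(\Delta,\varepsilon)$ as follows. * $A$ is non-degenerate and idempotent as a partial algebra: for every $x\in I^2$ the algebras $A\mathbf 1(x)$ and $\mathbf 1(x)A$ are idempotent, the first is left non-degenerate ($aA\mathbf 1(x)=0\Rightarrow a=0$) and the second right non-degenerate. * $\Delta:A\to M(A\otimes^IA)$ is a homomorphism with $B_x\Delta(A\mathbf 1(x))=B_x$ and $\Delta(\mathbf 1(x)A)\,{}_xB={}_xB$ for all $x\in I^2$, where $B=A\otimes^IA$ with its $I^2$-grading $B\binom{r\;s}{v\;w}=\bigoplus_{t,u}A\binom{r\;s}{t\;u}\otimes A\binom{t\;u}{v\;w}$; all $\Delta(a)(1\otimes b),\Delta(a)(b\otimes1),(1\otimes b)\Delta(a),(b\otimes1)\Delta(a)$ lie in $A\otimes A$; and $(\Delta\otimes\mathrm{id})\Delta=(\mathrm{id}\otimes\Delta)\Delta$ (with the unique extensions to multipliers). * $\varepsilon:A\to\mathbb C$ is linear, vanishes on $A\binom{r\;s}{t\;u}$ unless $r=t$ and $s=u$, is non-zero on each $A_r$ and each ${}_rA$, satisfies $\varepsilon(ab)=\varepsilon(a)\varepsilon(b)$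 for $a\in A\mathbf 1(x)$, $b\in\mathbf 1(x)A$, and $(\mathrm{id}\otimes\varepsilon)\Delta(a)=a=(\varepsilon\otimes\mathrm{id})\Delta(a)$. * The maps $a\otimes b\mapsto\Delta(a)(1\otimes b)$, $(a\otimes1)\Delta(b)$, $\Delta^{\mathrm{op}}(a)(1\otimes b)$, $(a\otimes1)\Delta^{\mathrm{op}}(b)$ restrict to bijections, respectively, $\bigoplus_rA_r\otimes{}_rA\to\bigoplus_r{}_rA\otimes{}^rA$, $\bigoplus_rA^r\otimes{}^rA\to\bigoplus_rA_r\otimes A^r$, $\bigoplus_rA^r\otimes{}^rA\to\bigoplus_r{}^rA\otimes{}_rA$, $\bigoplus_rA_r\otimes{}_rA\to\bigoplus_rA^r\otimes A_r$. * $\big(A\binom{r\;s}{t\;u}\big)^*=A\binom{s\;r}{u\;t}$ and $\Delta$ is $*$-preserving. * There is a positive ($\varphi(a^*a)\ge0$) faithful linear functional $\varphi$ on $A$ which is left invariant: $\varphi$ vanishes on $A\binom{r\;s}{t\;u}$ unless $r=s$, $t=u$, and $(\mathrm{id}\otimes\varphi)\Delta(a)=\sum_r\varphi(\mathbf 1^ra)\mathbf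 1^r=\sum_r\varphi(a\mathbf 1^r)\mathbf 1^r$. * Compact type: all $\mathbf 1\binom rs$ lie in $A$. Right invariance of $\psi$ means: same support condition and $(\psi\otimes\mathrm{id})\Delta(a)=\sum_s\psi(\mathbf 1_sa)\mathbf 1_s=\sum_s\psi(a\mathbf 1_s)\mathbf 1_s$. Write $r\sim s$ if $\mathbf 1\binom rs\ne0$. **(II) Partial compact quantum groups (De Commer–Timmermann).** These are given by units $\mathbf 1(x)\in A$ for the components ($x\in I^2$, possibly zero), linear maps $\Delta_{pq}:A\to A\otimes A$ with $\Delta_{pq}\big(A\binom{k\;l}{m\;n}\big)\subseteq A\binom{k\;l}{p\;q}\otimes A\binom{p\;q}{m\;n}$, and a linear functional $\varepsilon$ vanishing on $A\binom{k\;l}{m\;n}$ unless $k=m$, $l=n$, such that: * $(\Delta_{pq}\otimes\mathrm{id})\Delta_{rs}=(\mathrm{id}\otimes\Delta_{rs})\Delta_{pq}$, and $(\varepsilon\otimes\mathrm{id})\Delta_{kl}(a)=a=(\mathrm{id}\otimes\varepsilon)\Delta_{mn}(a)$ for $a\in A\binom{k\;l}{m\;n}$; * $\Delta_{ll'}(\mathbf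 1\binom km)=\delta_{l,l'}\mathbf 1\binom kl\otimes\mathbf 1\binom lm$; $\varepsilon(\mathbf 1\binom kk)=1$; $\varepsilon(ab)=\varepsilon(a)\varepsilon(b)$ for composable homogeneous $a,b$; * for every $a$ and fixed $p$ (resp. $q$) only finitely many $\Delta_{pq}(a)$ are non-zero, and $\Delta_{pq}(ab)=\sum_t\Delta_{pt}(a)\Delta_{tq}(b)$ for composable homogeneous $a,b$; * there is an antipode: a linear map $S$ with $S\big(A\binom{k\;l}{m\;n}\big)\subseteq A\binom{n\;m}{l\;k}$ and, writing $\Delta_{pq}(a)=a_{(1)pq}\otimes a_{(2)pq}$, $\sum_qa_{(1)pq}S(a_{(2)pq})=\varepsilon(a)\mathbf 1\binom kp$, $\sum_pS(a_{(1)pq})a_{(2)pq}=\varepsilon(a)\mathbf 1\binom qn$ for $a\in A\binom{k\;l}{m\;n}$; * $\big(A\binom{r\;s}{t\;u}\big)^*=A\binom{s\;r}{u\;t}$ and $\Delta_{pq}(a)^*=\Delta_{qp}(a^*)$; * there is a positive invariant integral: a positive functional $\varphi$ vanishing on $A\binom{k\;l}{m\;n}$ unless $k=l$, $m=n$, with $\varphi(\mathbf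 1\binom kk)=1$ and $(\mathrm{id}\otimes\varphi)\Delta_{pp}(a)=\varphi(a)\mathbf 1\binom kp$, $(\varphi\otimes\mathrm{id})\Delta_{pp}(a)=\varphi(a)\mathbf 1\binom pm$ for $a\in A\binom{k\;l}{m\;n}$. **Proposition.** The two notions coincide: on $A$, keeping the graded $*$-algebra, the units and the counit, the rule $$\Delta_{pq}(a)=(\mathbf 1_p\otimes\mathbf 1^p)\,\Delta(a)\,(\mathbf 1_q\otimes\mathbf 1^q)$$ is a bijection from the structures (I) onto the structures (II). Moreover, given a structure (I) and any positive faithful left invariant functional $\varphi$, there are numbers $\gamma_s>0$ ($s\in I$) such that the functional $\varphi'$ with $\varphi'(a)=\gamma_s\varphi(a)$ for $a\in A_s$ is positive, faithful, left and right invariant, satisfies $\varphi'(\mathbf 1\binom rs)=1$ whenever $r\sim s$, and is an invariant integral of the corresponding structure (II). -/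

import Mathlib

open scoped TensorProduct ComplexOrder

namespace PartialQG

universe u v w

section Multipliers

variable (A : Type v) [NonUnitalRing A] [Module ℂ A] [IsScalarTower ℂ A A] [SMulCommClass ℂ A A]

/-- The multiplier algebra `M(A)`: pairs `m = (l, r)` in `End(A) × End(A)ᵒᵖ` such that, writing
`m a = l a` and `a m = r a`, one has `a (m b) = (a m) b`. -/
def multiplierAlgebra : Subalgebra ℂ (Module.End ℂ A × (Module.End ℂ A)ᵐᵒᵖ) where
  carrier := {m | ∀ a b : A, a * m.1 b = m.2.unop a * b}
  mul_mem' := by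
    intro m n hm hn a b
    simp only [Set.mem_ofPred_eq] at hm hn
    simp [hm, hn]
  add_mem' := by
    intro m n hm hn a b
    simp only [Set.mem_ofPred_eq] at hm hn
    simp [mul_add, add_mul, hm, hn]
  algebraMap_mem' := by
    intro c a b
    simp [Module.algebraMap_end_apply, mul_smul_comm, smul_mul_assoc]

/-- The type of multipliers of `A`. -/
abbrev Multiplier : Type v := multiplierAlgebra A

variable {A}
variable {B : Type w} [NonUnitalRing B] [Module ℂ B] [IsScalarTower ℂ B B] [SMulCommClass ℂ B B]

namespace Multiplier

/-- The left multiplication `a ↦ m a`. -/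
def left (m : Multiplier A) : A →ₗ[ℂ] A := m.1.1

/-- The right multiplication `a ↦ a m`. -/
def right (m : Multiplier A) : A →ₗ[ℂ] A := m.1.2.unop

/-- Constructor from a compatible pair of linear maps. -/
def mk (l r : A →ₗ[ℂ] A) (h : ∀ a b : A, a * l b = r a * b) : Multiplier A :=
  ⟨(l, MulOpposite.op r), h⟩

theorem compat (m : Multiplier A) (a b : A) : a * m.left b = m.right a * b := m.2 a b

theorem ext' {m n : Multiplier A} (hl : ∀ a, m.left a = n.left a)
    (hr : ∀ a, m.right a = n.right a) : m = n :=
  Subtype.ext (Prod.ext (LinearMap.ext hl) (MulOpposite.unop_injective (LinearMap.ext hr)))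

/-- The canonical map `A → M(A)`. -/
def ofElem : A →ₗ[ℂ] Multiplier A where
  toFun a := mk (LinearMap.mulLeft ℂ a) (LinearMap.mulRight ℂ a) (by intro x y; simp [mul_assoc])
  map_add' a b := ext' (fun x => by simp [mk, left, add_mul]) (fun x => by simp [mk, right, mul_add])
  map_smul' c a := ext' (fun x => by simp [mk, left, smul_mul_assoc])
    (fun x => by simp [mk, right, mul_smul_comm])

/-- The multiplier `m ⊗ n` of `A ⊗ B`, as a bilinear map `M(A) × M(B) → M(A ⊗ B)`. -/
noncomputable def tmul : Multiplier A →ₗ[ℂ] Multiplier B →ₗ[ℂ] Multiplier (A ⊗[ℂ] B) :=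
  LinearMap.mk₂ ℂ
    (fun m n => mk (TensorProduct.map m.left n.left) (TensorProduct.map m.right n.right) (by
      intro x y
      induction x using TensorProduct.induction_on with
      | zero => simp
      | add x₁ x₂ h₁ h₂ => simp only [add_mul, map_add, h₁, h₂]
      | tmul a b =>
        induction y using TensorProduct.induction_on with
        | zero => simp
        | add y₁ y₂ h₁ h₂ => simp only [mul_add, map_add, h₁, h₂]
        | tmul c d => simp [Algebra.TensorProduct.tmul_mul_tmul, compat]))
    (fun m₁ m₂ n => ext' (fun x => LinearMap.congr_fun (TensorProduct.map_add_left _ _ _) x)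
      (fun x => LinearMap.congr_fun (TensorProduct.map_add_left _ _ _) x))
    (fun c m n => ext' (fun x => LinearMap.congr_fun (TensorProduct.map_smul_left _ _ _) x)
      (fun x => LinearMap.congr_fun (TensorProduct.map_smul_left _ _ _) x))
    (fun m n₁ n₂ => ext' (fun x => LinearMap.congr_fun (TensorProduct.map_add_right _ _ _) x)
      (fun x => LinearMap.congr_fun (TensorProduct.map_add_right _ _ _) x))
    (fun c m n => ext' (fun x => LinearMap.congr_fun (TensorProduct.map_smul_right _ _ _) x)
      (fun x => LinearMap.congr_fun (TensorProduct.map_smul_right _ _ _) x))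

/-- `a ⊗ 1` in `M(A ⊗ B)`. -/
noncomputable def inl (a : A) : Multiplier (A ⊗[ℂ] B) := tmul (ofElem a) 1

/-- `1 ⊗ b` in `M(A ⊗ B)`. -/
noncomputable def inr (b : B) : Multiplier (A ⊗[ℂ] B) := tmul 1 (ofElem b)

/-- `m` lies in (the image of) `A` inside `M(A)`. -/
def IsElem (m : Multiplier A) : Prop := ∃ a : A, ofElem a = m

/-- Membership in the restricted multiplier algebra of `A ⊗ B`: the products
`x (a ⊗ 1)`, `x (1 ⊗ b)`, `(a ⊗ 1) x`, `(1 ⊗ b) x` all lie in `A ⊗ B`. -/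
def IsRestricted (x : Multiplier (A ⊗[ℂ] B)) : Prop :=
  (∀ a : A, IsElem (x * inl a)) ∧ (∀ b : B, IsElem (x * inr b)) ∧
    (∀ a : A, IsElem (inl a * x)) ∧ (∀ b : B, IsElem (inr b * x))

theorem comm_mul (x y : A ⊗[ℂ] B) : TensorProduct.comm ℂ A B (x * y) =
    TensorProduct.comm ℂ A B x * TensorProduct.comm ℂ A B y := by
  induction x using TensorProduct.induction_on with
  | zero => simp
  | add x₁ x₂ h₁ h₂ => simp only [add_mul, map_add, h₁, h₂]
  | tmul a b =>
    induction y using TensorProduct.induction_on with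
    | zero => simp
    | add y₁ y₂ h₁ h₂ => simp only [mul_add, map_add, h₁, h₂]
    | tmul c d => simp [Algebra.TensorProduct.tmul_mul_tmul]

/-- The flip `M(A ⊗ A) → M(A ⊗ A)` of the two tensor legs. -/
noncomputable def flip (x : Multiplier (A ⊗[ℂ] A)) : Multiplier (A ⊗[ℂ] A) :=
  mk ((TensorProduct.comm ℂ A A).toLinearMap ∘ₗ x.left ∘ₗ (TensorProduct.comm ℂ A A).toLinearMap)
    ((TensorProduct.comm ℂ A A).toLinearMap ∘ₗ x.right ∘ₗ (TensorProduct.comm ℂ A A).toLinearMap)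
    (by
      intro a b
      have h := congrArg (TensorProduct.comm ℂ A A)
        (x.compat (TensorProduct.comm ℂ A A a) (TensorProduct.comm ℂ A A b))
      rw [comm_mul, comm_mul] at h
      simpa using h)

/-- The slice `id ⊗ ω` on `A ⊗ B`. -/
noncomputable def sliceR (ω : B →ₗ[ℂ] ℂ) : A ⊗[ℂ] B →ₗ[ℂ] A :=
  (TensorProduct.rid ℂ A).toLinearMap ∘ₗ ω.lTensor A

/-- The slice `ω ⊗ id` on `A ⊗ B`. -/
noncomputable def sliceL (ω : A →ₗ[ℂ] ℂ) : A ⊗[ℂ] B →ₗ[ℂ] B :=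
  (TensorProduct.lid ℂ B).toLinearMap ∘ₗ ω.rTensor B

/-- `(id ⊗ ω)(x) = m` in `M(A)`, for `x` in the restricted multiplier algebra: for all `b`,
`m b = (id ⊗ ω)(x (b ⊗ 1))` and `b m = (id ⊗ ω)((b ⊗ 1) x)`. -/
def IsSliceR (ω : B →ₗ[ℂ] ℂ) (x : Multiplier (A ⊗[ℂ] B)) (m : Multiplier A) : Prop :=
  ∀ (b : A) (z : A ⊗[ℂ] B), (ofElem z = x * inl b → sliceR ω z = m.left b) ∧
    (ofElem z = inl b * x → sliceR ω z = m.right b)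

/-- `(ω ⊗ id)(x) = m` in `M(B)`, for `x` in the restricted multiplier algebra. -/
def IsSliceL (ω : A →ₗ[ℂ] ℂ) (x : Multiplier (A ⊗[ℂ] B)) (m : Multiplier B) : Prop :=
  ∀ (b : B) (z : A ⊗[ℂ] B), (ofElem z = x * inr b → sliceL ω z = m.left b) ∧
    (ofElem z = inr b * x → sliceL ω z = m.right b)

/-- For a linear map `f : B → M(C)`, non-degenerate on the subalgebra `D` of `B`, the multiplier
`F` is the value at the multiplier `m` of `D` of the extension of `f`: `F f(d) = f(m d)` and
`f(d) F = f(d m)` for all `d ∈ D`. -/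
def IsExtensionValue {C : Type*} [NonUnitalRing C] [Module ℂ C] [IsScalarTower ℂ C C]
    [SMulCommClass ℂ C C] (f : B →ₗ[ℂ] Multiplier C) (D : Submodule ℂ B) (m : Multiplier B)
    (F : Multiplier C) : Prop :=
  ∀ d ∈ D, F * f d = f (m.left d) ∧ f d * F = f (m.right d)

end Multiplier

end Multipliers

/-- The image in `A ⊗ B` of the tensor product of two subspaces. -/
noncomputable def tensorSub {A : Type v} [AddCommGroup A] [Module ℂ A] {B : Type w}
    [AddCommGroup B] [Module ℂ B] (P : Submodule ℂ A) (Q : Submodule ℂ B) :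
    Submodule ℂ (A ⊗[ℂ] B) :=
  Submodule.map₂ (TensorProduct.mk ℂ A B) P Q

section PartialAlgebras

/-- An `X`-partial algebra structure on the (total) algebra `A`: a grading
`A = ⨁_{r,s ∈ X} comp r s` with `comp r s * comp s t ⊆ comp r t` and
`comp r s * comp s' t = 0` for `s ≠ s'`. -/
structure PartialAlgebra (X : Type u) (A : Type v) [NonUnitalRing A] [Module ℂ A] where
  comp : X → X → Submodule ℂ A
  indep : iSupIndep fun p : X × X => comp p.1 p.2
  iSup_eq_top : ⨆ p : X × X, comp p.1 p.2 = ⊤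
  mul_mem : ∀ {r s t a b}, a ∈ comp r s → b ∈ comp s t → a * b ∈ comp r t
  mul_eq_zero : ∀ {r s s' t a b}, a ∈ comp r s → b ∈ comp s' t → s ≠ s' → a * b = 0

namespace PartialAlgebra

variable {X : Type u} {A : Type v} [NonUnitalRing A] [Module ℂ A]

/-- `⨁_{r ∈ S, s} comp r s`. -/
def leftPart (𝒜 : PartialAlgebra X A) (S : Set X) : Submodule ℂ A := ⨆ r ∈ S, ⨆ s, 𝒜.comp r s

/-- `⨁_{r, s ∈ S} comp r s`. -/
def rightPart (𝒜 : PartialAlgebra X A) (S : Set X) : Submodule ℂ A := ⨆ s ∈ S, ⨆ r, 𝒜.comp r s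

/-- Non-degeneracy as a partial algebra: each `A_r` is left non-degenerate and each `_rA` is
right non-degenerate. -/
def IsNondegenerate (𝒜 : PartialAlgebra X A) : Prop :=
  (∀ r, ∀ a ∈ 𝒜.rightPart {r}, (∀ b ∈ 𝒜.rightPart {r}, a * b = 0) → a = 0) ∧
    (∀ r, ∀ a ∈ 𝒜.leftPart {r}, (∀ b ∈ 𝒜.leftPart {r}, b * a = 0) → a = 0)

/-- Idempotency as a partial algebra: each `A_r` and each `_rA` is idempotent. -/
def IsIdempotent (𝒜 : PartialAlgebra X A) : Prop :=
  (∀ r, Submodule.span ℂ {x | ∃ a ∈ 𝒜.rightPart {r}, ∃ b ∈ 𝒜.rightPart {r}, x = a * b} =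
      𝒜.rightPart {r}) ∧
    (∀ r, Submodule.span ℂ {x | ∃ a ∈ 𝒜.leftPart {r}, ∃ b ∈ 𝒜.leftPart {r}, x = a * b} =
      𝒜.leftPart {r})

/-- Compatibility of the grading with a `*`-structure on the total algebra: the involution maps
`comp r s` into (hence onto) `comp s r`. -/
def IsStar [StarRing A] (𝒜 : PartialAlgebra X A) : Prop :=
  ∀ r s, ∀ a ∈ 𝒜.comp r s, star a ∈ 𝒜.comp s r

open Classical in
/-- The projection of `A` onto the sum of the components with index in `T`, along the others. -/
noncomputable def proj (𝒜 : PartialAlgebra X A) (T : Set (X × X)) : A →ₗ[ℂ] A :=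
  (DirectSum.toModule ℂ (X × X) A fun p => if p ∈ T then (𝒜.comp p.1 p.2).subtype else 0) ∘ₗ
    (LinearEquiv.ofBijective (DirectSum.coeLinearMap fun p : X × X => 𝒜.comp p.1 p.2)
      (DirectSum.isInternal_submodule_of_iSupIndep_of_iSup_eq_top 𝒜.indep
        𝒜.iSup_eq_top)).symm.toLinearMap

open Classical in
theorem proj_apply (𝒜 : PartialAlgebra X A) (T : Set (X × X)) {r s : X} {a : A}
    (ha : a ∈ 𝒜.comp r s) : 𝒜.proj T a = if (r, s) ∈ T then a else 0 := by
  have h : (LinearEquiv.ofBijective (DirectSum.coeLinearMap fun p : X × X => 𝒜.comp p.1 p.2)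
      (DirectSum.isInternal_submodule_of_iSupIndep_of_iSup_eq_top 𝒜.indep
        𝒜.iSup_eq_top)).symm a =
      DirectSum.lof ℂ (X × X) (fun p : X × X => 𝒜.comp p.1 p.2) (r, s) ⟨a, ha⟩ := by
    rw [LinearEquiv.symm_apply_eq]
    exact (DirectSum.coeLinearMap_lof (fun p : X × X => 𝒜.comp p.1 p.2) (r, s) ⟨a, ha⟩).symm
  simp only [proj, LinearMap.comp_apply, LinearEquiv.coe_coe, h, DirectSum.toModule_lof]
  split_ifs <;> simp

theorem induction_on (𝒜 : PartialAlgebra X A) {P : A → Prop} (a : A)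
    (hcomp : ∀ r s, ∀ a ∈ 𝒜.comp r s, P a) (h0 : P 0) (hadd : ∀ a b, P a → P b → P (a + b)) :
    P a :=
  Submodule.iSup_induction (fun p : X × X => 𝒜.comp p.1 p.2) (motive := P)
    (by rw [𝒜.iSup_eq_top]; trivial) (fun p a ha => hcomp p.1 p.2 a ha) h0 hadd

variable [IsScalarTower ℂ A A] [SMulCommClass ℂ A A]

/-- The multiplier `∑_{r ∈ S} 1(r)` (strictly convergent sum of base units): for `a ∈ comp r s`,
`m a = a` if `r ∈ S` and `m a = 0` otherwise; `a m = a` if `s ∈ S` and `a m = 0` otherwise. -/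
noncomputable def baseUnit (𝒜 : PartialAlgebra X A) (S : Set X) : Multiplier A :=
  Multiplier.mk (𝒜.proj {p | p.1 ∈ S}) (𝒜.proj {p | p.2 ∈ S}) (by
    classical
    intro a b
    refine 𝒜.induction_on (P := fun a => a * 𝒜.proj {p | p.1 ∈ S} b =
      𝒜.proj {p | p.2 ∈ S} a * b) a ?_ (by simp) ?_
    · intro r s a ha
      refine 𝒜.induction_on (P := fun b => a * 𝒜.proj {p | p.1 ∈ S} b =
        𝒜.proj {p | p.2 ∈ S} a * b) b ?_ (by simp) ?_
      · intro s' t b hb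
        rw [𝒜.proj_apply _ ha, 𝒜.proj_apply _ hb]
        by_cases h : s = s'
        · subst h
          by_cases hs : s ∈ S <;> simp [hs]
        · have h0 := 𝒜.mul_eq_zero ha hb h
          split_ifs <;> simp [h0]
      · intro x y hx hy
        simp only [map_add, mul_add, hx, hy]
    · intro x y hx hy
      simp only [map_add, add_mul, hx, hy])

end PartialAlgebra

end PartialAlgebras

/-! ### `I²`-partial algebras

Elements of `I × I` are read as columns: `𝒜.comp (r, t) (s, u)` is the component with upper left
index `r`, upper right index `s`, lower left index `t` and lower right index `u`. -/

namespace PartialAlgebra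

variable {I : Type u} {A : Type v} [NonUnitalRing A] [Module ℂ A]

/-- `^rA`: upper left index `r`. -/
def upL (𝒜 : PartialAlgebra (I × I) A) (r : I) : Submodule ℂ A := 𝒜.leftPart {x | x.1 = r}

/-- `_rA`: lower left index `r`. -/
def loL (𝒜 : PartialAlgebra (I × I) A) (r : I) : Submodule ℂ A := 𝒜.leftPart {x | x.2 = r}

/-- `A^r`: upper right index `r`. -/
def upR (𝒜 : PartialAlgebra (I × I) A) (r : I) : Submodule ℂ A := 𝒜.rightPart {x | x.1 = r}

/-- `A_r`: lower right index `r`. -/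
def loR (𝒜 : PartialAlgebra (I × I) A) (r : I) : Submodule ℂ A := 𝒜.rightPart {x | x.2 = r}

/-- The components of the `I²`-partial algebra `A ⊗^I A`:
`⨁_{t,u} A(r s; t u) ⊗ A(t u; v w)`, for `p = (r, v)` and `q = (s, w)`. -/
noncomputable def tensorComp (𝒜 : PartialAlgebra (I × I) A) (p q : I × I) :
    Submodule ℂ (A ⊗[ℂ] A) :=
  ⨆ t : I, ⨆ u : I, tensorSub (𝒜.comp (p.1, t) (q.1, u)) (𝒜.comp (t, p.2) (u, q.2))

/-- The subalgebra `A ⊗^I A` of `A ⊗ A`. -/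
noncomputable def tensorI (𝒜 : PartialAlgebra (I × I) A) : Submodule ℂ (A ⊗[ℂ] A) :=
  ⨆ p : I × I, ⨆ q : I × I, 𝒜.tensorComp p q

variable [IsScalarTower ℂ A A] [SMulCommClass ℂ A A]

/-- The base unit `1(r, t)`. -/
noncomputable def unitC (𝒜 : PartialAlgebra (I × I) A) (r t : I) : Multiplier A :=
  𝒜.baseUnit {(r, t)}

/-- `1^r = ∑_t 1(r, t)`. -/
noncomputable def unitUp (𝒜 : PartialAlgebra (I × I) A) (r : I) : Multiplier A :=
  𝒜.baseUnit {x | x.1 = r}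

/-- `1_t = ∑_r 1(r, t)`. -/
noncomputable def unitLo (𝒜 : PartialAlgebra (I × I) A) (t : I) : Multiplier A :=
  𝒜.baseUnit {x | x.2 = t}

end PartialAlgebra

section MultiplierSide

variable {I : Type u} {A : Type v} [NonUnitalRing A] [Module ℂ A] [IsScalarTower ℂ A A]
  [SMulCommClass ℂ A A]

open Multiplier

/-- `Δ ⊗ id : A ⊗ A → M((A ⊗ A) ⊗ A)`. -/
noncomputable def comulId (Δ : A →ₗ[ℂ] Multiplier (A ⊗[ℂ] A)) :
    A ⊗[ℂ] A →ₗ[ℂ] Multiplier ((A ⊗[ℂ] A) ⊗[ℂ] A) :=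
  TensorProduct.lift (tmul.compl₁₂ Δ ofElem)

/-- `id ⊗ Δ : A ⊗ A → M(A ⊗ (A ⊗ A))`. -/
noncomputable def idComul (Δ : A →ₗ[ℂ] Multiplier (A ⊗[ℂ] A)) :
    A ⊗[ℂ] A →ₗ[ℂ] Multiplier (A ⊗[ℂ] (A ⊗[ℂ] A)) :=
  TensorProduct.lift (tmul.compl₁₂ ofElem Δ)

/-- A regular `I`-partial multiplier bialgebra `(A, Δ, ε)`. Here `M(A ⊗^I A)` is identified with
the corner `E M(A ⊗ A) E` of `M(A ⊗ A)`, where `E = ∑_t 1_t ⊗ 1^t`. -/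
structure RegularPartialMultiplierBialgebra (𝒜 : PartialAlgebra (I × I) A) where
  comul : A →ₙₐ[ℂ] Multiplier (A ⊗[ℂ] A)
  counit : A →ₗ[ℂ] ℂ
  nondegenerate : 𝒜.IsNondegenerate
  idempotent : 𝒜.IsIdempotent
  /-- `E Δ(a) = Δ(a)`: the range of `Δ(a)` lies in `E (A ⊗ A)`. -/
  corner_left : ∀ a x, (comul a).left x ∈ ⨆ t, tensorSub (𝒜.loL t) (𝒜.upL t)
  /-- `Δ(a) E = Δ(a)`: the range of `x ↦ x Δ(a)` lies in `(A ⊗ A) E`. -/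
  corner_right : ∀ a x, (comul a).right x ∈ ⨆ t, tensorSub (𝒜.loR t) (𝒜.upR t)
  /-- `B_q Δ(A_q) = B_q` for `B = A ⊗^I A` and every `q ∈ I²`. -/
  morphism_right : ∀ q : I × I,
    Submodule.span ℂ {y | ∃ x ∈ ⨆ p, 𝒜.tensorComp p q, ∃ a ∈ 𝒜.rightPart {q},
      y = (comul a).right x} = ⨆ p, 𝒜.tensorComp p q
  /-- `Δ(_pA) _pB = _pB` for `B = A ⊗^I A` and every `p ∈ I²`. -/
  morphism_left : ∀ p : I × I,
    Submodule.span ℂ {y | ∃ x ∈ ⨆ q, 𝒜.tensorComp p q, ∃ a ∈ 𝒜.leftPart {p},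
      y = (comul a).left x} = ⨆ q, 𝒜.tensorComp p q
  restricted : ∀ a, (comul a).IsRestricted
  /-- `(Δ ⊗ id) Δ(a) = (id ⊗ Δ) Δ(a)`, with `Δ ⊗ id` and `id ⊗ Δ` extended from `A ⊗^I A` to its
  multipliers, and up to the associativity isomorphism. -/
  coassoc : ∀ a, ∃ (F : Multiplier ((A ⊗[ℂ] A) ⊗[ℂ] A)) (G : Multiplier (A ⊗[ℂ] (A ⊗[ℂ] A))),
    IsExtensionValue (comulId (comul : A →ₗ[ℂ] Multiplier (A ⊗[ℂ] A))) 𝒜.tensorI (comul a) F ∧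
    IsExtensionValue (idComul (comul : A →ₗ[ℂ] Multiplier (A ⊗[ℂ] A))) 𝒜.tensorI (comul a) G ∧
    ∀ x, TensorProduct.assoc ℂ A A A (F.left x) = G.left (TensorProduct.assoc ℂ A A A x) ∧
      TensorProduct.assoc ℂ A A A (F.right x) = G.right (TensorProduct.assoc ℂ A A A x)
  counit_support : ∀ r s t u, (r ≠ t ∨ s ≠ u) → ∀ a ∈ 𝒜.comp (r, t) (s, u), counit a = 0
  counit_ne_zero : ∀ r, (∃ a ∈ 𝒜.loR r, counit a ≠ 0) ∧ ∃ a ∈ 𝒜.loL r, counit a ≠ 0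
  counit_mul : ∀ x : I × I, ∀ a ∈ 𝒜.rightPart {x}, ∀ b ∈ 𝒜.leftPart {x},
    counit (a * b) = counit a * counit b
  counit_right : ∀ a, IsSliceR counit (comul a) (ofElem a)
  counit_left : ∀ a, IsSliceL counit (comul a) (ofElem a)

namespace RegularPartialMultiplierBialgebra

variable {𝒜 : PartialAlgebra (I × I) A}

/-- A regular `I`-partial multiplier Hopf algebra: the four canonical maps
`a ⊗ b ↦ Δ(a)(1 ⊗ b)`, `a ⊗ b ↦ (a ⊗ 1)Δ(b)`, `a ⊗ b ↦ Δᵒᵖ(a)(1 ⊗ b)`,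
`a ⊗ b ↦ (a ⊗ 1)Δᵒᵖ(b)` restrict to bijections between the indicated subspaces of `A ⊗ A`. -/
def IsHopf (H : RegularPartialMultiplierBialgebra 𝒜) : Prop :=
  (∃ T : A ⊗[ℂ] A →ₗ[ℂ] A ⊗[ℂ] A, (∀ a b, ofElem (T (a ⊗ₜ b)) = H.comul a * inr b) ∧
    Set.BijOn T (⨆ r, tensorSub (𝒜.loR r) (𝒜.loL r) : Submodule ℂ (A ⊗[ℂ] A))
      (⨆ r, tensorSub (𝒜.loL r) (𝒜.upL r) : Submodule ℂ (A ⊗[ℂ] A))) ∧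
  (∃ T : A ⊗[ℂ] A →ₗ[ℂ] A ⊗[ℂ] A, (∀ a b, ofElem (T (a ⊗ₜ b)) = inl a * H.comul b) ∧
    Set.BijOn T (⨆ r, tensorSub (𝒜.upR r) (𝒜.upL r) : Submodule ℂ (A ⊗[ℂ] A))
      (⨆ r, tensorSub (𝒜.loR r) (𝒜.upR r) : Submodule ℂ (A ⊗[ℂ] A))) ∧
  (∃ T : A ⊗[ℂ] A →ₗ[ℂ] A ⊗[ℂ] A, (∀ a b, ofElem (T (a ⊗ₜ b)) = (H.comul a).flip * inr b) ∧
    Set.BijOn T (⨆ r, tensorSub (𝒜.upR r) (𝒜.upL r) : Submodule ℂ (A ⊗[ℂ] A))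
      (⨆ r, tensorSub (𝒜.upL r) (𝒜.loL r) : Submodule ℂ (A ⊗[ℂ] A))) ∧
  (∃ T : A ⊗[ℂ] A →ₗ[ℂ] A ⊗[ℂ] A, (∀ a b, ofElem (T (a ⊗ₜ b)) = inl a * (H.comul b).flip) ∧
    Set.BijOn T (⨆ r, tensorSub (𝒜.loR r) (𝒜.loL r) : Submodule ℂ (A ⊗[ℂ] A))
      (⨆ r, tensorSub (𝒜.upR r) (𝒜.loR r) : Submodule ℂ (A ⊗[ℂ] A)))

/-- Left invariance of `φ`: support on `⨁ A(r r; s s)` and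
`(id ⊗ φ)Δ(a) = ∑_r φ(1^r a) 1^r = ∑_r φ(a 1^r) 1^r`. -/
def IsLeftInvariant (H : RegularPartialMultiplierBialgebra 𝒜) (φ : A →ₗ[ℂ] ℂ) : Prop :=
  (∀ r s t u, (r ≠ s ∨ t ≠ u) → ∀ a ∈ 𝒜.comp (r, t) (s, u), φ a = 0) ∧
  (∀ a, IsSliceR φ (H.comul a) (∑ᶠ r, φ ((𝒜.unitUp r).left a) • 𝒜.unitUp r)) ∧
  (∀ a, IsSliceR φ (H.comul a) (∑ᶠ r, φ ((𝒜.unitUp r).right a) • 𝒜.unitUp r))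

/-- Right invariance of `ψ`: support on `⨁ A(r r; s s)` and
`(ψ ⊗ id)Δ(a) = ∑_s ψ(1_s a) 1_s = ∑_s ψ(a 1_s) 1_s`. -/
def IsRightInvariant (H : RegularPartialMultiplierBialgebra 𝒜) (ψ : A →ₗ[ℂ] ℂ) : Prop :=
  (∀ r s t u, (r ≠ s ∨ t ≠ u) → ∀ a ∈ 𝒜.comp (r, t) (s, u), ψ a = 0) ∧
  (∀ a, IsSliceL ψ (H.comul a) (∑ᶠ s, ψ ((𝒜.unitLo s).left a) • 𝒜.unitLo s)) ∧
  (∀ a, IsSliceL ψ (H.comul a) (∑ᶠ s, ψ ((𝒜.unitLo s).right a) • 𝒜.unitLo s))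

end RegularPartialMultiplierBialgebra

/-- Faithfulness of a functional: its left and right kernels vanish. -/
def IsFaithful (φ : A →ₗ[ℂ] ℂ) : Prop :=
  (∀ a, (∀ b, φ (a * b) = 0) → a = 0) ∧ ∀ a, (∀ b, φ (b * a) = 0) → a = 0

/-- Positivity of a functional on a `*`-algebra. -/
def IsPositive [StarRing A] (φ : A →ₗ[ℂ] ℂ) : Prop := ∀ a, 0 ≤ φ (star a * a)

namespace RegularPartialMultiplierBialgebra

variable {𝒜 : PartialAlgebra (I × I) A}

/-- `r ∼ s` if and only if `1(r, s) ≠ 0`. -/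
def Hyper (_H : RegularPartialMultiplierBialgebra 𝒜) (r s : I) : Prop := 𝒜.unitC r s ≠ 0

/-- Compact type: all base units `1(r, s)` lie in `A`. -/
def IsCompactType (_H : RegularPartialMultiplierBialgebra 𝒜) : Prop :=
  ∀ r s, IsElem (𝒜.unitC r s)

variable [StarRing A] [StarModule ℂ A]

/-- An `I`-partial multiplier Hopf `*`-algebra: `A` is an `I²`-partial `*`-algebra and
`Δ(a^*) = Δ(a)^*` in `M(A ⊗ A)`, where `m^* x = (x^* m)^*` and `x m^* = (m x^*)^*`. -/
def IsHopfStar (H : RegularPartialMultiplierBialgebra 𝒜) : Prop :=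
  H.IsHopf ∧ 𝒜.IsStar ∧
    ∀ a x, (H.comul (star a)).left x = star ((H.comul a).right (star x)) ∧
      (H.comul (star a)).right x = star ((H.comul a).left (star x))

/-- An `I`-partial `*`-algebraic quantum group: an `I`-partial multiplier Hopf `*`-algebra with a
faithful positive left invariant functional. -/
def IsStarAlgebraicQuantumGroup (H : RegularPartialMultiplierBialgebra 𝒜) : Prop :=
  H.IsHopfStar ∧ ∃ φ : A →ₗ[ℂ] ℂ, H.IsLeftInvariant φ ∧ IsFaithful φ ∧ IsPositive φ

end RegularPartialMultiplierBialgebra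

end MultiplierSide

section PartialCompact

variable {I : Type u} {A : Type v} [NonUnitalRing A] [Module ℂ A] [IsScalarTower ℂ A A]
  [SMulCommClass ℂ A A]

/-- An `I`-partial bialgebra (De Commer–Timmermann): a unital `I²`-partial algebra (the units may
be zero) with componentwise comultiplications
`Δ_{pq} : A(k l; m n) → A(k l; p q) ⊗ A(p q; m n)` and counit functionals on the `A(k l; k l)`,
extended by zero. -/
structure PartialBialgebra (𝒜 : PartialAlgebra (I × I) A) where
  one : I × I → A
  comul : I → I → A →ₗ[ℂ] A ⊗[ℂ] A
  counit : A →ₗ[ℂ] ℂ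
  one_mem : ∀ x, one x ∈ 𝒜.comp x x
  one_mul : ∀ x y, ∀ a ∈ 𝒜.comp x y, one x * a = a
  mul_one : ∀ x y, ∀ a ∈ 𝒜.comp x y, a * one y = a
  comul_mem : ∀ p q k l m n, ∀ a ∈ 𝒜.comp (k, m) (l, n),
    comul p q a ∈ tensorSub (𝒜.comp (k, p) (l, q)) (𝒜.comp (p, m) (q, n))
  coassoc : ∀ p q r s a, TensorProduct.assoc ℂ A A A ((comul p q).rTensor A (comul r s a)) =
    (comul r s).lTensor A (comul p q a)
  counit_support : ∀ k l m n, (k ≠ m ∨ l ≠ n) → ∀ a ∈ 𝒜.comp (k, m) (l, n), counit a = 0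
  counit_left : ∀ k l m n, ∀ a ∈ 𝒜.comp (k, m) (l, n),
    Multiplier.sliceL counit (comul k l a) = a
  counit_right : ∀ k l m n, ∀ a ∈ 𝒜.comp (k, m) (l, n),
    Multiplier.sliceR counit (comul m n a) = a
  /-- Comultiplication of units. -/
  comul_one_same : ∀ k l m, comul l l (one (k, m)) = one (k, l) ⊗ₜ one (l, m)
  comul_one_ne : ∀ k l l' m, l ≠ l' → comul l l' (one (k, m)) = 0
  /-- Counit of multiplication. -/
  counit_mul : ∀ x y z, ∀ a ∈ 𝒜.comp x y, ∀ b ∈ 𝒜.comp y z,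
    counit (a * b) = counit a * counit b
  /-- Non-degeneracy. -/
  counit_one : ∀ k, counit (one (k, k)) = 1
  /-- Finiteness. -/
  finite_left : ∀ a q, {p | comul p q a ≠ 0}.Finite
  finite_right : ∀ a p, {q | comul p q a ≠ 0}.Finite
  /-- Multiplicativity of the comultiplication. -/
  comul_mul : ∀ p q x y z, ∀ a ∈ 𝒜.comp x y, ∀ b ∈ 𝒜.comp y z,
    comul p q (a * b) = ∑ᶠ t, comul p t a * comul t q b

namespace PartialBialgebra

variable {𝒜 : PartialAlgebra (I × I) A}

/-- `S` is an antipode: `S` maps `A(k l; m n)` into `A(n m; l k)` and, for `a ∈ A(k l; m n)`,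
`∑_q a_{(1)pq} S(a_{(2)pq}) = ε(a) 1(k, p)` and `∑_p S(a_{(1)pq}) a_{(2)pq} = ε(a) 1(q, n)`. -/
def IsAntipode (P : PartialBialgebra 𝒜) (S : A →ₗ[ℂ] A) : Prop :=
  (∀ k l m n, ∀ a ∈ 𝒜.comp (k, m) (l, n), S a ∈ 𝒜.comp (n, l) (m, k)) ∧
  (∀ k l m n, ∀ a ∈ 𝒜.comp (k, m) (l, n), ∀ p,
    ∑ᶠ q, LinearMap.mul' ℂ A (S.lTensor A (P.comul p q a)) = P.counit a • P.one (k, p)) ∧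
  (∀ k l m n, ∀ a ∈ 𝒜.comp (k, m) (l, n), ∀ q,
    ∑ᶠ p, LinearMap.mul' ℂ A (S.rTensor A (P.comul p q a)) = P.counit a • P.one (q, n))

/-- `φ` is a (normalized, left and right) invariant integral: it is supported on the
`A(k k; m m)`, `φ(1(k, k)) = 1`, and, for `a ∈ A(k l; m n)`,
`(id ⊗ φ)Δ_{pp}(a) = φ(a) 1(k, p)` and `(φ ⊗ id)Δ_{pp}(a) = φ(a) 1(p, m)`. -/
def IsInvariantIntegral (P : PartialBialgebra 𝒜) (φ : A →ₗ[ℂ] ℂ) : Prop :=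
  (∀ k l m n, (k ≠ l ∨ m ≠ n) → ∀ a ∈ 𝒜.comp (k, m) (l, n), φ a = 0) ∧
  (∀ k, φ (P.one (k, k)) = 1) ∧
  (∀ k l m n, ∀ a ∈ 𝒜.comp (k, m) (l, n), ∀ p,
    Multiplier.sliceR φ (P.comul p p a) = φ a • P.one (k, p)) ∧
  (∀ k l m n, ∀ a ∈ 𝒜.comp (k, m) (l, n), ∀ p,
    Multiplier.sliceL φ (P.comul p p a) = φ a • P.one (p, m))

variable [StarRing A] [StarModule ℂ A]

/-- A partial Hopf `*`-algebra: a partial bialgebra with antipode, whose underlying partial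
algebra is a partial `*`-algebra, with `Δ_{pq}(a)^* = Δ_{qp}(a^*)`. -/
def IsPartialHopfStar (P : PartialBialgebra 𝒜) : Prop :=
  (∃ S, P.IsAntipode S) ∧ 𝒜.IsStar ∧ ∀ p q a, star (P.comul p q a) = P.comul q p (star a)

/-- A partial compact quantum group: a partial Hopf `*`-algebra with a positive invariant
integral. -/
def IsPartialCompactQuantumGroup (P : PartialBialgebra 𝒜) : Prop :=
  P.IsPartialHopfStar ∧ ∃ φ, P.IsInvariantIntegral φ ∧ IsPositive φ

end PartialBialgebra

/-- The two descriptions have the same underlying structure: the units of the partial bialgebra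
are the base units, the counits agree, and
`Δ_{pq}(a) = (1_p ⊗ 1^p) Δ(a) (1_q ⊗ 1^q)`. -/
def Corresponds {𝒜 : PartialAlgebra (I × I) A} (H : RegularPartialMultiplierBialgebra 𝒜)
    (P : PartialBialgebra 𝒜) : Prop :=
  (∀ r t, Multiplier.ofElem (P.one (r, t)) = 𝒜.unitC r t) ∧ P.counit = H.counit ∧
    ∀ p q a, Multiplier.ofElem (P.comul p q a) =
      Multiplier.tmul (𝒜.unitLo p) (𝒜.unitUp p) * H.comul a *
        Multiplier.tmul (𝒜.unitLo q) (𝒜.unitUp q)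

end PartialCompact

end PartialQG

/-! Once all base units lie in `A`, the algebra has local units, so `A` embeds in `M(A)`, `A ⊗ A`
embeds in `M(A ⊗ A)`, and each half of a multiplier determines the other. The elements `1_p ⊗ 1^p`
(`midUnit p`) are orthogonal projections with strict sum `E`. A comultiplication with values in the
corner of `E` is therefore the same thing as its matrix of pieces `Δ_pq(a)`, and the proof is a
translation through this matrix.

From (II) to (I), the columns `∑_p Δ_pq(a)` and rows `∑_q Δ_pq(a)` are honest elements of `A ⊗ A` by
the finiteness axioms; they give the right and left cut of a multiplier `Δ(a)` (`delta`). The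
antipode inverts two of the canonical maps by the Hopf algebra formulas `a ⊗ b ↦ a₁ ⊗ S(a₂)b` and `a
⊗ b ↦ aS(b₁) ⊗ b₂`; the two maps for `Δᵒᵖ` are conjugates of these under `a ⊗ b ↦ b^* ⊗ a^*`. An
invariant integral is automatically faithful (`IsAntipode.eq_zero_of_forall_mul`).

From (I) to (II), the axioms on `B = A ⊗^I A` force `Δ(1(k,m))` to be the strict sum of the `1(k,p)
⊗ 1(p,m)`. Hence `Δ(a)(1_q ⊗ 1^q)` is an element of `A ⊗ A`, which yields the components, their
finiteness and all bialgebra axioms. Bijectivity of a single canonical map already yields the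
antipode (`exists_isAntipode`). Since `eq_delta` recovers `Δ` from its components, the two
constructions are mutually inverse.

For the integral, left invariance gives `φ(1(r,s)) = φ(1(s,s)) > 0` for `r ∼ s`, so dividing by this
number on `A_s` normalizes `φ` and keeps left invariance. Right invariance of the normalized `φ` is
a Hilbert space argument. With `R_u = (φ ⊗ id)Δ_uu`, the form `φ ⊗ φ` satisfies `‖Δ(x)(1_u ⊗ 1^u) -
1 ⊗ R_u x‖² = ‖x‖² - ‖R_u x‖²`, so every `R_u` is a contraction. On its range it is undone by
another such operator, so the contraction is an equality there; the left side vanishes, and applying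
the counit shows that the range consists of multiples of units. -/

set_option linter.unusedSectionVars false

namespace PartialQG

/-! ### Pointwise finite sums of linear maps. -/

section LocallyFinite

variable {ι κ M N K : Type*} [AddCommGroup M] [Module ℂ M] [AddCommGroup N] [Module ℂ N]
  [AddCommGroup K] [Module ℂ K]

/-- The pointwise sum of a family of linear maps that is pointwise finite. -/
noncomputable def lfSum (f : ι → M →ₗ[ℂ] N) (hf : ∀ a, {i | f i a ≠ 0}.Finite) : M →ₗ[ℂ] N where
  toFun a := ∑ᶠ i, f i a
  map_add' a b := by
    simp only [map_add]
    exact finsum_add_distrib (hf a) (hf b)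
  map_smul' c a := by simp only [map_smul, RingHom.id_apply, smul_finsum]

theorem lfSum_apply (f : ι → M →ₗ[ℂ] N) (hf) (a : M) : lfSum f hf a = ∑ᶠ i, f i a := rfl

theorem lfSum_eq_single (f : ι → M →ₗ[ℂ] N) (hf) (a : M) (i : ι) (h : ∀ j, j ≠ i → f j a = 0) :
    lfSum f hf a = f i a := finsum_eq_single _ i h

theorem map_lfSum (f : ι → M →ₗ[ℂ] N) (hf) (g : N →ₗ[ℂ] K) (a : M) :
    g (lfSum f hf a) = ∑ᶠ i, g (f i a) := map_finsum g (hf a)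

theorem finite_add {f : ι → M →ₗ[ℂ] N} {a b : M} (ha : {i | f i a ≠ 0}.Finite)
    (hb : {i | f i b ≠ 0}.Finite) : {i | f i (a + b) ≠ 0}.Finite := by
  refine (ha.union hb).subset fun i hi => ?_
  by_contra h
  simp only [Set.mem_union, Set.mem_ofPred_eq, not_or, not_not] at h
  exact hi (by rw [map_add, h.1, h.2, add_zero])

theorem finite_of_tmul (f : ι → M ⊗[ℂ] K →ₗ[ℂ] N) (h : ∀ a b, {i | f i (a ⊗ₜ b) ≠ 0}.Finite)
    (z : M ⊗[ℂ] K) : {i | f i z ≠ 0}.Finite := by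
  induction z using TensorProduct.induction_on with
  | zero => simp
  | tmul a b => exact h a b
  | add x y hx hy => exact finite_add hx hy

theorem finite_rTensor (f : ι → M →ₗ[ℂ] N) (hf : ∀ a, {i | f i a ≠ 0}.Finite) (z : M ⊗[ℂ] K) :
    {i | (f i).rTensor K z ≠ 0}.Finite :=
  finite_of_tmul _ (fun a b => (hf a).subset fun i (hi : _ ≠ 0) h =>
    hi (by rw [LinearMap.rTensor_tmul, h, TensorProduct.zero_tmul])) z

theorem finite_lTensor (f : ι → M →ₗ[ℂ] N) (hf : ∀ a, {i | f i a ≠ 0}.Finite) (z : K ⊗[ℂ] M) :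
    {i | (f i).lTensor K z ≠ 0}.Finite :=
  finite_of_tmul _ (fun a b => (hf b).subset fun i (hi : _ ≠ 0) h =>
    hi (by rw [LinearMap.lTensor_tmul, h, TensorProduct.tmul_zero])) z

theorem rTensor_lfSum (f : ι → M →ₗ[ℂ] N) (hf : ∀ a, {i | f i a ≠ 0}.Finite) (z : M ⊗[ℂ] K) :
    (lfSum f hf).rTensor K z = ∑ᶠ i, (f i).rTensor K z := by
  have : (lfSum f hf).rTensor K = lfSum (fun i => (f i).rTensor K) (finite_rTensor f hf) := by
    refine TensorProduct.ext' fun a b => ?_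
    simpa [lfSum_apply] using map_finsum ((TensorProduct.mk ℂ N K).flip b) (hf a)
  rw [this, lfSum_apply]

theorem lTensor_lfSum (f : ι → M →ₗ[ℂ] N) (hf : ∀ a, {i | f i a ≠ 0}.Finite) (z : K ⊗[ℂ] M) :
    (lfSum f hf).lTensor K z = ∑ᶠ i, (f i).lTensor K z := by
  have : (lfSum f hf).lTensor K = lfSum (fun i => (f i).lTensor K) (finite_lTensor f hf) := by
    refine TensorProduct.ext' fun a b => ?_
    simpa [lfSum_apply] using map_finsum (TensorProduct.mk ℂ K N a) (hf b)
  rw [this, lfSum_apply]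

/-- Each index of componentwise coassociativity belongs to only one of the two comultiplications, so
one index of each may be summed independently. This gives coassociativity for rows and columns in
any combination. -/
theorem lfSum_coassoc (f : ι → M →ₗ[ℂ] M ⊗[ℂ] M) (hf : ∀ a, {i | f i a ≠ 0}.Finite)
    (g : κ → M →ₗ[ℂ] M ⊗[ℂ] M) (hg : ∀ a, {i | g i a ≠ 0}.Finite)
    (h : ∀ i j a, TensorProduct.assoc ℂ M M M ((f i).rTensor M (g j a)) =
      (g j).lTensor M (f i a)) (a : M) :
    TensorProduct.assoc ℂ M M M ((lfSum f hf).rTensor M (lfSum g hg a)) =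
      (lfSum g hg).lTensor M (lfSum f hf a) := by
  have h1 : ∀ i, TensorProduct.assoc ℂ M M M ((f i).rTensor M (lfSum g hg a)) =
      (lfSum g hg).lTensor M (f i a) := fun i => by
    rw [lTensor_lfSum]
    simp only [← h]
    exact map_lfSum g hg ((TensorProduct.assoc ℂ M M M).toLinearMap ∘ₗ (f i).rTensor M) a
  rw [rTensor_lfSum, map_lfSum]
  simp only [← h1]
  exact map_finsum (TensorProduct.assoc ℂ M M M) (finite_rTensor f hf _)

end LocallyFinite

/-! ### Subspaces of tensor products described by indices of the grading. -/

section TensorSub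

variable {A B : Type*} [AddCommGroup A] [Module ℂ A] [AddCommGroup B] [Module ℂ B]

theorem tmul_mem_tensorSub {P : Submodule ℂ A} {Q : Submodule ℂ B} {a : A} {b : B} (ha : a ∈ P)
    (hb : b ∈ Q) : a ⊗ₜ[ℂ] b ∈ tensorSub P Q := Submodule.apply_mem_map₂ _ ha hb

theorem tensorSub_le {P : Submodule ℂ A} {Q : Submodule ℂ B} {W : Submodule ℂ (A ⊗[ℂ] B)} :
    tensorSub P Q ≤ W ↔ ∀ a ∈ P, ∀ b ∈ Q, a ⊗ₜ[ℂ] b ∈ W := Submodule.map₂_le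

/-- Linear maps that agree on pure tensors agree on `tensorSub P Q`. -/
theorem eqOn_tensorSub {K : Type*} [AddCommGroup K] [Module ℂ K] {P : Submodule ℂ A}
    {Q : Submodule ℂ B} {f g : A ⊗[ℂ] B →ₗ[ℂ] K}
    (h : ∀ a ∈ P, ∀ b ∈ Q, f (a ⊗ₜ b) = g (a ⊗ₜ b)) {z : A ⊗[ℂ] B} (hz : z ∈ tensorSub P Q) :
    f z = g z :=
  (tensorSub_le (W := LinearMap.eqLocus f g)).2 h hz

end TensorSub

namespace PartialAlgebra

variable {X A : Type*} [NonUnitalRing A] [Module ℂ A] (𝒜 : PartialAlgebra X A)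

/-- The sum of the components with index in `S`. -/
def part (S : Set (X × X)) : Submodule ℂ A := ⨆ p ∈ S, 𝒜.comp p.1 p.2

variable {𝒜}

theorem comp_le_part {S : Set (X × X)} {r s : X} (h : (r, s) ∈ S) : 𝒜.comp r s ≤ 𝒜.part S :=
  le_iSup₂_of_le (f := fun (p : X × X) (_ : p ∈ S) => 𝒜.comp p.1 p.2) (r, s) h le_rfl

theorem part_le {S : Set (X × X)} {W : Submodule ℂ A} :
    𝒜.part S ≤ W ↔ ∀ r s, (r, s) ∈ S → ∀ a ∈ 𝒜.comp r s, a ∈ W := by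
  simp only [part, iSup_le_iff, Prod.forall]
  rfl

variable (𝒜) in
theorem leftPart_eq (S : Set X) : 𝒜.leftPart S = 𝒜.part {p | p.1 ∈ S} := by
  refine le_antisymm (iSup₂_le fun r hr => iSup_le fun s => comp_le_part hr) ?_
  exact part_le.2 fun r s h a ha =>
    (le_iSup₂_of_le (f := fun r (_ : r ∈ S) => ⨆ s, 𝒜.comp r s) r h (le_iSup _ s)) ha

variable (𝒜) in
theorem rightPart_eq (S : Set X) : 𝒜.rightPart S = 𝒜.part {p | p.2 ∈ S} := by
  refine le_antisymm (iSup₂_le fun r hr => iSup_le fun s => comp_le_part hr) ?_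
  exact part_le.2 fun r s h a ha =>
    (le_iSup₂_of_le (f := fun s (_ : s ∈ S) => ⨆ r, 𝒜.comp r s) s h (le_iSup _ r)) ha

variable (𝒜) in
/-- The span of the pure tensors of homogeneous elements whose indices are related by `R`. -/
def pairSpan (R : X × X → X × X → Prop) : Submodule ℂ (A ⊗[ℂ] A) :=
  Submodule.span ℂ {z | ∃ x y x' y' : X, R (x, y) (x', y') ∧ ∃ a ∈ 𝒜.comp x y,
    ∃ b ∈ 𝒜.comp x' y', z = a ⊗ₜ b}

theorem tmul_mem_pairSpan {R : X × X → X × X → Prop} {x y x' y' : X} {a b : A}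
    (ha : a ∈ 𝒜.comp x y) (hb : b ∈ 𝒜.comp x' y') (h : R (x, y) (x', y')) :
    a ⊗ₜ b ∈ 𝒜.pairSpan R := Submodule.subset_span ⟨x, y, x', y', h, a, ha, b, hb, rfl⟩

theorem pairSpan_le {R : X × X → X × X → Prop} {W : Submodule ℂ (A ⊗[ℂ] A)} :
    𝒜.pairSpan R ≤ W ↔ ∀ x y x' y', R (x, y) (x', y') → ∀ a ∈ 𝒜.comp x y,
      ∀ b ∈ 𝒜.comp x' y', a ⊗ₜ b ∈ W := by
  rw [pairSpan, Submodule.span_le]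
  constructor
  · intro h x y x' y' hR a ha b hb
    exact h ⟨x, y, x', y', hR, a, ha, b, hb, rfl⟩
  · rintro h z ⟨x, y, x', y', hR, a, ha, b, hb, rfl⟩
    exact h x y x' y' hR a ha b hb

theorem map_mem_of_mem_pairSpan {K : Type*} [AddCommGroup K] [Module ℂ K]
    {R : X × X → X × X → Prop} (f : A ⊗[ℂ] A →ₗ[ℂ] K) {W : Submodule ℂ K}
    (h : ∀ x y x' y', R (x, y) (x', y') → ∀ a ∈ 𝒜.comp x y, ∀ b ∈ 𝒜.comp x' y', f (a ⊗ₜ b) ∈ W)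
    {z : A ⊗[ℂ] A} (hz : z ∈ 𝒜.pairSpan R) : f z ∈ W :=
  (pairSpan_le (W := W.comap f)).2 h hz

theorem pairSpan_mono {R R' : X × X → X × X → Prop} (h : ∀ p p', R p p' → R' p p') :
    𝒜.pairSpan R ≤ 𝒜.pairSpan R' :=
  pairSpan_le.2 fun _ _ _ _ hR _ ha _ hb => tmul_mem_pairSpan ha hb (h _ _ hR)

theorem eqOn_pairSpan {K : Type*} [AddCommGroup K] [Module ℂ K] {R : X × X → X × X → Prop}
    {f g : A ⊗[ℂ] A →ₗ[ℂ] K}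
    (h : ∀ x y x' y', R (x, y) (x', y') → ∀ a ∈ 𝒜.comp x y, ∀ b ∈ 𝒜.comp x' y',
      f (a ⊗ₜ b) = g (a ⊗ₜ b)) {z : A ⊗[ℂ] A} (hz : z ∈ 𝒜.pairSpan R) : f z = g z :=
  (pairSpan_le (W := LinearMap.eqLocus f g)).2 h hz

/-- Scalars can be absorbed into the second leg, so no scalar clause is needed; the principle
therefore also serves conjugate linear maps such as `flipStar`. -/
theorem pairSpan_induction {R : X × X → X × X → Prop} {P : A ⊗[ℂ] A → Prop} {z : A ⊗[ℂ] A}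
    (hz : z ∈ 𝒜.pairSpan R)
    (tmul : ∀ x y x' y', R (x, y) (x', y') → ∀ a ∈ 𝒜.comp x y, ∀ b ∈ 𝒜.comp x' y', P (a ⊗ₜ b))
    (zero : P 0) (add : ∀ x y, P x → P y → P (x + y)) : P z := by
  refine Submodule.closure_induction (p := fun z _ => P z) zero (fun x y _ _ => add x y) ?_ hz
  rintro c _ ⟨x, y, x', y', hR, a, ha, b, hb, rfl⟩
  rw [← TensorProduct.tmul_smul]
  exact tmul x y x' y' hR a ha _ (Submodule.smul_mem _ c hb)

/-- Domains and ranges of the canonical maps and the ranges of `E` all have this shape. The lemma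
turns each of them into a relation between the indices of the two legs, to be checked on pure
homogeneous tensors. -/
theorem iSup_tensorSub_part {J : Type*} {P Q : J → Submodule ℂ A} (S S' : J → Set (X × X))
    (hP : ∀ r, P r = 𝒜.part (S r)) (hQ : ∀ r, Q r = 𝒜.part (S' r)) :
    ⨆ r, tensorSub (P r) (Q r) = 𝒜.pairSpan fun p p' => ∃ r, p ∈ S r ∧ p' ∈ S' r := by
  refine le_antisymm (iSup_le fun r => ?_) (pairSpan_le.2 ?_)
  · rw [hP, hQ, tensorSub_le]
    intro a ha b hb
    have h1 : 𝒜.part (S r) ≤ (𝒜.pairSpan fun p p' => ∃ r, p ∈ S r ∧ p' ∈ S' r).comap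
        ((TensorProduct.mk ℂ A A).flip b) := by
      refine part_le.2 fun x y h a ha => ?_
      have h2 : 𝒜.part (S' r) ≤ (𝒜.pairSpan fun p p' => ∃ r, p ∈ S r ∧ p' ∈ S' r).comap
          (TensorProduct.mk ℂ A A a) :=
        part_le.2 fun x' y' h' b hb => by
          rw [Submodule.mem_comap]
          exact tmul_mem_pairSpan ha hb ⟨r, h, h'⟩
      exact h2 hb
    exact h1 ha
  · rintro x y x' y' ⟨r, h, h'⟩ a ha b hb
    refine (le_iSup (fun r => tensorSub (P r) (Q r)) r) (tmul_mem_tensorSub ?_ ?_)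
    · rw [hP]; exact comp_le_part h ha
    · rw [hQ]; exact comp_le_part h' hb

theorem mem_pairSpan_true (z : A ⊗[ℂ] A) : z ∈ 𝒜.pairSpan fun _ _ => True := by
  induction z using TensorProduct.induction_on with
  | zero => exact Submodule.zero_mem _
  | add x y hx hy => exact Submodule.add_mem _ hx hy
  | tmul a b =>
    refine 𝒜.induction_on (P := fun a => a ⊗ₜ b ∈ 𝒜.pairSpan fun _ _ => True) a ?_
      (by simp) (fun x y hx hy => by rw [TensorProduct.add_tmul]; exact Submodule.add_mem _ hx hy)
    intro r s a ha
    refine 𝒜.induction_on (P := fun b => a ⊗ₜ b ∈ 𝒜.pairSpan fun _ _ => True) b ?_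
      (by simp) (fun x y hx hy => by rw [TensorProduct.tmul_add]; exact Submodule.add_mem _ hx hy)
    intro r' s' b hb
    exact tmul_mem_pairSpan ha hb trivial

/-- Induction on `A ⊗ A` from pure tensors of homogeneous elements. -/
theorem tensor_induction (𝒜 : PartialAlgebra X A) {P : A ⊗[ℂ] A → Prop} (z : A ⊗[ℂ] A)
    (tmul : ∀ x y x' y', ∀ a ∈ 𝒜.comp x y, ∀ b ∈ 𝒜.comp x' y', P (a ⊗ₜ b))
    (zero : P 0) (add : ∀ x y, P x → P y → P (x + y)) : P z :=
  pairSpan_induction (mem_pairSpan_true (𝒜 := 𝒜) z)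
    (fun x y x' y' _ => tmul x y x' y') zero add

theorem tensor_ext (𝒜 : PartialAlgebra X A) {K : Type*} [AddCommGroup K] [Module ℂ K]
    {f g : A ⊗[ℂ] A →ₗ[ℂ] K} (h : ∀ x y x' y', ∀ a ∈ 𝒜.comp x y, ∀ b ∈ 𝒜.comp x' y',
      f (a ⊗ₜ b) = g (a ⊗ₜ b)) : f = g :=
  LinearMap.ext fun z => eqOn_pairSpan (fun x y x' y' _ => h x y x' y')
    (mem_pairSpan_true (𝒜 := 𝒜) z)

theorem linearMap_ext (𝒜 : PartialAlgebra X A) {K : Type*} [AddCommGroup K] [Module ℂ K]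
    {f g : A →ₗ[ℂ] K} (h : ∀ x y, ∀ a ∈ 𝒜.comp x y, f a = g a) : f = g :=
  LinearMap.ext fun z => 𝒜.induction_on (P := fun z => f z = g z) z h (by simp)
    fun a b ha hb => by rw [map_add, map_add, ha, hb]

/-- Linear maps on `A` can be prescribed on the components. -/
theorem exists_linearMap (𝒜 : PartialAlgebra X A) {K : Type*} [AddCommGroup K] [Module ℂ K]
    (f : X → X → A →ₗ[ℂ] K) : ∃ F : A →ₗ[ℂ] K, ∀ x y, ∀ a ∈ 𝒜.comp x y, F a = f x y a := by
  classical
  refine ⟨(DirectSum.toModule ℂ (X × X) K fun p => f p.1 p.2 ∘ₗ (𝒜.comp p.1 p.2).subtype) ∘ₗ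
    (LinearEquiv.ofBijective (DirectSum.coeLinearMap fun p : X × X => 𝒜.comp p.1 p.2)
      (DirectSum.isInternal_submodule_of_iSupIndep_of_iSup_eq_top 𝒜.indep
        𝒜.iSup_eq_top)).symm.toLinearMap, fun r s a ha => ?_⟩
  have h : (LinearEquiv.ofBijective (DirectSum.coeLinearMap fun p : X × X => 𝒜.comp p.1 p.2)
      (DirectSum.isInternal_submodule_of_iSupIndep_of_iSup_eq_top 𝒜.indep
        𝒜.iSup_eq_top)).symm a =
      DirectSum.lof ℂ (X × X) (fun p : X × X => 𝒜.comp p.1 p.2) (r, s) ⟨a, ha⟩ := by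
    rw [LinearEquiv.symm_apply_eq]
    exact (DirectSum.coeLinearMap_lof (fun p : X × X => 𝒜.comp p.1 p.2) (r, s) ⟨a, ha⟩).symm
  simp only [LinearMap.comp_apply, LinearEquiv.coe_coe, h, DirectSum.toModule_lof]
  simp

end PartialAlgebra

end PartialQG

namespace PartialQG

/-! ### Multipliers of algebras with local units. -/

section LocallyUnital

variable {C D : Type*} [NonUnitalRing C] [Module ℂ C] [IsScalarTower ℂ C C] [SMulCommClass ℂ C C]
  [NonUnitalRing D] [Module ℂ D] [IsScalarTower ℂ D D] [SMulCommClass ℂ D D]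

/-- Every finite subset of `C` has a common two-sided local unit. -/
def LocallyUnital (C : Type*) [NonUnitalRing C] : Prop :=
  ∀ s : Set C, s.Finite → ∃ e : C, ∀ x ∈ s, e * x = x ∧ x * e = x

theorem LocallyUnital.eq_of_mul_left {C : Type*} [NonUnitalRing C] (h : LocallyUnital C) {x y : C} (hxy : ∀ c, c * x = c * y) :
    x = y := by
  obtain ⟨e, he⟩ := h {x, y} (by simp)
  rw [← (he x (by simp)).1, hxy, (he y (by simp)).1]

theorem LocallyUnital.eq_of_mul_right {C : Type*} [NonUnitalRing C] (h : LocallyUnital C) {x y : C} (hxy : ∀ c, x * c = y * c) :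
    x = y := by
  obtain ⟨e, he⟩ := h {x, y} (by simp)
  rw [← (he x (by simp)).2, hxy, (he y (by simp)).2]

theorem LocallyUnital.tensor (hC : LocallyUnital C) (hD : LocallyUnital D) :
    LocallyUnital (C ⊗[ℂ] D) := by
  -- A tensor is fixed by `e ⊗ f` as soon as `e` and `f` fix finitely many legs. Recording the legs,
  -- not the units, lets one `e ⊗ f` serve finitely many tensors.
  have key : ∀ x : C ⊗[ℂ] D, ∃ (S : Set C) (T : Set D), S.Finite ∧ T.Finite ∧ ∀ e f,
      (∀ c ∈ S, e * c = c ∧ c * e = c) → (∀ d ∈ T, f * d = d ∧ d * f = d) →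
      e ⊗ₜ[ℂ] f * x = x ∧ x * e ⊗ₜ[ℂ] f = x := by
    intro x
    induction x using TensorProduct.induction_on with
    | zero => exact ⟨∅, ∅, by simp, by simp, by simp⟩
    | tmul a b =>
      refine ⟨{a}, {b}, by simp, by simp, fun e f he hf => ?_⟩
      simp [he a rfl, hf b rfl]
    | add x y hx hy =>
      obtain ⟨S, T, hS, hT, h⟩ := hx
      obtain ⟨S', T', hS', hT', h'⟩ := hy
      refine ⟨S ∪ S', T ∪ T', hS.union hS', hT.union hT', fun e f he hf => ?_⟩
      have h1 := h e f (fun c hc => he c (Or.inl hc)) (fun d hd => hf d (Or.inl hd))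
      have h2 := h' e f (fun c hc => he c (Or.inr hc)) (fun d hd => hf d (Or.inr hd))
      exact ⟨by rw [mul_add, h1.1, h2.1], by rw [add_mul, h1.2, h2.2]⟩
  intro s hs
  choose S T hS hT h using key
  obtain ⟨e, he⟩ := hC (⋃ x ∈ s, S x) (hs.biUnion fun x _ => hS x)
  obtain ⟨f, hf⟩ := hD (⋃ x ∈ s, T x) (hs.biUnion fun x _ => hT x)
  exact ⟨e ⊗ₜ f, fun x hx => h x e f (fun c hc => he c (Set.mem_biUnion hx hc))
    fun d hd => hf d (Set.mem_biUnion hx hd)⟩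

namespace Multiplier

theorem left_mul (m n : Multiplier C) (x : C) : (m * n).left x = m.left (n.left x) := rfl

theorem right_mul (m n : Multiplier C) (x : C) : (m * n).right x = n.right (m.right x) := rfl

theorem left_ofElem (a x : C) : (ofElem a).left x = a * x := rfl

theorem right_ofElem (a x : C) : (ofElem a).right x = x * a := rfl

theorem left_add (m n : Multiplier C) (x : C) : (m + n).left x = m.left x + n.left x := rfl

theorem left_zero (x : C) : (0 : Multiplier C).left x = 0 := rfl

theorem right_zero (x : C) : (0 : Multiplier C).right x = 0 := rfl

theorem left_smul (c : ℂ) (m : Multiplier C) (x : C) : (c • m).left x = c • m.left x := rfl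

theorem right_smul (c : ℂ) (m : Multiplier C) (x : C) : (c • m).right x = c • m.right x := rfl

theorem left_tmul (m : Multiplier C) (n : Multiplier D) (x : C ⊗[ℂ] D) :
    (tmul m n).left x = TensorProduct.map m.left n.left x := rfl

theorem right_tmul (m : Multiplier C) (n : Multiplier D) (x : C ⊗[ℂ] D) :
    (tmul m n).right x = TensorProduct.map m.right n.right x := rfl

theorem ofElem_mul (a b : C) : ofElem (a * b) = ofElem a * ofElem b :=
  ext' (fun x => by simp only [left_mul, left_ofElem, mul_assoc])
    fun x => by simp only [right_mul, right_ofElem, mul_assoc]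

theorem tmul_mul (m m' : Multiplier C) (n n' : Multiplier D) :
    tmul (m * m') (n * n') = tmul m n * tmul m' n' :=
  ext' (fun x => LinearMap.congr_fun (TensorProduct.map_comp m.left n.left m'.left n'.left) x)
    (fun x => LinearMap.congr_fun (TensorProduct.map_comp m'.right n'.right m.right n.right) x)

/-- A multiplier is only required to satisfy `a (m b) = (a m) b`. The module property follows
because elements are separated by left multiplications. -/
theorem left_mul_apply (hC : LocallyUnital C) (m : Multiplier C) (x y : C) : m.left (x * y) = m.left x * y :=
  hC.eq_of_mul_left fun c => by rw [compat, ← mul_assoc, ← compat, mul_assoc]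

theorem right_mul_apply (hC : LocallyUnital C) (m : Multiplier C) (x y : C) : m.right (x * y) = x * m.right y :=
  hC.eq_of_mul_right fun c => by rw [← compat, mul_assoc, compat, mul_assoc]

/-- The compatibility of the two halves determines the right action from the left one, since
elements are separated by right multiplications. -/
theorem ext_left (hC : LocallyUnital C) {m n : Multiplier C} (h : ∀ x, m.left x = n.left x) : m = n :=
  ext' h fun x => hC.eq_of_mul_right fun c => by rw [← compat, h, compat]

theorem ext_right (hC : LocallyUnital C) {m n : Multiplier C} (h : ∀ x, m.right x = n.right x) : m = n :=
  ext' (fun x => hC.eq_of_mul_left fun c => by rw [compat, h, compat]) h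

theorem ofElem_injective (hC : LocallyUnital C) : Function.Injective (ofElem : C →ₗ[ℂ] Multiplier C) := fun a b h =>
  hC.eq_of_mul_right fun c => by rw [← left_ofElem, h, left_ofElem]

theorem mul_ofElem (hC : LocallyUnital C) (m : Multiplier C) (a : C) : m * ofElem a = ofElem (m.left a) :=
  ext_left hC fun x => by rw [left_mul, left_ofElem, left_ofElem, left_mul_apply hC]

theorem ofElem_mul' (hC : LocallyUnital C) (m : Multiplier C) (a : C) : ofElem a * m = ofElem (m.right a) :=
  ext_right hC fun x => by rw [right_mul, right_ofElem, right_ofElem, right_mul_apply hC]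

/-- The sum of a family of multipliers that is finite on every element. -/
noncomputable def lfSum {ι : Type*} (m : ι → Multiplier C)
    (hl : ∀ x, {i | (m i).left x ≠ 0}.Finite) (hr : ∀ x, {i | (m i).right x ≠ 0}.Finite) :
    Multiplier C :=
  mk (PartialQG.lfSum (fun i => (m i).left) hl) (PartialQG.lfSum (fun i => (m i).right) hr) (by
    intro a b
    have h1 := map_finsum (LinearMap.mulLeft ℂ a) (hl b)
    have h2 := map_finsum (LinearMap.mulRight ℂ b) (hr a)
    simp only [LinearMap.mulLeft_apply, LinearMap.mulRight_apply] at h1 h2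
    rw [lfSum_apply, lfSum_apply, h1, h2]
    simp only [compat])

theorem left_lfSum {ι : Type*} (m : ι → Multiplier C) (hl) (hr) (x : C) :
    (lfSum m hl hr).left x = ∑ᶠ i, (m i).left x := rfl

theorem right_lfSum {ι : Type*} (m : ι → Multiplier C) (hl) (hr) (x : C) :
    (lfSum m hl hr).right x = ∑ᶠ i, (m i).right x := rfl

end Multiplier

end LocallyUnital

/-! ### Base units as elements of the algebra. -/

namespace PartialAlgebra

open Multiplier

variable {X A : Type*} [NonUnitalRing A] [Module ℂ A]

/-- Elements of `A` acting as the base units. -/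
structure Units (𝒜 : PartialAlgebra X A) where
  one : X → A
  one_mem : ∀ x, one x ∈ 𝒜.comp x x
  one_mul : ∀ x y, ∀ a ∈ 𝒜.comp x y, one x * a = a
  mul_one : ∀ x y, ∀ a ∈ 𝒜.comp x y, a * one y = a

namespace Units

variable {𝒜 : PartialAlgebra X A} (U : 𝒜.Units)

theorem one_mul_ne {x x' y : X} {a : A} (ha : a ∈ 𝒜.comp x y) (h : x' ≠ x) : U.one x' * a = 0 :=
  𝒜.mul_eq_zero (U.one_mem x') ha h

theorem mul_one_ne {x y y' : X} {a : A} (ha : a ∈ 𝒜.comp x y) (h : y ≠ y') : a * U.one y' = 0 :=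
  𝒜.mul_eq_zero ha (U.one_mem y') h

theorem one_mul_one (x : X) : U.one x * U.one x = U.one x := U.one_mul _ _ _ (U.one_mem x)

theorem locallyUnital {𝒜 : PartialAlgebra X A} (U : 𝒜.Units) : LocallyUnital A := by
  classical
  -- Quantifying over all larger finite sets `G` makes the claim stable under sums of elements.
  have key : ∀ a : A, ∃ F : Finset X, ∀ G, F ⊆ G →
      (∑ x ∈ G, U.one x) * a = a ∧ a * (∑ x ∈ G, U.one x) = a := by
    intro a
    refine 𝒜.induction_on (P := fun a => ∃ F : Finset X, ∀ G, F ⊆ G →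
      (∑ x ∈ G, U.one x) * a = a ∧ a * (∑ x ∈ G, U.one x) = a) a ?_ ⟨∅, by simp⟩ ?_
    · intro x y a ha
      refine ⟨{x, y}, fun G hG => ⟨?_, ?_⟩⟩
      · rw [Finset.sum_mul, Finset.sum_eq_single x (fun z _ hz => U.one_mul_ne ha hz)
          (fun h => absurd (hG (by simp)) h), U.one_mul _ _ _ ha]
      · rw [Finset.mul_sum, Finset.sum_eq_single y (fun z _ hz => U.mul_one_ne ha hz.symm)
          (fun h => absurd (hG (by simp)) h), U.mul_one _ _ _ ha]
    · rintro a b ⟨F, hF⟩ ⟨F', hF'⟩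
      refine ⟨F ∪ F', fun G hG => ?_⟩
      have h1 := hF G (Finset.union_subset_left hG)
      have h2 := hF' G (Finset.union_subset_right hG)
      exact ⟨by rw [mul_add, h1.1, h2.1], by rw [add_mul, h1.2, h2.2]⟩
  choose F hF using key
  intro s hs
  refine ⟨∑ x ∈ hs.toFinset.biUnion F, U.one x, fun x hx => hF x _ ?_⟩
  exact Finset.subset_biUnion_of_mem F (hs.mem_toFinset.2 hx)

/-- `a` lies in `comp x y` as soon as `1(x) a = a = a 1(y)`. -/
theorem one_mul_mul_one_mem (x y : X) (a : A) : U.one x * a * U.one y ∈ 𝒜.comp x y := by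
  refine 𝒜.induction_on (P := fun a => U.one x * a * U.one y ∈ 𝒜.comp x y) a ?_ (by simp) ?_
  · intro r s a ha
    by_cases hr : x = r
    · subst hr
      by_cases hs : s = y
      · subst hs
        rwa [U.one_mul _ _ _ ha, U.mul_one _ _ _ ha]
      · rw [U.one_mul _ _ _ ha, U.mul_one_ne ha hs]
        exact Submodule.zero_mem _
    · rw [U.one_mul_ne ha hr, zero_mul]
      exact Submodule.zero_mem _
  · intro a b ha hb
    rw [mul_add, add_mul]
    exact Submodule.add_mem _ ha hb

theorem mem_comp_iff {x y : X} {a : A} :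
    a ∈ 𝒜.comp x y ↔ U.one x * a = a ∧ a * U.one y = a := by
  refine ⟨fun h => ⟨U.one_mul _ _ _ h, U.mul_one _ _ _ h⟩, fun h => ?_⟩
  have := U.one_mul_mul_one_mem x y a
  rwa [h.1, h.2] at this

theorem eq_of_mul_one {a b : A} (h : ∀ x, a * U.one x = b * U.one x) : a = b := by
  refine U.locallyUnital.eq_of_mul_right fun c => ?_
  refine 𝒜.induction_on (P := fun c => a * c = b * c) c ?_ (by simp)
    (fun c d hc hd => by rw [mul_add, mul_add, hc, hd])
  intro x y c hc
  rw [← U.one_mul _ _ _ hc, ← mul_assoc, h, mul_assoc]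

end Units

variable [IsScalarTower ℂ A A] [SMulCommClass ℂ A A]

open Classical in
theorem left_baseUnit (𝒜 : PartialAlgebra X A) (S : Set X) {x y : X} {a : A}
    (ha : a ∈ 𝒜.comp x y) : (𝒜.baseUnit S).left a = if x ∈ S then a else 0 := 𝒜.proj_apply _ ha

open Classical in
theorem right_baseUnit (𝒜 : PartialAlgebra X A) (S : Set X) {x y : X} {a : A}
    (ha : a ∈ 𝒜.comp x y) : (𝒜.baseUnit S).right a = if y ∈ S then a else 0 := 𝒜.proj_apply _ ha

theorem Units.ofElem_one {𝒜 : PartialAlgebra X A} (U : 𝒜.Units) (x : X) :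
    ofElem (U.one x) = 𝒜.baseUnit {x} := by
  classical
  refine ext_left U.locallyUnital fun a => ?_
  refine 𝒜.induction_on (P := fun a => (ofElem (U.one x)).left a = (𝒜.baseUnit {x}).left a) a ?_
    (by simp) (fun a b ha hb => by rw [map_add, map_add, ha, hb])
  intro r s a ha
  rw [𝒜.left_baseUnit _ ha, left_ofElem]
  split_ifs with h
  · rw [← Set.mem_singleton_iff.1 h, U.one_mul _ _ _ ha]
  · exact U.one_mul_ne ha fun h' => h (by simp [h'])

/-- If the base units lie in `A`, they may be chosen in the components. -/
theorem exists_units (𝒜 : PartialAlgebra X A) (h : ∀ x, IsElem (𝒜.baseUnit {x})) :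
    ∃ U : 𝒜.Units, ∀ x, ofElem (U.one x) = 𝒜.baseUnit {x} := by
  classical
  choose u hu using h
  have hl : ∀ x a, u x * a = (𝒜.baseUnit {x}).left a := fun x a => by rw [← hu, left_ofElem]
  have hr : ∀ x a, a * u x = (𝒜.baseUnit {x}).right a := fun x a => by rw [← hu, right_ofElem]
  have hmem : ∀ x a, (𝒜.baseUnit {x}).right ((𝒜.baseUnit {x}).left a) ∈ 𝒜.comp x x := by
    intro x a
    refine 𝒜.induction_on (P := fun a => (𝒜.baseUnit {x}).right ((𝒜.baseUnit {x}).left a) ∈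
      𝒜.comp x x) a ?_ (by simp)
      (fun a b ha hb => by rw [map_add, map_add]; exact Submodule.add_mem _ ha hb)
    intro r s a ha
    rw [𝒜.left_baseUnit _ ha]
    split_ifs with h
    · rw [𝒜.right_baseUnit _ ha]
      split_ifs with h'
      · rw [Set.mem_singleton_iff] at h h'
        subst h h'
        exact ha
      · exact Submodule.zero_mem _
    · rw [map_zero]
      exact Submodule.zero_mem _
  let U : 𝒜.Units :=
    -- The element `u x` is known only through its multiplications, so it may contain components
    -- that annihilate `A` on both sides. The cube is `1(x) u 1(x)` and lies in `comp x x`.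
    { one := fun x => u x * u x * u x
      one_mem := fun x => by rw [hr, hl]; exact hmem x _
      one_mul := fun x y a ha => by
        have h : u x * a = a := by rw [hl, 𝒜.left_baseUnit _ ha, if_pos (Set.mem_singleton _)]
        rw [mul_assoc, mul_assoc, h, h, h]
      mul_one := fun x y a ha => by
        have h : a * u y = a := by rw [hr, 𝒜.right_baseUnit _ ha, if_pos (Set.mem_singleton _)]
        rw [← mul_assoc, ← mul_assoc, h, h, h] }
  exact ⟨U, U.ofElem_one⟩

end PartialAlgebra

end PartialQG

/-! ### The orthogonal multipliers `1_p ⊗ 1^p` and the corner of `E`. -/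

namespace PartialQG

open Multiplier

variable {I A : Type*} [NonUnitalRing A] [Module ℂ A] [IsScalarTower ℂ A A] [SMulCommClass ℂ A A]

namespace PartialAlgebra

variable (𝒜 : PartialAlgebra (I × I) A)

theorem loL_eq (r : I) : 𝒜.loL r = 𝒜.part {p | p.1.2 = r} := 𝒜.leftPart_eq _

theorem upL_eq (r : I) : 𝒜.upL r = 𝒜.part {p | p.1.1 = r} := 𝒜.leftPart_eq _

theorem loR_eq (r : I) : 𝒜.loR r = 𝒜.part {p | p.2.2 = r} := 𝒜.rightPart_eq _

theorem upR_eq (r : I) : 𝒜.upR r = 𝒜.part {p | p.2.1 = r} := 𝒜.rightPart_eq _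

/-- The range of left multiplication by `E = ∑_t 1_t ⊗ 1^t`. -/
theorem iSup_loL_upL : ⨆ r, tensorSub (𝒜.loL r) (𝒜.upL r) =
    𝒜.pairSpan fun p p' => p.1.2 = p'.1.1 := by
  rw [iSup_tensorSub_part _ _ 𝒜.loL_eq 𝒜.upL_eq]
  simp [eq_comm]

/-- The range of right multiplication by `E = ∑_t 1_t ⊗ 1^t`. -/
theorem iSup_loR_upR : ⨆ r, tensorSub (𝒜.loR r) (𝒜.upR r) =
    𝒜.pairSpan fun p p' => p.2.2 = p'.2.1 := by
  rw [iSup_tensorSub_part _ _ 𝒜.loR_eq 𝒜.upR_eq]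
  simp [eq_comm]

theorem iSup_loR_loL : ⨆ r, tensorSub (𝒜.loR r) (𝒜.loL r) =
    𝒜.pairSpan fun p p' => p.2.2 = p'.1.2 := by
  rw [iSup_tensorSub_part _ _ 𝒜.loR_eq 𝒜.loL_eq]
  simp [eq_comm]

theorem iSup_upR_upL : ⨆ r, tensorSub (𝒜.upR r) (𝒜.upL r) =
    𝒜.pairSpan fun p p' => p.2.1 = p'.1.1 := by
  rw [iSup_tensorSub_part _ _ 𝒜.upR_eq 𝒜.upL_eq]
  simp [eq_comm]

theorem iSup_upL_loL : ⨆ r, tensorSub (𝒜.upL r) (𝒜.loL r) =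
    𝒜.pairSpan fun p p' => p.1.1 = p'.1.2 := by
  rw [iSup_tensorSub_part _ _ 𝒜.upL_eq 𝒜.loL_eq]
  simp [eq_comm]

theorem iSup_upR_loR : ⨆ r, tensorSub (𝒜.upR r) (𝒜.loR r) =
    𝒜.pairSpan fun p p' => p.2.1 = p'.2.2 := by
  rw [iSup_tensorSub_part _ _ 𝒜.upR_eq 𝒜.loR_eq]
  simp [eq_comm]

/-- The multiplier `1_p ⊗ 1^p`. -/
noncomputable def midUnit (p : I) : Multiplier (A ⊗[ℂ] A) := tmul (𝒜.unitLo p) (𝒜.unitUp p)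

variable {𝒜}

open Classical in
theorem left_unitUp {x y : I × I} {a : A} (ha : a ∈ 𝒜.comp x y) (r : I) :
    (𝒜.unitUp r).left a = if x.1 = r then a else 0 := 𝒜.left_baseUnit _ ha

open Classical in
theorem left_unitLo {x y : I × I} {a : A} (ha : a ∈ 𝒜.comp x y) (r : I) :
    (𝒜.unitLo r).left a = if x.2 = r then a else 0 := 𝒜.left_baseUnit _ ha

open Classical in
theorem right_unitUp {x y : I × I} {a : A} (ha : a ∈ 𝒜.comp x y) (r : I) :
    (𝒜.unitUp r).right a = if y.1 = r then a else 0 := 𝒜.right_baseUnit _ ha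

open Classical in
theorem right_unitLo {x y : I × I} {a : A} (ha : a ∈ 𝒜.comp x y) (r : I) :
    (𝒜.unitLo r).right a = if y.2 = r then a else 0 := 𝒜.right_baseUnit _ ha

open Classical in
theorem left_midUnit_tmul {x y x' y' : I × I} {a b : A} (ha : a ∈ 𝒜.comp x y)
    (hb : b ∈ 𝒜.comp x' y') (p : I) :
    (𝒜.midUnit p).left (a ⊗ₜ b) = if x.2 = p ∧ x'.1 = p then a ⊗ₜ b else 0 := by
  rw [midUnit, left_tmul, TensorProduct.map_tmul, left_unitLo ha, left_unitUp hb]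
  by_cases h : x.2 = p <;> by_cases h' : x'.1 = p <;> simp [h, h']

open Classical in
theorem right_midUnit_tmul {x y x' y' : I × I} {a b : A} (ha : a ∈ 𝒜.comp x y)
    (hb : b ∈ 𝒜.comp x' y') (p : I) :
    (𝒜.midUnit p).right (a ⊗ₜ b) = if y.2 = p ∧ y'.1 = p then a ⊗ₜ b else 0 := by
  rw [midUnit, right_tmul, TensorProduct.map_tmul, right_unitLo ha, right_unitUp hb]
  by_cases h : y.2 = p <;> by_cases h' : y'.1 = p <;> simp [h, h']

open Classical in
theorem left_midUnit_tensorSub {x y x' y' : I × I} {z : A ⊗[ℂ] A}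
    (hz : z ∈ tensorSub (𝒜.comp x y) (𝒜.comp x' y')) (p : I) :
    (𝒜.midUnit p).left z = if x.2 = p ∧ x'.1 = p then z else 0 := by
  have := eqOn_tensorSub (f := (𝒜.midUnit p).left)
    (g := if x.2 = p ∧ x'.1 = p then LinearMap.id else 0) (fun a ha b hb => by
      rw [left_midUnit_tmul ha hb]; split_ifs <;> rfl) hz
  rw [this]
  split_ifs <;> rfl

open Classical in
theorem right_midUnit_tensorSub {x y x' y' : I × I} {z : A ⊗[ℂ] A}
    (hz : z ∈ tensorSub (𝒜.comp x y) (𝒜.comp x' y')) (p : I) :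
    (𝒜.midUnit p).right z = if y.2 = p ∧ y'.1 = p then z else 0 := by
  have := eqOn_tensorSub (f := (𝒜.midUnit p).right)
    (g := if y.2 = p ∧ y'.1 = p then LinearMap.id else 0) (fun a ha b hb => by
      rw [right_midUnit_tmul ha hb]; split_ifs <;> rfl) hz
  rw [this]
  split_ifs <;> rfl

variable (𝒜) in
theorem finite_left_midUnit (z : A ⊗[ℂ] A) : {p | (𝒜.midUnit p).left z ≠ 0}.Finite := by
  refine 𝒜.tensor_induction (P := fun z => {p | (𝒜.midUnit p).left z ≠ 0}.Finite) z ?_ (by simp)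
    (fun _ _ => finite_add)
  intro x y x' y' a ha b hb
  refine (Set.finite_singleton x.2).subset fun p hp => ?_
  by_contra h
  refine hp ?_
  rw [left_midUnit_tmul ha hb, if_neg]
  exact fun h' => h h'.1.symm

variable (𝒜) in
theorem finite_right_midUnit (z : A ⊗[ℂ] A) : {p | (𝒜.midUnit p).right z ≠ 0}.Finite := by
  refine 𝒜.tensor_induction (P := fun z => {p | (𝒜.midUnit p).right z ≠ 0}.Finite) z ?_ (by simp)
    (fun _ _ => finite_add)
  intro x y x' y' a ha b hb
  refine (Set.finite_singleton y.2).subset fun p hp => ?_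
  by_contra h
  refine hp ?_
  rw [right_midUnit_tmul ha hb, if_neg]
  exact fun h' => h h'.1.symm

/-- The sum of the `1_p ⊗ 1^p` is `E`, which acts as the identity on its range. -/
theorem finsum_left_midUnit {z : A ⊗[ℂ] A} (hz : z ∈ 𝒜.pairSpan fun p p' => p.1.2 = p'.1.1) :
    ∑ᶠ p, (𝒜.midUnit p).left z = z := by
  refine eqOn_pairSpan (f := lfSum (fun p => (𝒜.midUnit p).left) 𝒜.finite_left_midUnit)
    (g := LinearMap.id) (fun x y x' y' h a ha b hb => ?_) hz
  change x.2 = x'.1 at h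
  rw [lfSum_eq_single _ _ _ x.2, left_midUnit_tmul ha hb, if_pos ⟨rfl, h.symm⟩]
  · rfl
  · intro p hp
    rw [left_midUnit_tmul ha hb, if_neg fun h => hp h.1.symm]

theorem finsum_right_midUnit {z : A ⊗[ℂ] A} (hz : z ∈ 𝒜.pairSpan fun p p' => p.2.2 = p'.2.1) :
    ∑ᶠ p, (𝒜.midUnit p).right z = z := by
  refine eqOn_pairSpan (f := lfSum (fun p => (𝒜.midUnit p).right) 𝒜.finite_right_midUnit)
    (g := LinearMap.id) (fun x y x' y' h a ha b hb => ?_) hz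
  change y.2 = y'.1 at h
  rw [lfSum_eq_single _ _ _ y.2, right_midUnit_tmul ha hb, if_pos ⟨rfl, h.symm⟩]
  · rfl
  · intro p hp
    rw [right_midUnit_tmul ha hb, if_neg fun h => hp h.1.symm]

/-- This is how multipliers in the corner are compared: in the range of `E` the pieces cut out by
the `1_p ⊗ 1^p` determine the element. -/
theorem eq_of_left_midUnit {z w : A ⊗[ℂ] A} (hz : z ∈ 𝒜.pairSpan fun p p' => p.1.2 = p'.1.1)
    (hw : w ∈ 𝒜.pairSpan fun p p' => p.1.2 = p'.1.1)
    (h : ∀ p, (𝒜.midUnit p).left z = (𝒜.midUnit p).left w) : z = w := by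
  rw [← finsum_left_midUnit hz, ← finsum_left_midUnit hw]
  simp only [h]

theorem eq_of_right_midUnit {z w : A ⊗[ℂ] A} (hz : z ∈ 𝒜.pairSpan fun p p' => p.2.2 = p'.2.1)
    (hw : w ∈ 𝒜.pairSpan fun p p' => p.2.2 = p'.2.1)
    (h : ∀ p, (𝒜.midUnit p).right z = (𝒜.midUnit p).right w) : z = w := by
  rw [← finsum_right_midUnit hz, ← finsum_right_midUnit hw]
  simp only [h]

theorem mul_mem_corner_left {z : A ⊗[ℂ] A} (hz : z ∈ 𝒜.pairSpan fun p p' => p.1.2 = p'.1.1)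
    (w : A ⊗[ℂ] A) : z * w ∈ 𝒜.pairSpan fun p p' => p.1.2 = p'.1.1 := by
  refine (pairSpan_le (W := (𝒜.pairSpan fun p p' => p.1.2 = p'.1.1).comap
    (LinearMap.mulRight ℂ w))).2 ?_ hz
  intro x y x' y' h a ha b hb
  rw [Submodule.mem_comap, LinearMap.mulRight_apply]
  refine 𝒜.tensor_induction (P := fun w => a ⊗ₜ b * w ∈ 𝒜.pairSpan fun p p' => p.1.2 = p'.1.1) w
    ?_ (by simp) (fun z w hz hw => by rw [mul_add]; exact Submodule.add_mem _ hz hw)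
  intro u v u' v' c hc d hd
  rw [Algebra.TensorProduct.tmul_mul_tmul]
  by_cases h1 : y = u
  · by_cases h2 : y' = u'
    · subst h1 h2
      exact tmul_mem_pairSpan (𝒜.mul_mem ha hc) (𝒜.mul_mem hb hd) h
    · rw [𝒜.mul_eq_zero hb hd h2]; simp
  · rw [𝒜.mul_eq_zero ha hc h1]; simp

theorem mul_mem_corner_right {z : A ⊗[ℂ] A} (hz : z ∈ 𝒜.pairSpan fun p p' => p.2.2 = p'.2.1)
    (w : A ⊗[ℂ] A) : w * z ∈ 𝒜.pairSpan fun p p' => p.2.2 = p'.2.1 := by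
  refine (pairSpan_le (W := (𝒜.pairSpan fun p p' => p.2.2 = p'.2.1).comap
    (LinearMap.mulLeft ℂ w))).2 ?_ hz
  intro x y x' y' h a ha b hb
  rw [Submodule.mem_comap, LinearMap.mulLeft_apply]
  refine 𝒜.tensor_induction (P := fun w => w * a ⊗ₜ b ∈ 𝒜.pairSpan fun p p' => p.2.2 = p'.2.1) w
    ?_ (by simp) (fun z w hz hw => by rw [add_mul]; exact Submodule.add_mem _ hz hw)
  intro u v u' v' c hc d hd
  rw [Algebra.TensorProduct.tmul_mul_tmul]
  by_cases h1 : v = x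
  · by_cases h2 : v' = x'
    · subst h1 h2
      exact tmul_mem_pairSpan (𝒜.mul_mem hc ha) (𝒜.mul_mem hd hb) h
    · rw [𝒜.mul_eq_zero hd hb h2]; simp
  · rw [𝒜.mul_eq_zero hc ha h1]; simp

theorem tensorSub_mul_eq_zero {x y x' y' u v u' v' : I × I} {z w : A ⊗[ℂ] A}
    (hz : z ∈ tensorSub (𝒜.comp x y) (𝒜.comp x' y'))
    (hw : w ∈ tensorSub (𝒜.comp u v) (𝒜.comp u' v')) (h : y ≠ u ∨ y' ≠ u') : z * w = 0 := by
  refine eqOn_tensorSub (f := LinearMap.mulRight ℂ w) (g := 0) (fun a ha b hb => ?_) hz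
  refine eqOn_tensorSub (f := LinearMap.mulLeft ℂ (a ⊗ₜ b)) (g := 0) (fun c hc d hd => ?_) hw
  rw [LinearMap.mulLeft_apply, Algebra.TensorProduct.tmul_mul_tmul]
  rcases h with h | h
  · simp [𝒜.mul_eq_zero ha hc h]
  · simp [𝒜.mul_eq_zero hb hd h]

end PartialAlgebra

open PartialAlgebra

/-! ### From (II) to (I): the multiplier `Δ(a)` assembled from its components. -/

namespace PartialBialgebra

variable {𝒜 : PartialAlgebra (I × I) A} (P : PartialBialgebra 𝒜)

/-- The units of a partial bialgebra. -/
def units : 𝒜.Units := ⟨P.one, P.one_mem, P.one_mul, P.mul_one⟩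

/-- `∑_p Δ_{pq}`, that is, `a ↦ Δ(a)(1_q ⊗ 1^q)`. -/
noncomputable def col (q : I) : A →ₗ[ℂ] A ⊗[ℂ] A :=
  lfSum (fun p => P.comul p q) fun a => P.finite_left a q

/-- `∑_q Δ_{pq}`, that is, `a ↦ (1_p ⊗ 1^p)Δ(a)`. -/
noncomputable def row (p : I) : A →ₗ[ℂ] A ⊗[ℂ] A :=
  lfSum (fun q => P.comul p q) fun a => P.finite_right a p

theorem locallyUnital (P : PartialBialgebra 𝒜) : LocallyUnital A := P.units.locallyUnital

theorem locallyUnital₂ (P : PartialBialgebra 𝒜) : LocallyUnital (A ⊗[ℂ] A) :=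
  P.locallyUnital.tensor P.locallyUnital

open Classical in
theorem left_midUnit_comul (r p q : I) (a : A) :
    (𝒜.midUnit r).left (P.comul p q a) = if p = r then P.comul p q a else 0 := by
  refine 𝒜.induction_on (P := fun a => (𝒜.midUnit r).left (P.comul p q a) =
    if p = r then P.comul p q a else 0) a ?_ (by simp)
    (fun a b ha hb => by rw [map_add, map_add, ha, hb]; split_ifs <;> simp)
  rintro ⟨k, m⟩ ⟨l, n⟩ a ha
  rw [left_midUnit_tensorSub (P.comul_mem p q k l m n a ha)]
  simp

open Classical in
theorem right_midUnit_comul (r p q : I) (a : A) :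
    (𝒜.midUnit r).right (P.comul p q a) = if q = r then P.comul p q a else 0 := by
  refine 𝒜.induction_on (P := fun a => (𝒜.midUnit r).right (P.comul p q a) =
    if q = r then P.comul p q a else 0) a ?_ (by simp)
    (fun a b ha hb => by rw [map_add, map_add, ha, hb]; split_ifs <;> simp)
  rintro ⟨k, m⟩ ⟨l, n⟩ a ha
  rw [right_midUnit_tensorSub (P.comul_mem p q k l m n a ha)]
  simp

theorem left_midUnit_col (p q : I) (a : A) :
    (𝒜.midUnit p).left (P.col q a) = P.comul p q a := by
  classical
  rw [col, map_lfSum, finsum_eq_single _ p, left_midUnit_comul, if_pos rfl]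
  intro r hr
  rw [left_midUnit_comul, if_neg hr]

theorem right_midUnit_row (p q : I) (a : A) :
    (𝒜.midUnit q).right (P.row p a) = P.comul p q a := by
  classical
  rw [row, map_lfSum, finsum_eq_single _ q, right_midUnit_comul, if_pos rfl]
  intro r hr
  rw [right_midUnit_comul, if_neg hr]

open Classical in
theorem right_midUnit_col (r q : I) (a : A) :
    (𝒜.midUnit r).right (P.col q a) = if q = r then P.col q a else 0 := by
  rw [col, map_lfSum, lfSum_apply]
  simp only [right_midUnit_comul]
  split_ifs <;> simp

open Classical in
theorem left_midUnit_row (r p : I) (a : A) :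
    (𝒜.midUnit r).left (P.row p a) = if p = r then P.row p a else 0 := by
  rw [row, map_lfSum, lfSum_apply]
  simp only [left_midUnit_comul]
  split_ifs <;> simp

theorem comul_mem_corner_left (p q : I) (a : A) :
    P.comul p q a ∈ 𝒜.pairSpan fun p p' => p.1.2 = p'.1.1 := by
  refine 𝒜.induction_on (P := fun a => P.comul p q a ∈ 𝒜.pairSpan fun p p' => p.1.2 = p'.1.1) a ?_
    (by simp) (fun a b ha hb => by rw [map_add]; exact Submodule.add_mem _ ha hb)
  rintro ⟨k, m⟩ ⟨l, n⟩ a ha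
  refine (tensorSub_le (W := 𝒜.pairSpan fun p p' => p.1.2 = p'.1.1)).2 ?_
    (P.comul_mem p q k l m n a ha)
  intro a ha b hb
  exact tmul_mem_pairSpan ha hb rfl

theorem comul_mem_corner_right (p q : I) (a : A) :
    P.comul p q a ∈ 𝒜.pairSpan fun p p' => p.2.2 = p'.2.1 := by
  refine 𝒜.induction_on (P := fun a => P.comul p q a ∈ 𝒜.pairSpan fun p p' => p.2.2 = p'.2.1) a ?_
    (by simp) (fun a b ha hb => by rw [map_add]; exact Submodule.add_mem _ ha hb)
  rintro ⟨k, m⟩ ⟨l, n⟩ a ha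
  refine (tensorSub_le (W := 𝒜.pairSpan fun p p' => p.2.2 = p'.2.1)).2 ?_
    (P.comul_mem p q k l m n a ha)
  intro a ha b hb
  exact tmul_mem_pairSpan ha hb rfl

theorem col_mem_corner_left (q : I) (a : A) :
    P.col q a ∈ 𝒜.pairSpan fun p p' => p.1.2 = p'.1.1 :=
  finsum_induction (· ∈ 𝒜.pairSpan fun p p' => p.1.2 = p'.1.1) (Submodule.zero_mem _)
    (fun _ _ => Submodule.add_mem _) fun p => P.comul_mem_corner_left p q a

theorem row_mem_corner_right (p : I) (a : A) :
    P.row p a ∈ 𝒜.pairSpan fun p p' => p.2.2 = p'.2.1 :=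
  finsum_induction (· ∈ 𝒜.pairSpan fun p p' => p.2.2 = p'.2.1) (Submodule.zero_mem _)
    (fun _ _ => Submodule.add_mem _) fun q => P.comul_mem_corner_right p q a

theorem col_mul (q : I) (a : A) (x : A ⊗[ℂ] A) :
    P.col q a * x = P.col q a * (𝒜.midUnit q).left x := by
  classical
  rw [compat, right_midUnit_col, if_pos rfl]

theorem col_mul_ne {q r : I} (h : q ≠ r) (a : A) (x : A ⊗[ℂ] A) :
    P.col q a * (𝒜.midUnit r).left x = 0 := by
  classical
  rw [compat, right_midUnit_col, if_neg h, zero_mul]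

theorem mul_row (p : I) (a : A) (x : A ⊗[ℂ] A) :
    x * P.row p a = (𝒜.midUnit p).right x * P.row p a := by
  classical
  rw [← compat, left_midUnit_row, if_pos rfl]

theorem finite_col_mul (a : A) (x : A ⊗[ℂ] A) : {q | P.col q a * x ≠ 0}.Finite :=
  (𝒜.finite_left_midUnit x).subset fun q (hq : _ ≠ 0) h => hq (by rw [col_mul, h, mul_zero])

theorem finite_mul_row (a : A) (x : A ⊗[ℂ] A) : {p | x * P.row p a ≠ 0}.Finite :=
  (𝒜.finite_right_midUnit x).subset fun q (hq : _ ≠ 0) h => hq (by rw [mul_row, h, zero_mul])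

theorem row_mul (p : I) (a : A) (x : A ⊗[ℂ] A) :
    P.row p a * x = ∑ᶠ q, P.comul p q a * x :=
  map_lfSum (fun q => P.comul p q) (fun a => P.finite_right a p) (LinearMap.mulRight ℂ x) a

theorem mul_col (q : I) (a : A) (x : A ⊗[ℂ] A) :
    x * P.col q a = ∑ᶠ p, x * P.comul p q a :=
  map_lfSum (fun p => P.comul p q) (fun a => P.finite_left a q) (LinearMap.mulLeft ℂ x) a

/-- `Δ_pt(a)Δ_t'q(b) = 0` for `t ≠ t'`, so `∑_t Δ_pt(a)Δ_tq(b)` is the product of the full row and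
the full column. Composability can be dropped: otherwise `ab = 0`, and the outer indices make every
product on the right vanish too. -/
theorem comul_mul_eq (p q : I) (a b : A) : P.comul p q (a * b) = P.row p a * P.col q b := by
  refine 𝒜.induction_on (P := fun a => P.comul p q (a * b) = P.row p a * P.col q b) a ?_ (by simp)
    (fun a b ha hb => by simp only [map_add, add_mul, ha, hb])
  intro x y a ha
  refine 𝒜.induction_on (P := fun b => P.comul p q (a * b) = P.row p a * P.col q b) b ?_ (by simp)
    (fun a b ha hb => by simp only [map_add, mul_add, ha, hb])
  intro y' z b hb
  have h1 : P.row p a * P.col q b = ∑ᶠ t, P.comul p t a * P.comul t q b := by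
    rw [mul_col]
    refine finsum_congr fun t => ?_
    have : P.comul t q b = (𝒜.midUnit t).left (P.comul t q b) := by
      classical rw [left_midUnit_comul, if_pos rfl]
    rw [this, compat, right_midUnit_row, ← this]
  by_cases h : y = y'
  · subst h
    rw [h1, P.comul_mul p q x y z a ha b hb]
  · obtain ⟨k, m⟩ := x
    obtain ⟨l, n⟩ := y
    obtain ⟨l', n'⟩ := y'
    obtain ⟨k', m'⟩ := z
    rw [h1, 𝒜.mul_eq_zero ha hb h, map_zero]
    refine (finsum_eq_zero_of_forall_eq_zero fun t => ?_).symm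
    refine tensorSub_mul_eq_zero (P.comul_mem _ _ _ _ _ _ a ha) (P.comul_mem _ _ _ _ _ _ b hb) ?_
    by_contra h'
    simp only [ne_eq, Prod.mk.injEq] at h h'
    tauto

/-- Summing the components by columns or by rows gives the same multiplier. This makes the two
halves of `delta` compatible. -/
theorem left_midUnit_finsum_col (p : I) (a : A) (x : A ⊗[ℂ] A) :
    (𝒜.midUnit p).left (∑ᶠ q, P.col q a * x) = P.row p a * x := by
  rw [map_finsum _ (P.finite_col_mul a x), row_mul]
  refine finsum_congr fun q => ?_
  rw [left_mul_apply P.locallyUnital₂, left_midUnit_col]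

theorem finsum_col_mem (a : A) (x : A ⊗[ℂ] A) :
    ∑ᶠ q, P.col q a * x ∈ 𝒜.pairSpan fun p p' => p.1.2 = p'.1.1 :=
  finsum_induction (· ∈ 𝒜.pairSpan fun p p' => p.1.2 = p'.1.1) (Submodule.zero_mem _)
    (fun _ _ => Submodule.add_mem _) fun q => mul_mem_corner_left (P.col_mem_corner_left q a) x

theorem finsum_row_mem (a : A) (x : A ⊗[ℂ] A) :
    ∑ᶠ p, x * P.row p a ∈ 𝒜.pairSpan fun p p' => p.2.2 = p'.2.1 :=
  finsum_induction (· ∈ 𝒜.pairSpan fun p p' => p.2.2 = p'.2.1) (Submodule.zero_mem _)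
    (fun _ _ => Submodule.add_mem _) fun q => mul_mem_corner_right (P.row_mem_corner_right q a) x

/-- The comultiplication as a multiplier: `Δ(a) = ∑_{p,q} Δ_{pq}(a)`. -/
noncomputable def delta (a : A) : Multiplier (A ⊗[ℂ] A) :=
  Multiplier.mk (lfSum (fun q => LinearMap.mulLeft ℂ (P.col q a)) (P.finite_col_mul a))
    (lfSum (fun p => LinearMap.mulRight ℂ (P.row p a)) (P.finite_mul_row a)) (by
      intro y x
      have h1 : ∀ p, P.row p a * x = (𝒜.midUnit p).left (∑ᶠ q, P.col q a * x) := fun p =>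
        (P.left_midUnit_finsum_col p a x).symm
      change y * (∑ᶠ q, P.col q a * x) = (∑ᶠ p, y * P.row p a) * x
      have h2 := map_finsum (LinearMap.mulRight ℂ x) (P.finite_mul_row a y)
      -- The sum of columns lies in the range of `E`, so it may be replaced by the sum of its pieces
      -- `P.row p a * x`.
      have h3 := map_finsum (LinearMap.mulLeft ℂ y)
        (𝒜.finite_left_midUnit (∑ᶠ q, P.col q a * x))
      simp only [LinearMap.mulRight_apply, LinearMap.mulLeft_apply] at h2 h3
      rw [finsum_left_midUnit (P.finsum_col_mem a x)] at h3
      rw [h2, h3]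
      simp only [mul_assoc, h1])

theorem left_delta (a : A) (x : A ⊗[ℂ] A) : (P.delta a).left x = ∑ᶠ q, P.col q a * x := rfl

theorem right_delta (a : A) (x : A ⊗[ℂ] A) : (P.delta a).right x = ∑ᶠ p, x * P.row p a := rfl

theorem left_delta_midUnit (a : A) (q : I) (x : A ⊗[ℂ] A) :
    (P.delta a).left ((𝒜.midUnit q).left x) = P.col q a * x := by
  rw [left_delta, finsum_eq_single _ q fun r hr => P.col_mul_ne hr a x, ← col_mul]

theorem left_midUnit_delta (a : A) (p : I) (x : A ⊗[ℂ] A) :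
    (𝒜.midUnit p).left ((P.delta a).left x) = P.row p a * x := P.left_midUnit_finsum_col p a x

theorem delta_add (a b : A) : P.delta (a + b) = P.delta a + P.delta b :=
  ext_left P.locallyUnital₂ fun x => by
    simp only [left_add, left_delta, map_add, add_mul]
    exact finsum_add_distrib (P.finite_col_mul a x) (P.finite_col_mul b x)

theorem delta_smul (c : ℂ) (a : A) : P.delta (c • a) = c • P.delta a :=
  ext_left P.locallyUnital₂ fun x => by
    simp only [left_smul, left_delta, map_smul, smul_mul_assoc, smul_finsum]

/-- After cutting by `1_p ⊗ 1^p` on the left, both sides become sums of `P.row p a * P.col q b * x`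
over `q`, by `comul_mul_eq`. -/
theorem delta_mul (a b : A) : P.delta (a * b) = P.delta a * P.delta b :=
  ext_left P.locallyUnital₂ fun x => by
    refine eq_of_left_midUnit (P.finsum_col_mem _ _) (P.finsum_col_mem _ _) fun p => ?_
    change (𝒜.midUnit p).left ((P.delta (a * b)).left x) =
      (𝒜.midUnit p).left ((P.delta a).left ((P.delta b).left x))
    rw [left_midUnit_delta, left_midUnit_delta, left_delta]
    have h := map_finsum (LinearMap.mulLeft ℂ (P.row p a)) (P.finite_col_mul b x)
    simp only [LinearMap.mulLeft_apply] at h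
    rw [h, row_mul]
    simp only [comul_mul_eq, mul_assoc]

/-- `a ↦ Δ(a)` as a homomorphism. -/
noncomputable def deltaHom : A →ₙₐ[ℂ] Multiplier (A ⊗[ℂ] A) where
  toFun := P.delta
  map_smul' := P.delta_smul
  map_zero' := by simpa using P.delta_smul 0 0
  map_add' := P.delta_add
  map_mul' := P.delta_mul

theorem deltaHom_apply (a : A) : P.deltaHom a = P.delta a := rfl

theorem midUnit_delta_midUnit (p q : I) (a : A) :
    ofElem (P.comul p q a) = 𝒜.midUnit p * P.delta a * 𝒜.midUnit q :=
  ext_left P.locallyUnital₂ fun x => by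
    rw [left_mul, left_mul, left_delta_midUnit, left_mul_apply P.locallyUnital₂, left_midUnit_col,
      left_ofElem]

/-- `Δ(a)` is determined by its range conditions and its components. -/
theorem eq_delta (a : A) (m : Multiplier (A ⊗[ℂ] A))
    (hl : ∀ x, m.left x ∈ ⨆ t, tensorSub (𝒜.loL t) (𝒜.upL t))
    (hr : ∀ x, m.right x ∈ ⨆ t, tensorSub (𝒜.loR t) (𝒜.upR t))
    (h : ∀ p q, ofElem (P.comul p q a) = 𝒜.midUnit p * m * 𝒜.midUnit q) : m = P.delta a := by
  rw [iSup_loL_upL] at hl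
  rw [iSup_loR_upR] at hr
  refine ext_left P.locallyUnital₂ fun x => eq_of_left_midUnit (hl x) (P.finsum_col_mem a x)
    fun p => ?_
  -- The left action has been cut by `1_p ⊗ 1^p`. Testing against `y` passes to the right action,
  -- where a second cut, by `1_q ⊗ 1^q`, reduces the claim to components.
  refine P.locallyUnital₂.eq_of_mul_left fun y => ?_
  change y * (𝒜.midUnit p).left (m.left x) = y * (𝒜.midUnit p).left ((P.delta a).left x)
  rw [compat, compat, compat, compat]
  congr 1
  refine eq_of_right_midUnit (hr _) (P.finsum_row_mem a _) fun q => ?_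
  have h1 := congrArg (fun n => Multiplier.right n y) ((h p q).symm.trans
    (P.midUnit_delta_midUnit p q a))
  exact h1

theorem col_coassoc (q s : I) (a : A) :
    TensorProduct.assoc ℂ A A A ((P.col q).rTensor A (P.col s a)) =
      (P.col s).lTensor A (P.col q a) :=
  lfSum_coassoc _ _ _ _ (fun p r a => P.coassoc p q r s a) a

theorem col_row_coassoc (q r : I) (a : A) :
    TensorProduct.assoc ℂ A A A ((P.col q).rTensor A (P.row r a)) =
      (P.row r).lTensor A (P.col q a) :=
  lfSum_coassoc _ _ _ _ (fun p s a => P.coassoc p q r s a) a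

theorem row_col_coassoc (p s : I) (a : A) :
    TensorProduct.assoc ℂ A A A ((P.row p).rTensor A (P.col s a)) =
      (P.col s).lTensor A (P.row p a) :=
  lfSum_coassoc _ _ _ _ (fun q r a => P.coassoc p q r s a) a

end PartialBialgebra

end PartialQG

/-! ### Products of `Δ(a)` with one leg, slices, and the action on `A ⊗^I A`. -/

namespace PartialQG

open Multiplier PartialAlgebra

variable {I A : Type*} [NonUnitalRing A] [Module ℂ A] [IsScalarTower ℂ A A] [SMulCommClass ℂ A A]

theorem assoc_mul (x y : (A ⊗[ℂ] A) ⊗[ℂ] A) : TensorProduct.assoc ℂ A A A (x * y) =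
    TensorProduct.assoc ℂ A A A x * TensorProduct.assoc ℂ A A A y := by
  induction x using TensorProduct.induction_on with
  | zero => simp
  | add x₁ x₂ h₁ h₂ => simp only [add_mul, map_add, h₁, h₂]
  | tmul x c =>
    induction x using TensorProduct.induction_on with
    | zero => simp
    | add x₁ x₂ h₁ h₂ => simp only [TensorProduct.add_tmul, add_mul, map_add, h₁, h₂]
    | tmul a b =>
      induction y using TensorProduct.induction_on with
      | zero => simp
      | add x₁ x₂ h₁ h₂ => simp only [mul_add, map_add, h₁, h₂]
      | tmul y c' =>
        induction y using TensorProduct.induction_on with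
        | zero => simp
        | add x₁ x₂ h₁ h₂ => simp only [TensorProduct.add_tmul, mul_add, map_add, h₁, h₂]
        | tmul a' b' => simp [Algebra.TensorProduct.tmul_mul_tmul]

theorem triple_induction (𝒜 : PartialAlgebra (I × I) A) {p : (A ⊗[ℂ] A) ⊗[ℂ] A → Prop}
    (z : (A ⊗[ℂ] A) ⊗[ℂ] A) (zero : p 0) (add : ∀ x y, p x → p y → p (x + y))
    (tmul : ∀ x y x' y' x'' y'', ∀ a ∈ 𝒜.comp x y, ∀ b ∈ 𝒜.comp x' y', ∀ c ∈ 𝒜.comp x'' y'',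
      p ((a ⊗ₜ b) ⊗ₜ c)) : p z := by
  induction z using TensorProduct.induction_on with
  | zero => exact zero
  | add x y hx hy => exact add _ _ hx hy
  | tmul z c =>
    refine 𝒜.induction_on (P := fun c => p (z ⊗ₜ c)) c ?_ (by simpa using zero)
      (fun c d hc hd => by rw [TensorProduct.tmul_add]; exact add _ _ hc hd)
    intro x'' y'' c hc
    refine 𝒜.tensor_induction (P := fun z => p (z ⊗ₜ c)) z ?_ (by simpa using zero)
      (fun c d hc hd => by rw [TensorProduct.add_tmul]; exact add _ _ hc hd)
    intro x y x' y' a ha b hb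
    exact tmul x y x' y' x'' y'' a ha b hb c hc

theorem right_inr (b : A) (z : A ⊗[ℂ] A) :
    (inr (A := A) b).right z = (LinearMap.mulRight ℂ b).lTensor A z := rfl

theorem left_inr (b : A) (z : A ⊗[ℂ] A) :
    (inr (A := A) b).left z = (LinearMap.mulLeft ℂ b).lTensor A z := rfl

theorem right_inl (b : A) (z : A ⊗[ℂ] A) :
    (inl (B := A) b).right z = (LinearMap.mulRight ℂ b).rTensor A z := rfl

theorem left_inl (b : A) (z : A ⊗[ℂ] A) :
    (inl (B := A) b).left z = (LinearMap.mulLeft ℂ b).rTensor A z := rfl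

theorem inl_add (a b : A) : (inl (a + b) : Multiplier (A ⊗[ℂ] A)) = inl a + inl b := by
  simp [inl]

theorem inr_add (a b : A) : (inr (a + b) : Multiplier (A ⊗[ℂ] A)) = inr a + inr b := by
  simp [inr]

theorem inl_zero : (inl (0 : A) : Multiplier (A ⊗[ℂ] A)) = 0 := by simp [inl]

theorem inr_zero : (inr (0 : A) : Multiplier (A ⊗[ℂ] A)) = 0 := by simp [inr]

theorem sliceR_tmul (ω : A →ₗ[ℂ] ℂ) (a b : A) : sliceR ω (a ⊗ₜ[ℂ] b) = ω b • a := by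
  simp [sliceR]

theorem sliceL_tmul (ω : A →ₗ[ℂ] ℂ) (a b : A) : sliceL ω (a ⊗ₜ[ℂ] b) = ω a • b := by
  simp [sliceL]

theorem sliceR_right_inl (ω : A →ₗ[ℂ] ℂ) (b : A) (z : A ⊗[ℂ] A) :
    sliceR ω ((inl b).right z) = sliceR ω z * b := by
  have : sliceR ω ∘ₗ (inl b).right = LinearMap.mulRight ℂ b ∘ₗ sliceR ω :=
    TensorProduct.ext' fun x y => by
      simp [right_inl, sliceR_tmul]
  exact LinearMap.congr_fun this z

theorem sliceR_left_inl (ω : A →ₗ[ℂ] ℂ) (b : A) (z : A ⊗[ℂ] A) :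
    sliceR ω ((inl b).left z) = b * sliceR ω z := by
  have : sliceR ω ∘ₗ (inl b).left = LinearMap.mulLeft ℂ b ∘ₗ sliceR ω :=
    TensorProduct.ext' fun x y => by
      simp [left_inl, sliceR_tmul]
  exact LinearMap.congr_fun this z

theorem sliceL_right_inr (ω : A →ₗ[ℂ] ℂ) (b : A) (z : A ⊗[ℂ] A) :
    sliceL ω ((inr b).right z) = sliceL ω z * b := by
  have : sliceL ω ∘ₗ (inr b).right = LinearMap.mulRight ℂ b ∘ₗ sliceL ω :=
    TensorProduct.ext' fun x y => by
      simp [right_inr, sliceL_tmul]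
  exact LinearMap.congr_fun this z

theorem sliceL_left_inr (ω : A →ₗ[ℂ] ℂ) (b : A) (z : A ⊗[ℂ] A) :
    sliceL ω ((inr b).left z) = b * sliceL ω z := by
  have : sliceL ω ∘ₗ (inr b).left = LinearMap.mulLeft ℂ b ∘ₗ sliceL ω :=
    TensorProduct.ext' fun x y => by
      simp [left_inr, sliceL_tmul]
  exact LinearMap.congr_fun this z

namespace PartialAlgebra

variable {𝒜 : PartialAlgebra (I × I) A}

theorem midUnit_mul_inr (U : 𝒜.Units) {r : I} {x y : I × I} {b : A} (hb : b ∈ 𝒜.comp x y) (h : x.1 ≠ r) :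
    𝒜.midUnit r * inr b = 0 := by
  classical
  rw [midUnit, inr, ← tmul_mul, mul_ofElem U.locallyUnital, left_unitUp hb, if_neg h, map_zero,
    map_zero]

theorem midUnit_mul_inl (U : 𝒜.Units) {r : I} {x y : I × I} {b : A} (hb : b ∈ 𝒜.comp x y) (h : x.2 ≠ r) :
    𝒜.midUnit r * inl b = 0 := by
  classical
  rw [midUnit, inl, ← tmul_mul, mul_ofElem U.locallyUnital, left_unitLo hb, if_neg h, map_zero,
    map_zero, LinearMap.zero_apply]

theorem inr_mul_midUnit (U : 𝒜.Units) {r : I} {x y : I × I} {b : A} (hb : b ∈ 𝒜.comp x y) (h : y.1 ≠ r) :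
    inr b * 𝒜.midUnit r = 0 := by
  classical
  rw [midUnit, inr, ← tmul_mul, ofElem_mul' U.locallyUnital, right_unitUp hb, if_neg h, map_zero,
    map_zero]

theorem inl_mul_midUnit (U : 𝒜.Units) {r : I} {x y : I × I} {b : A} (hb : b ∈ 𝒜.comp x y) (h : y.2 ≠ r) :
    inl b * 𝒜.midUnit r = 0 := by
  classical
  rw [midUnit, inl, ← tmul_mul, ofElem_mul' U.locallyUnital, right_unitLo hb, if_neg h, map_zero,
    map_zero, LinearMap.zero_apply]

theorem iSup_tensorComp_left (p : I × I) : ⨆ q, 𝒜.tensorComp p q = 𝒜.pairSpan fun u v =>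
    (u.1.1 = p.1 ∧ v.1.2 = p.2) ∧ u.1.2 = v.1.1 ∧ u.2.2 = v.2.1 := by
  refine le_antisymm (iSup_le fun q => iSup_le fun t => iSup_le fun u => ?_) (pairSpan_le.2 ?_)
  · rw [tensorSub_le]
    intro a ha b hb
    exact tmul_mem_pairSpan ha hb ⟨⟨rfl, rfl⟩, rfl, rfl⟩
  · rintro ⟨k, t⟩ ⟨l, u⟩ ⟨t', m⟩ ⟨u', n⟩ ⟨⟨h1, h2⟩, h3, h4⟩ a ha b hb
    dsimp only at h1 h2 h3 h4
    subst h1 h2 h3 h4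
    exact Submodule.mem_iSup_of_mem (l, n) (Submodule.mem_iSup_of_mem t
      (Submodule.mem_iSup_of_mem u (tmul_mem_tensorSub ha hb)))

theorem iSup_tensorComp_right (q : I × I) : ⨆ p, 𝒜.tensorComp p q = 𝒜.pairSpan fun u v =>
    (u.2.1 = q.1 ∧ v.2.2 = q.2) ∧ u.1.2 = v.1.1 ∧ u.2.2 = v.2.1 := by
  refine le_antisymm (iSup_le fun q => iSup_le fun t => iSup_le fun u => ?_) (pairSpan_le.2 ?_)
  · rw [tensorSub_le]
    intro a ha b hb
    exact tmul_mem_pairSpan ha hb ⟨⟨rfl, rfl⟩, rfl, rfl⟩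
  · rintro ⟨k, t⟩ ⟨l, u⟩ ⟨t', m⟩ ⟨u', n⟩ ⟨⟨h1, h2⟩, h3, h4⟩ a ha b hb
    dsimp only at h1 h2 h3 h4
    subst h1 h2 h3 h4
    exact Submodule.mem_iSup_of_mem (k, m) (Submodule.mem_iSup_of_mem t
      (Submodule.mem_iSup_of_mem u (tmul_mem_tensorSub ha hb)))

end PartialAlgebra

namespace PartialBialgebra

variable {𝒜 : PartialAlgebra (I × I) A} (P : PartialBialgebra 𝒜)

theorem one_mul_ne {x x' y : I × I} {a : A} (ha : a ∈ 𝒜.comp x y) (h : x' ≠ x) :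
    P.one x' * a = 0 := P.units.one_mul_ne ha h

theorem mul_one_ne {x y y' : I × I} {a : A} (ha : a ∈ 𝒜.comp x y) (h : y ≠ y') :
    a * P.one y' = 0 := P.units.mul_one_ne ha h

/-- `1^q b = 0` unless `q` is the upper left index of `b`, so only one column survives and the
product is an element of `A ⊗ A`. The three variants below read the surviving index from another
corner of `b`. -/
theorem delta_mul_inr {x y : I × I} {b : A} (hb : b ∈ 𝒜.comp x y) (a : A) :
    P.delta a * inr b = ofElem ((inr b).right (P.col x.1 a)) :=
  ext_left P.locallyUnital₂ fun z => by
    rw [left_mul, left_delta, finsum_eq_single _ x.1, left_ofElem, compat]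
    intro r hr
    rw [col_mul, ← left_mul, midUnit_mul_inr P.units hb hr.symm, left_zero, mul_zero]

theorem delta_mul_inl {x y : I × I} {b : A} (hb : b ∈ 𝒜.comp x y) (a : A) :
    P.delta a * inl b = ofElem ((inl b).right (P.col x.2 a)) :=
  ext_left P.locallyUnital₂ fun z => by
    rw [left_mul, left_delta, finsum_eq_single _ x.2, left_ofElem, compat]
    intro r hr
    rw [col_mul, ← left_mul, midUnit_mul_inl P.units hb hr.symm, left_zero, mul_zero]

theorem inr_mul_delta {x y : I × I} {b : A} (hb : b ∈ 𝒜.comp x y) (a : A) :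
    inr b * P.delta a = ofElem ((inr b).left (P.row y.1 a)) :=
  ext_right P.locallyUnital₂ fun z => by
    rw [right_mul, right_delta, finsum_eq_single _ y.1, right_ofElem, compat]
    intro r hr
    rw [mul_row, ← right_mul, inr_mul_midUnit P.units hb hr.symm, right_zero, zero_mul]

theorem inl_mul_delta {x y : I × I} {b : A} (hb : b ∈ 𝒜.comp x y) (a : A) :
    inl b * P.delta a = ofElem ((inl b).left (P.row y.2 a)) :=
  ext_right P.locallyUnital₂ fun z => by
    rw [right_mul, right_delta, finsum_eq_single _ y.2, right_ofElem, compat]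
    intro r hr
    rw [mul_row, ← right_mul, inl_mul_midUnit P.units hb hr.symm, right_zero, zero_mul]

theorem delta_isRestricted (a : A) : (P.delta a).IsRestricted := by
  have hadd : ∀ m n : Multiplier (A ⊗[ℂ] A), IsElem m → IsElem n → IsElem (m + n) := by
    rintro _ _ ⟨z, rfl⟩ ⟨w, rfl⟩
    exact ⟨z + w, map_add _ _ _⟩
  have h0 : IsElem (0 : Multiplier (A ⊗[ℂ] A)) := ⟨0, map_zero _⟩
  refine ⟨fun b => ?_, fun b => ?_, fun b => ?_, fun b => ?_⟩
  · exact 𝒜.induction_on (P := fun b => IsElem (P.delta a * inl b)) b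
      (fun x y b hb => ⟨_, (P.delta_mul_inl hb a).symm⟩) (by rwa [inl_zero, mul_zero])
      (fun b c hb hc => by rw [inl_add, mul_add]; exact hadd _ _ hb hc)
  · exact 𝒜.induction_on (P := fun b => IsElem (P.delta a * inr b)) b
      (fun x y b hb => ⟨_, (P.delta_mul_inr hb a).symm⟩) (by rwa [inr_zero, mul_zero])
      (fun b c hb hc => by rw [inr_add, mul_add]; exact hadd _ _ hb hc)
  · exact 𝒜.induction_on (P := fun b => IsElem (inl b * P.delta a)) b
      (fun x y b hb => ⟨_, (P.inl_mul_delta hb a).symm⟩) (by rwa [inl_zero, zero_mul])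
      (fun b c hb hc => by rw [inl_add, add_mul]; exact hadd _ _ hb hc)
  · exact 𝒜.induction_on (P := fun b => IsElem (inr b * P.delta a)) b
      (fun x y b hb => ⟨_, (P.inr_mul_delta hb a).symm⟩) (by rwa [inr_zero, zero_mul])
      (fun b c hb hc => by rw [inr_add, add_mul]; exact hadd _ _ hb hc)

/-- Counit and invariance conditions on the multiplier `Δ(a)` are verified through this criterion,
which involves only slices of single columns and rows. -/
theorem isSliceR_delta_iff (ω : A →ₗ[ℂ] ℂ) (a : A) (m : Multiplier A) :
    IsSliceR ω (P.delta a) m ↔ ∀ x y, ∀ b ∈ 𝒜.comp x y,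
      sliceR ω (P.col x.2 a) * b = m.left b ∧ b * sliceR ω (P.row y.2 a) = m.right b := by
  constructor
  · intro h x y b hb
    rw [← sliceR_right_inl, ← sliceR_left_inl]
    exact ⟨(h b _).1 (P.delta_mul_inl hb a).symm, (h b _).2 (P.inl_mul_delta hb a).symm⟩
  · intro h b
    have hres := P.delta_isRestricted a
    have hinj := ofElem_injective P.locallyUnital₂
    refine 𝒜.induction_on (P := fun b => ∀ z, (ofElem z = P.delta a * inl b →
      sliceR ω z = m.left b) ∧ (ofElem z = inl b * P.delta a → sliceR ω z = m.right b)) b ?_ ?_ ?_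
    · intro x y b hb z
      rw [P.delta_mul_inl hb, P.inl_mul_delta hb, ← (h x y b hb).1, ← (h x y b hb).2,
        ← sliceR_right_inl, ← sliceR_left_inl]
      exact ⟨fun hz => by rw [hinj hz], fun hz => by rw [hinj hz]⟩
    · intro z
      rw [inl_zero, mul_zero, zero_mul, ← map_zero ofElem]
      exact ⟨fun hz => by rw [hinj hz]; simp, fun hz => by rw [hinj hz]; simp⟩
    · intro b c hb hc z
      rw [inl_add, mul_add, add_mul]
      constructor
      · intro hz
        -- Restrictedness of `Δ(a)` provides elements for the two summands, so that `z` splits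
        -- accordingly.
        obtain ⟨u, hu⟩ := hres.1 b
        obtain ⟨v, hv⟩ := hres.1 c
        rw [← hu, ← hv, ← map_add] at hz
        rw [hinj hz, map_add, map_add, (hb u).1 hu, (hc v).1 hv]
      · intro hz
        obtain ⟨u, hu⟩ := hres.2.2.1 b
        obtain ⟨v, hv⟩ := hres.2.2.1 c
        rw [← hu, ← hv, ← map_add] at hz
        rw [hinj hz, map_add, map_add, (hb u).2 hu, (hc v).2 hv]

theorem isSliceL_delta_iff (ω : A →ₗ[ℂ] ℂ) (a : A) (m : Multiplier A) :
    IsSliceL ω (P.delta a) m ↔ ∀ x y, ∀ b ∈ 𝒜.comp x y,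
      sliceL ω (P.col x.1 a) * b = m.left b ∧ b * sliceL ω (P.row y.1 a) = m.right b := by
  constructor
  · intro h x y b hb
    rw [← sliceL_right_inr, ← sliceL_left_inr]
    exact ⟨(h b _).1 (P.delta_mul_inr hb a).symm, (h b _).2 (P.inr_mul_delta hb a).symm⟩
  · intro h b
    have hres := P.delta_isRestricted a
    have hinj := ofElem_injective P.locallyUnital₂
    refine 𝒜.induction_on (P := fun b => ∀ z, (ofElem z = P.delta a * inr b →
      sliceL ω z = m.left b) ∧ (ofElem z = inr b * P.delta a → sliceL ω z = m.right b)) b ?_ ?_ ?_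
    · intro x y b hb z
      rw [P.delta_mul_inr hb, P.inr_mul_delta hb, ← (h x y b hb).1, ← (h x y b hb).2,
        ← sliceL_right_inr, ← sliceL_left_inr]
      exact ⟨fun hz => by rw [hinj hz], fun hz => by rw [hinj hz]⟩
    · intro z
      rw [inr_zero, mul_zero, zero_mul, ← map_zero ofElem]
      exact ⟨fun hz => by rw [hinj hz]; simp, fun hz => by rw [hinj hz]; simp⟩
    · intro b c hb hc z
      rw [inr_add, mul_add, add_mul]
      constructor
      · intro hz
        obtain ⟨u, hu⟩ := hres.2.1 b
        obtain ⟨v, hv⟩ := hres.2.1 c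
        rw [← hu, ← hv, ← map_add] at hz
        rw [hinj hz, map_add, map_add, (hb u).1 hu, (hc v).1 hv]
      · intro hz
        obtain ⟨u, hu⟩ := hres.2.2.2 b
        obtain ⟨v, hv⟩ := hres.2.2.2 c
        rw [← hu, ← hv, ← map_add] at hz
        rw [hinj hz, map_add, map_add, (hb u).2 hu, (hc v).2 hv]

theorem col_one (q k m : I) : P.col q (P.one (k, m)) = P.one (k, q) ⊗ₜ P.one (q, m) := by
  rw [col, lfSum_eq_single _ _ _ q fun r hr => P.comul_one_ne k r q m hr, comul_one_same]

theorem row_one (p k m : I) : P.row p (P.one (k, m)) = P.one (k, p) ⊗ₜ P.one (p, m) := by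
  rw [row, lfSum_eq_single _ _ _ p fun r hr => P.comul_one_ne k p r m hr.symm, comul_one_same]

-- `Δ(1(k,m))` is the strict sum of the `1(k,q) ⊗ 1(q,m)`; on a tensor with left inner index `p`
-- only the term `q = p` can act.
open Classical in
theorem left_delta_one (k m : I) {x y x' y' : I × I} {a b : A} (ha : a ∈ 𝒜.comp x y)
    (hb : b ∈ 𝒜.comp x' y') : (P.delta (P.one (k, m))).left (a ⊗ₜ b) =
      if x.1 = k ∧ x'.2 = m ∧ x.2 = x'.1 then a ⊗ₜ b else 0 := by
  obtain ⟨k', p⟩ := x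
  obtain ⟨p', m'⟩ := x'
  rw [left_delta, finsum_eq_single _ p]
  · rw [col_one, Algebra.TensorProduct.tmul_mul_tmul]
    split_ifs with h
    · obtain ⟨h1, h2, h3⟩ := h
      dsimp only at h1 h2 h3
      subst h1 h2 h3
      rw [P.one_mul _ _ _ ha, P.one_mul _ _ _ hb]
    · by_cases h1 : k' = k
      · rw [P.one_mul_ne (a := b) (x' := (p, m)) hb, TensorProduct.tmul_zero]
        intro h'
        simp only [Prod.mk.injEq] at h'
        exact h ⟨h1, h'.2.symm, h'.1⟩
      · rw [P.one_mul_ne (a := a) (x' := (k, p)) ha, TensorProduct.zero_tmul]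
        intro h'
        simp only [Prod.mk.injEq] at h'
        exact h1 h'.1.symm
  · intro r hr
    rw [col_one, Algebra.TensorProduct.tmul_mul_tmul,
      P.one_mul_ne (a := a) (x' := (k, r)) ha, TensorProduct.zero_tmul]
    intro h'
    simp only [Prod.mk.injEq] at h'
    exact hr h'.2

open Classical in
theorem right_delta_one (k m : I) {x y x' y' : I × I} {a b : A} (ha : a ∈ 𝒜.comp x y)
    (hb : b ∈ 𝒜.comp x' y') : (P.delta (P.one (k, m))).right (a ⊗ₜ b) =
      if y.1 = k ∧ y'.2 = m ∧ y.2 = y'.1 then a ⊗ₜ b else 0 := by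
  obtain ⟨k', p⟩ := y
  obtain ⟨p', m'⟩ := y'
  rw [right_delta, finsum_eq_single _ p]
  · rw [row_one, Algebra.TensorProduct.tmul_mul_tmul]
    split_ifs with h
    · obtain ⟨h1, h2, h3⟩ := h
      dsimp only at h1 h2 h3
      subst h1 h2 h3
      rw [P.mul_one _ _ _ ha, P.mul_one _ _ _ hb]
    · by_cases h1 : k' = k
      · rw [P.mul_one_ne (a := b) (y' := (p, m)) hb, TensorProduct.tmul_zero]
        intro h'
        simp only [Prod.mk.injEq] at h'
        exact h ⟨h1, h'.2, h'.1.symm⟩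
      · rw [P.mul_one_ne (a := a) (y' := (k, p)) ha, TensorProduct.zero_tmul]
        intro h'
        simp only [Prod.mk.injEq] at h'
        exact h1 h'.1
  · intro r hr
    rw [row_one, Algebra.TensorProduct.tmul_mul_tmul,
      P.mul_one_ne (a := a) (y' := (k, r)) ha, TensorProduct.zero_tmul]
    intro h'
    simp only [Prod.mk.injEq] at h'
    exact hr h'.2.symm

theorem left_delta_eq_zero {u v x y x' y' : I × I} {a b c : A} (hc : c ∈ 𝒜.comp u v)
    (ha : a ∈ 𝒜.comp x y) (hb : b ∈ 𝒜.comp x' y')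
    (h : ¬ (x.1 = v.1 ∧ x'.2 = v.2 ∧ x.2 = x'.1)) : (P.delta c).left (a ⊗ₜ b) = 0 := by
  classical
  rw [← P.mul_one _ _ _ hc, delta_mul, left_mul, ← Prod.mk.eta (p := v), left_delta_one P _ _ ha hb,
    if_neg h, map_zero]

theorem one_mul_of_mem_leftPart {p : I × I} {a : A} (ha : a ∈ 𝒜.leftPart {p}) :
    P.one p * a = a := by
  rw [leftPart_eq] at ha
  refine (part_le (W := LinearMap.eqLocus (LinearMap.mulLeft ℂ (P.one p)) LinearMap.id)).2 ?_ ha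
  intro r s h a ha'
  rw [Set.mem_ofPred_eq, Set.mem_singleton_iff] at h
  dsimp only at h
  subst h
  exact P.one_mul _ _ _ ha'

theorem mul_one_of_mem_rightPart {p : I × I} {a : A} (ha : a ∈ 𝒜.rightPart {p}) :
    a * P.one p = a := by
  rw [rightPart_eq] at ha
  refine (part_le (W := LinearMap.eqLocus (LinearMap.mulRight ℂ (P.one p)) LinearMap.id)).2 ?_ ha
  intro r s h a ha'
  rw [Set.mem_ofPred_eq, Set.mem_singleton_iff] at h
  dsimp only at h
  subst h
  exact P.mul_one _ _ _ ha'

theorem one_mem_leftPart (p : I × I) : P.one p ∈ 𝒜.leftPart {p} := by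
  rw [leftPart_eq]
  exact comp_le_part (by simp) (P.one_mem p)

theorem one_mem_rightPart (p : I × I) : P.one p ∈ 𝒜.rightPart {p} := by
  rw [rightPart_eq]
  exact comp_le_part (by simp) (P.one_mem p)

theorem finsum_mul_mem_corner_right (a : A) {x : A ⊗[ℂ] A}
    (hx : x ∈ 𝒜.pairSpan fun p p' => p.2.2 = p'.2.1) :
    (P.delta a).left x ∈ 𝒜.pairSpan fun p p' => p.2.2 = p'.2.1 :=
  finsum_induction (· ∈ 𝒜.pairSpan fun p p' => p.2.2 = p'.2.1) (Submodule.zero_mem _)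
    (fun _ _ => Submodule.add_mem _) fun _ => mul_mem_corner_right hx _

theorem finsum_mul_mem_corner_left (a : A) {x : A ⊗[ℂ] A}
    (hx : x ∈ 𝒜.pairSpan fun p p' => p.1.2 = p'.1.1) :
    (P.delta a).right x ∈ 𝒜.pairSpan fun p p' => p.1.2 = p'.1.1 :=
  finsum_induction (· ∈ 𝒜.pairSpan fun p p' => p.1.2 = p'.1.1) (Submodule.zero_mem _)
    (fun _ _ => Submodule.add_mem _) fun _ => mul_mem_corner_left hx _

/-- `Δ(1(p))` acts as the projection onto `_pB` inside the corner. One inclusion follows from `Δ(a)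
= Δ(1(p))Δ(a)`, the other from taking `a = 1(p)`. -/
theorem delta_morphism_left (p : I × I) :
    Submodule.span ℂ {y | ∃ x ∈ ⨆ q, 𝒜.tensorComp p q, ∃ a ∈ 𝒜.leftPart {p},
      y = (P.delta a).left x} = ⨆ q, 𝒜.tensorComp p q := by
  classical
  rw [iSup_tensorComp_left]
  refine le_antisymm (Submodule.span_le.2 ?_) fun x hx => ?_
  · rintro _ ⟨x, hx, a, ha, rfl⟩
    rw [← P.one_mul_of_mem_leftPart ha, delta_mul, left_mul]
    have h := P.finsum_mul_mem_corner_right a (pairSpan_mono (fun _ _ h => h.2.2) hx)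
    refine map_mem_of_mem_pairSpan (P.delta (P.one p)).left ?_ h
    intro u v u' v' h a ha b hb
    rw [← Prod.mk.eta (p := p), left_delta_one P _ _ ha hb]
    split_ifs with h'
    · exact tmul_mem_pairSpan ha hb ⟨⟨h'.1, h'.2.1⟩, h'.2.2, h⟩
    · exact Submodule.zero_mem _
  · refine Submodule.subset_span ⟨x, hx, P.one p, P.one_mem_leftPart p, ?_⟩
    refine (eqOn_pairSpan (f := (P.delta (P.one p)).left) (g := LinearMap.id) ?_ hx).symm
    intro u v u' v' h a ha b hb
    rw [← Prod.mk.eta (p := p), left_delta_one P _ _ ha hb, if_pos ⟨h.1.1, h.1.2, h.2.1⟩]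
    rfl

theorem delta_morphism_right (q : I × I) :
    Submodule.span ℂ {y | ∃ x ∈ ⨆ p, 𝒜.tensorComp p q, ∃ a ∈ 𝒜.rightPart {q},
      y = (P.delta a).right x} = ⨆ p, 𝒜.tensorComp p q := by
  classical
  rw [iSup_tensorComp_right]
  refine le_antisymm (Submodule.span_le.2 ?_) fun x hx => ?_
  · rintro _ ⟨x, hx, a, ha, rfl⟩
    rw [← P.mul_one_of_mem_rightPart ha, delta_mul, right_mul]
    have h := P.finsum_mul_mem_corner_left a (pairSpan_mono (fun _ _ h => h.2.1) hx)
    refine map_mem_of_mem_pairSpan (P.delta (P.one q)).right ?_ h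
    intro u v u' v' h a ha b hb
    rw [← Prod.mk.eta (p := q), right_delta_one P _ _ ha hb]
    split_ifs with h'
    · exact tmul_mem_pairSpan ha hb ⟨⟨h'.1, h'.2.1⟩, h, h'.2.2⟩
    · exact Submodule.zero_mem _
  · refine Submodule.subset_span ⟨x, hx, P.one q, P.one_mem_rightPart q, ?_⟩
    refine (eqOn_pairSpan (f := (P.delta (P.one q)).right) (g := LinearMap.id) ?_ hx).symm
    intro u v u' v' h a ha b hb
    rw [← Prod.mk.eta (p := q), right_delta_one P _ _ ha hb, if_pos ⟨h.1.1, h.1.2, h.2.2⟩]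
    rfl

end PartialBialgebra

end PartialQG

/-! ### Coassociativity of the multiplier `Δ(a)`. -/

namespace PartialQG

open Multiplier PartialAlgebra

namespace Multiplier

variable {B C : Type*} [NonUnitalRing B] [Module ℂ B] [IsScalarTower ℂ B B] [SMulCommClass ℂ B B]
  [NonUnitalRing C] [Module ℂ C] [IsScalarTower ℂ C C] [SMulCommClass ℂ C C]

/-- Evaluation of left multiplications, as a linear map in the multiplier. -/
def leftEval (x : C) : Multiplier C →ₗ[ℂ] C where
  toFun m := m.left x
  map_add' _ _ := rfl
  map_smul' _ _ := rfl

/-- Evaluation of right multiplications, as a linear map in the multiplier. -/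
def rightEval (x : C) : Multiplier C →ₗ[ℂ] C where
  toFun m := m.right x
  map_add' _ _ := rfl
  map_smul' _ _ := rfl

/-- If `m = ∑ z_i` strictly, multiplicativity gives `∑ f(z_i) f(d) = ∑ f(z_i d) = f(m d)`, where the
last sum is finite. The extension of `f` is thus computed termwise. -/
theorem isExtensionValue_lfSum {ι : Type*} (f : B →ₗ[ℂ] Multiplier C)
    (hf : ∀ x y, f (x * y) = f x * f y) (z : ι → B) (hl hr hl' hr') (D : Submodule ℂ B) :
    IsExtensionValue f D (Multiplier.lfSum (fun i => ofElem (z i)) hl hr)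
      (Multiplier.lfSum (fun i => f (z i)) hl' hr') := by
  intro d _
  have h1 : ∀ x, (f ((Multiplier.lfSum (fun i => ofElem (z i)) hl hr).left d)).left x =
      ∑ᶠ i, (f (z i * d)).left x := fun x =>
    map_finsum (leftEval x ∘ₗ f) (hl d)
  have h2 : ∀ x, (f ((Multiplier.lfSum (fun i => ofElem (z i)) hl hr).left d)).right x =
      ∑ᶠ i, (f (z i * d)).right x := fun x =>
    map_finsum (rightEval x ∘ₗ f) (hl d)
  have h3 : ∀ x, (f ((Multiplier.lfSum (fun i => ofElem (z i)) hl hr).right d)).left x =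
      ∑ᶠ i, (f (d * z i)).left x := fun x =>
    map_finsum (leftEval x ∘ₗ f) (hr d)
  have h4 : ∀ x, (f ((Multiplier.lfSum (fun i => ofElem (z i)) hl hr).right d)).right x =
      ∑ᶠ i, (f (d * z i)).right x := fun x =>
    map_finsum (rightEval x ∘ₗ f) (hr d)
  constructor
  · refine ext' (fun x => ?_) fun x => ?_
    · rw [h1, left_mul, left_lfSum]
      simp only [hf, left_mul]
    · rw [h2, right_mul, right_lfSum, map_finsum _ (hr' x)]
      simp only [hf, right_mul]
  · refine ext' (fun x => ?_) fun x => ?_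
    · rw [h3, left_mul, left_lfSum, map_finsum _ (hl' x)]
      simp only [hf, left_mul]
    · rw [h4, right_mul, right_lfSum]
      simp only [hf, right_mul]

end Multiplier

variable {I A : Type*} [NonUnitalRing A] [Module ℂ A] [IsScalarTower ℂ A A] [SMulCommClass ℂ A A]

theorem comulId_tmul (Δ : A →ₗ[ℂ] Multiplier (A ⊗[ℂ] A)) (x y : A) :
    comulId Δ (x ⊗ₜ y) = tmul (Δ x) (ofElem y) := rfl

theorem idComul_tmul (Δ : A →ₗ[ℂ] Multiplier (A ⊗[ℂ] A)) (x y : A) :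
    idComul Δ (x ⊗ₜ y) = tmul (ofElem x) (Δ y) := rfl

theorem comulId_mul (Δ : A →ₙₐ[ℂ] Multiplier (A ⊗[ℂ] A)) (x y : A ⊗[ℂ] A) :
    comulId (Δ : A →ₗ[ℂ] Multiplier (A ⊗[ℂ] A)) (x * y) =
      comulId (Δ : A →ₗ[ℂ] Multiplier (A ⊗[ℂ] A)) x * comulId (Δ : A →ₗ[ℂ] _) y := by
  induction x using TensorProduct.induction_on with
  | zero => simp
  | add x₁ x₂ h₁ h₂ => simp only [add_mul, map_add, h₁, h₂]
  | tmul a b =>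
    induction y using TensorProduct.induction_on with
    | zero => simp
    | add y₁ y₂ h₁ h₂ => simp only [mul_add, map_add, h₁, h₂]
    | tmul c d =>
      rw [Algebra.TensorProduct.tmul_mul_tmul, comulId_tmul, comulId_tmul, comulId_tmul, ← tmul_mul,
        ofElem_mul]
      congr 2
      exact map_mul Δ a c

theorem idComul_mul (Δ : A →ₙₐ[ℂ] Multiplier (A ⊗[ℂ] A)) (x y : A ⊗[ℂ] A) :
    idComul (Δ : A →ₗ[ℂ] Multiplier (A ⊗[ℂ] A)) (x * y) =
      idComul (Δ : A →ₗ[ℂ] Multiplier (A ⊗[ℂ] A)) x * idComul (Δ : A →ₗ[ℂ] _) y := by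
  induction x using TensorProduct.induction_on with
  | zero => simp
  | add x₁ x₂ h₁ h₂ => simp only [add_mul, map_add, h₁, h₂]
  | tmul a b =>
    induction y using TensorProduct.induction_on with
    | zero => simp
    | add y₁ y₂ h₁ h₂ => simp only [mul_add, map_add, h₁, h₂]
    | tmul c d =>
      rw [Algebra.TensorProduct.tmul_mul_tmul, idComul_tmul, idComul_tmul, idComul_tmul, ← tmul_mul,
        ofElem_mul]
      congr 1
      exact map_mul Δ b d

namespace PartialBialgebra

variable {𝒜 : PartialAlgebra (I × I) A} (P : PartialBialgebra 𝒜)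

/-- The comultiplication as a linear map. -/
noncomputable abbrev deltaLin : A →ₗ[ℂ] Multiplier (A ⊗[ℂ] A) := (P.deltaHom : A →ₗ[ℂ] _)

section vanishing

variable (Δ : A →ₗ[ℂ] Multiplier (A ⊗[ℂ] A)) {x y : I × I} {c : A} (w : A ⊗[ℂ] A)

/-- One homogeneous leg fixes one of the two indices of `Δ_pq(a)`; the finiteness axiom then
controls the other. These four statements give strict convergence of `(Δ ⊗ id)Δ(a)` and `(id ⊗
Δ)Δ(a)`. -/
theorem comulId_left_eq_zero (hc : c ∈ 𝒜.comp x y) {s : I} (h : s ≠ x.1) (z : A ⊗[ℂ] A) :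
    (comulId Δ ((𝒜.midUnit s).right z)).left (w ⊗ₜ c) = 0 := by
  classical
  have : leftEval (w ⊗ₜ c) ∘ₗ comulId Δ ∘ₗ (𝒜.midUnit s).right = 0 :=
    𝒜.tensor_ext fun u v u' v' a ha b hb => by
      rw [LinearMap.comp_apply, LinearMap.comp_apply, right_midUnit_tmul ha hb]
      split_ifs with h'
      · change TensorProduct.map (Δ a).left (ofElem b).left (w ⊗ₜ c) = _
        rw [TensorProduct.map_tmul, left_ofElem, 𝒜.mul_eq_zero hb hc, TensorProduct.tmul_zero]
        · rfl
        · rintro rfl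
          exact h h'.2.symm
      · simp
  exact LinearMap.congr_fun this z

theorem comulId_right_eq_zero (hc : c ∈ 𝒜.comp x y) {s : I} (h : s ≠ y.1) (z : A ⊗[ℂ] A) :
    (comulId Δ ((𝒜.midUnit s).left z)).right (w ⊗ₜ c) = 0 := by
  classical
  have : rightEval (w ⊗ₜ c) ∘ₗ comulId Δ ∘ₗ (𝒜.midUnit s).left = 0 :=
    𝒜.tensor_ext fun u v u' v' a ha b hb => by
      rw [LinearMap.comp_apply, LinearMap.comp_apply, left_midUnit_tmul ha hb]
      split_ifs with h'
      · change TensorProduct.map (Δ a).right (ofElem b).right (w ⊗ₜ c) = _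
        rw [TensorProduct.map_tmul, right_ofElem, 𝒜.mul_eq_zero hc hb, TensorProduct.tmul_zero]
        · rfl
        · rintro rfl
          exact h h'.2.symm
      · simp
  exact LinearMap.congr_fun this z

theorem idComul_left_eq_zero (hc : c ∈ 𝒜.comp x y) {s : I} (h : s ≠ x.2) (z : A ⊗[ℂ] A) :
    (idComul Δ ((𝒜.midUnit s).right z)).left (c ⊗ₜ w) = 0 := by
  classical
  have : leftEval (c ⊗ₜ w) ∘ₗ idComul Δ ∘ₗ (𝒜.midUnit s).right = 0 :=
    𝒜.tensor_ext fun u v u' v' a ha b hb => by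
      rw [LinearMap.comp_apply, LinearMap.comp_apply, right_midUnit_tmul ha hb]
      split_ifs with h'
      · change TensorProduct.map (ofElem a).left (Δ b).left (c ⊗ₜ w) = _
        rw [TensorProduct.map_tmul, left_ofElem, 𝒜.mul_eq_zero ha hc, TensorProduct.zero_tmul]
        · rfl
        · rintro rfl
          exact h h'.1.symm
      · simp
  exact LinearMap.congr_fun this z

theorem idComul_right_eq_zero (hc : c ∈ 𝒜.comp x y) {s : I} (h : s ≠ y.2) (z : A ⊗[ℂ] A) :
    (idComul Δ ((𝒜.midUnit s).left z)).right (c ⊗ₜ w) = 0 := by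
  classical
  have : rightEval (c ⊗ₜ w) ∘ₗ idComul Δ ∘ₗ (𝒜.midUnit s).left = 0 :=
    𝒜.tensor_ext fun u v u' v' a ha b hb => by
      rw [LinearMap.comp_apply, LinearMap.comp_apply, left_midUnit_tmul ha hb]
      split_ifs with h'
      · change TensorProduct.map (ofElem a).right (Δ b).right (c ⊗ₜ w) = _
        rw [TensorProduct.map_tmul, right_ofElem, 𝒜.mul_eq_zero hc ha, TensorProduct.zero_tmul]
        · rfl
        · rintro rfl
          exact h h'.1.symm
      · simp
  exact LinearMap.congr_fun this z

end vanishing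

theorem right_midUnit_comul_self (p q : I) (a : A) :
    (𝒜.midUnit q).right (P.comul p q a) = P.comul p q a := by
  classical rw [right_midUnit_comul, if_pos rfl]

theorem left_midUnit_comul_self (p q : I) (a : A) :
    (𝒜.midUnit p).left (P.comul p q a) = P.comul p q a := by
  classical rw [left_midUnit_comul, if_pos rfl]

section finiteness

variable {K : Type*} [AddCommGroup K] [Module ℂ K] (a : A)

/-- The pair `i` is `(q, p)` in this order, so that `finsum_curry` sums over `p` on the inside and
produces a column. -/
theorem finite_pairs_left (f : A ⊗[ℂ] A →ₗ[ℂ] K) (s : I)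
    (h : ∀ s', s' ≠ s → ∀ z, f ((𝒜.midUnit s').right z) = 0) :
    {i : I × I | f (P.comul i.2 i.1 a) ≠ 0}.Finite := by
  refine ((P.finite_left a s).image (Prod.mk s)).subset ?_
  rintro ⟨s', r⟩ hi
  have hs : s' = s := by
    by_contra hs
    refine hi ?_
    dsimp only
    rw [← right_midUnit_comul_self, h s' hs]
  subst hs
  exact ⟨r, fun h0 => hi (by dsimp only; rw [h0, map_zero]), rfl⟩

theorem finite_pairs_right (f : A ⊗[ℂ] A →ₗ[ℂ] K) (r : I)
    (h : ∀ r', r' ≠ r → ∀ z, f ((𝒜.midUnit r').left z) = 0) :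
    {i : I × I | f (P.comul i.2 i.1 a) ≠ 0}.Finite := by
  refine ((P.finite_right a r).image (fun s => (s, r))).subset ?_
  rintro ⟨s, r'⟩ hi
  have hs : r' = r := by
    by_contra hs
    refine hi ?_
    dsimp only
    rw [← left_midUnit_comul_self, h r' hs]
  subst hs
  exact ⟨s, fun h0 => hi (by dsimp only; rw [h0, map_zero]), rfl⟩

theorem finsum_pairs_left (f : A ⊗[ℂ] A →ₗ[ℂ] K) (s : I)
    (h : ∀ s', s' ≠ s → ∀ z, f ((𝒜.midUnit s').right z) = 0) :
    ∑ᶠ i : I × I, f (P.comul i.2 i.1 a) = f (P.col s a) := by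
  rw [finsum_curry _ (P.finite_pairs_left a f s h), finsum_eq_single _ s]
  · exact (map_finsum f (P.finite_left a s)).symm
  · intro s' hs
    refine finsum_eq_zero_of_forall_eq_zero fun r => ?_
    rw [← right_midUnit_comul_self, h s' hs]

end finiteness

theorem finite_comul_mul (a : A) (x : A ⊗[ℂ] A) :
    {i : I × I | (ofElem (P.comul i.2 i.1 a)).left x ≠ 0}.Finite := by
  classical
  refine 𝒜.tensor_induction
    (P := fun x => {i : I × I | (ofElem (P.comul i.2 i.1 a)).left x ≠ 0}.Finite) x ?_ (by simp)
    fun x y hx hy => finite_add (f := fun i : I × I => (ofElem (P.comul i.2 i.1 a)).left) hx hy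
  intro x y x' y' c hc d hd
  refine P.finite_pairs_left a (LinearMap.mulRight ℂ (c ⊗ₜ d)) x.2 fun s hs z => ?_
  rw [LinearMap.mulRight_apply, ← compat, left_midUnit_tmul hc hd, if_neg fun h => hs h.1.symm,
    mul_zero]

theorem finite_mul_comul (a : A) (x : A ⊗[ℂ] A) :
    {i : I × I | (ofElem (P.comul i.2 i.1 a)).right x ≠ 0}.Finite := by
  classical
  refine 𝒜.tensor_induction
    (P := fun x => {i : I × I | (ofElem (P.comul i.2 i.1 a)).right x ≠ 0}.Finite) x ?_ (by simp)
    fun x y hx hy => finite_add (f := fun i : I × I => (ofElem (P.comul i.2 i.1 a)).right) hx hy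
  intro x y x' y' c hc d hd
  refine P.finite_pairs_right a (LinearMap.mulLeft ℂ (c ⊗ₜ d)) y.2 fun s hs z => ?_
  rw [LinearMap.mulLeft_apply, compat, right_midUnit_tmul hc hd, if_neg fun h => hs h.1.symm,
    zero_mul]

/-- Presents `Δ(a)` as a strict sum of elements of `A ⊗ A`, the form required by
`isExtensionValue_lfSum`. -/
theorem delta_eq_lfSum (a : A) : P.delta a =
    Multiplier.lfSum (fun i : I × I => ofElem (P.comul i.2 i.1 a)) (P.finite_comul_mul a)
      (P.finite_mul_comul a) :=
  ext_left P.locallyUnital₂ fun x => by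
    classical
    refine 𝒜.tensor_induction (P := fun x => (P.delta a).left x = (Multiplier.lfSum
      (fun i : I × I => ofElem (P.comul i.2 i.1 a)) (P.finite_comul_mul a)
      (P.finite_mul_comul a)).left x) x ?_ (by simp) fun x y hx hy => by rw [map_add, map_add, hx, hy]
    intro x y x' y' c hc d hd
    have h1 : ∀ s, s ≠ x.2 → ∀ z, LinearMap.mulRight ℂ (c ⊗ₜ[ℂ] d) ((𝒜.midUnit s).right z) = 0 := by
      intro s hs z
      rw [LinearMap.mulRight_apply, ← compat, left_midUnit_tmul hc hd, if_neg fun h => hs h.1.symm,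
        mul_zero]
    have h2 := P.finsum_pairs_left a (LinearMap.mulRight ℂ (c ⊗ₜ[ℂ] d)) x.2 h1
    simp only [LinearMap.mulRight_apply] at h2
    rw [left_lfSum]
    simp only [left_ofElem]
    rw [h2, left_delta, finsum_eq_single _ x.2]
    intro r hr
    rw [col_mul, left_midUnit_tmul hc hd, if_neg fun h => hr h.1.symm, mul_zero]

theorem finite_comulId_left (a : A) (w : (A ⊗[ℂ] A) ⊗[ℂ] A) :
    {i : I × I | (comulId P.deltaLin (P.comul i.2 i.1 a)).left w ≠ 0}.Finite := by
  refine finite_of_tmul (fun i : I × I => (comulId P.deltaLin (P.comul i.2 i.1 a)).left)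
    (fun w c => ?_) w
  refine 𝒜.induction_on (P := fun c => {i : I × I |
      (comulId P.deltaLin (P.comul i.2 i.1 a)).left (w ⊗ₜ c) ≠ 0}.Finite) c ?_ (by simp)
    fun c d hc hd => by
      simp only [TensorProduct.tmul_add]
      exact finite_add (f := fun i : I × I => (comulId P.deltaLin (P.comul i.2 i.1 a)).left) hc hd
  intro x y c hc
  exact P.finite_pairs_left a (leftEval (w ⊗ₜ c) ∘ₗ comulId P.deltaLin) x.1
    fun s hs z => comulId_left_eq_zero P.deltaLin w hc hs z

theorem finite_comulId_right (a : A) (w : (A ⊗[ℂ] A) ⊗[ℂ] A) :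
    {i : I × I | (comulId P.deltaLin (P.comul i.2 i.1 a)).right w ≠ 0}.Finite := by
  refine finite_of_tmul (fun i : I × I => (comulId P.deltaLin (P.comul i.2 i.1 a)).right)
    (fun w c => ?_) w
  refine 𝒜.induction_on (P := fun c => {i : I × I |
      (comulId P.deltaLin (P.comul i.2 i.1 a)).right (w ⊗ₜ c) ≠ 0}.Finite) c ?_ (by simp)
    fun c d hc hd => by
      simp only [TensorProduct.tmul_add]
      exact finite_add (f := fun i : I × I => (comulId P.deltaLin (P.comul i.2 i.1 a)).right) hc hd
  intro x y c hc
  exact P.finite_pairs_right a (rightEval (w ⊗ₜ c) ∘ₗ comulId P.deltaLin) y.1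
    fun s hs z => comulId_right_eq_zero P.deltaLin w hc hs z

theorem finite_idComul_left (a : A) (w : A ⊗[ℂ] (A ⊗[ℂ] A)) :
    {i : I × I | (idComul P.deltaLin (P.comul i.2 i.1 a)).left w ≠ 0}.Finite := by
  refine finite_of_tmul (fun i : I × I => (idComul P.deltaLin (P.comul i.2 i.1 a)).left)
    (fun c w => ?_) w
  refine 𝒜.induction_on (P := fun c => {i : I × I |
      (idComul P.deltaLin (P.comul i.2 i.1 a)).left (c ⊗ₜ w) ≠ 0}.Finite) c ?_ (by simp)
    fun c d hc hd => by
      simp only [TensorProduct.add_tmul]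
      exact finite_add (f := fun i : I × I => (idComul P.deltaLin (P.comul i.2 i.1 a)).left) hc hd
  intro x y c hc
  exact P.finite_pairs_left a (leftEval (c ⊗ₜ w) ∘ₗ idComul P.deltaLin) x.2
    fun s hs z => idComul_left_eq_zero P.deltaLin w hc hs z

theorem finite_idComul_right (a : A) (w : A ⊗[ℂ] (A ⊗[ℂ] A)) :
    {i : I × I | (idComul P.deltaLin (P.comul i.2 i.1 a)).right w ≠ 0}.Finite := by
  refine finite_of_tmul (fun i : I × I => (idComul P.deltaLin (P.comul i.2 i.1 a)).right)
    (fun c w => ?_) w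
  refine 𝒜.induction_on (P := fun c => {i : I × I |
      (idComul P.deltaLin (P.comul i.2 i.1 a)).right (c ⊗ₜ w) ≠ 0}.Finite) c ?_ (by simp)
    fun c d hc hd => by
      simp only [TensorProduct.add_tmul]
      exact finite_add (f := fun i : I × I => (idComul P.deltaLin (P.comul i.2 i.1 a)).right) hc hd
  intro x y c hc
  exact P.finite_pairs_right a (rightEval (c ⊗ₜ w) ∘ₗ idComul P.deltaLin) y.2
    fun s hs z => idComul_right_eq_zero P.deltaLin w hc hs z

/-- `(Δ ⊗ id)Δ(a)` as a multiplier. -/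
noncomputable def comulIdDelta (a : A) : Multiplier ((A ⊗[ℂ] A) ⊗[ℂ] A) :=
  Multiplier.lfSum (fun i : I × I => comulId P.deltaLin (P.comul i.2 i.1 a))
    (P.finite_comulId_left a) (P.finite_comulId_right a)

/-- `(id ⊗ Δ)Δ(a)` as a multiplier. -/
noncomputable def idComulDelta (a : A) : Multiplier (A ⊗[ℂ] (A ⊗[ℂ] A)) :=
  Multiplier.lfSum (fun i : I × I => idComul P.deltaLin (P.comul i.2 i.1 a))
    (P.finite_idComul_left a) (P.finite_idComul_right a)

section homogeneous

variable {x y x' y' x'' y'' : I × I} {c c' c'' : A} (hc : c ∈ 𝒜.comp x y) (hc' : c' ∈ 𝒜.comp x' y')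
  (hc'' : c'' ∈ 𝒜.comp x'' y'')
include hc hc' hc''

theorem left_comulIdDelta (a : A) :
    (P.comulIdDelta a).left ((c ⊗ₜ[ℂ] c') ⊗ₜ[ℂ] c'') =
      (comulId P.deltaLin (P.col x''.1 a)).left ((c ⊗ₜ[ℂ] c') ⊗ₜ[ℂ] c'') :=
  P.finsum_pairs_left a (leftEval ((c ⊗ₜ[ℂ] c') ⊗ₜ[ℂ] c'') ∘ₗ comulId P.deltaLin) x''.1
    fun _ hs z => comulId_left_eq_zero P.deltaLin _ hc'' hs z

theorem left_idComulDelta (a : A) :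
    (P.idComulDelta a).left (c ⊗ₜ[ℂ] (c' ⊗ₜ[ℂ] c'')) =
      (idComul P.deltaLin (P.col x.2 a)).left (c ⊗ₜ[ℂ] (c' ⊗ₜ[ℂ] c'')) :=
  P.finsum_pairs_left a (leftEval (c ⊗ₜ[ℂ] (c' ⊗ₜ[ℂ] c'')) ∘ₗ idComul P.deltaLin) x.2
    fun _ hs z => idComul_left_eq_zero P.deltaLin _ hc hs z

theorem left_delta_tmul (a : A) (h : x.2 = x'.1) :
    (P.delta a).left (c ⊗ₜ[ℂ] c') = P.col x.2 a * (c ⊗ₜ[ℂ] c') := by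
  classical
  rw [← left_delta_midUnit, left_midUnit_tmul hc hc', if_pos ⟨rfl, h.symm⟩]

theorem comulId_left_tmul (h : x.2 = x'.1) (z : A ⊗[ℂ] A) :
    (comulId P.deltaLin z).left ((c ⊗ₜ[ℂ] c') ⊗ₜ[ℂ] c'') =
      (P.col x.2).rTensor A z * ((c ⊗ₜ[ℂ] c') ⊗ₜ[ℂ] c'') := by
  have : leftEval ((c ⊗ₜ[ℂ] c') ⊗ₜ[ℂ] c'') ∘ₗ comulId P.deltaLin =
      LinearMap.mulRight ℂ ((c ⊗ₜ[ℂ] c') ⊗ₜ[ℂ] c'') ∘ₗ (P.col x.2).rTensor A :=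
    TensorProduct.ext' fun a b => by
      change TensorProduct.map (P.delta a).left (ofElem b).left ((c ⊗ₜ[ℂ] c') ⊗ₜ[ℂ] c'') = _
      rw [TensorProduct.map_tmul, P.left_delta_tmul hc hc' hc'' a h]
      simp [left_ofElem, Algebra.TensorProduct.tmul_mul_tmul]
  exact LinearMap.congr_fun this z

theorem idComul_left_tmul (h : x'.2 = x''.1) (z : A ⊗[ℂ] A) :
    (idComul P.deltaLin z).left (c ⊗ₜ[ℂ] (c' ⊗ₜ[ℂ] c'')) =
      (P.col x'.2).lTensor A z * (c ⊗ₜ[ℂ] (c' ⊗ₜ[ℂ] c'')) := by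
  have : leftEval (c ⊗ₜ[ℂ] (c' ⊗ₜ[ℂ] c'')) ∘ₗ idComul P.deltaLin =
      LinearMap.mulRight ℂ (c ⊗ₜ[ℂ] (c' ⊗ₜ[ℂ] c'')) ∘ₗ (P.col x'.2).lTensor A :=
    TensorProduct.ext' fun a b => by
      change TensorProduct.map (ofElem a).left (P.delta b).left (c ⊗ₜ[ℂ] (c' ⊗ₜ[ℂ] c'')) = _
      rw [TensorProduct.map_tmul, P.left_delta_tmul hc' hc'' hc b h]
      simp [left_ofElem, Algebra.TensorProduct.tmul_mul_tmul]
  exact LinearMap.congr_fun this z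

theorem comulId_left_tmul_eq_zero (s : I) (h : x.2 ≠ x'.1 ∨ x'.2 ≠ s) (z : A ⊗[ℂ] A) :
    (comulId P.deltaLin ((𝒜.midUnit s).right z)).left ((c ⊗ₜ[ℂ] c') ⊗ₜ[ℂ] c'') = 0 := by
  classical
  have : leftEval ((c ⊗ₜ[ℂ] c') ⊗ₜ[ℂ] c'') ∘ₗ comulId P.deltaLin ∘ₗ (𝒜.midUnit s).right = 0 :=
    𝒜.tensor_ext fun u v u' v' a ha b hb => by
      rw [LinearMap.comp_apply, LinearMap.comp_apply, right_midUnit_tmul ha hb]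
      split_ifs with h'
      · change TensorProduct.map (P.delta a).left (ofElem b).left ((c ⊗ₜ[ℂ] c') ⊗ₜ[ℂ] c'') = _
        rw [TensorProduct.map_tmul, P.left_delta_eq_zero ha hc hc', TensorProduct.zero_tmul]
        · rfl
        · rintro ⟨-, h1, h2⟩
          rcases h with h | h
          · exact h h2
          · exact h (h1.trans h'.1)
      · simp
  exact LinearMap.congr_fun this z

theorem idComul_left_tmul_eq_zero (q : I) (h : x'.2 ≠ x''.1 ∨ x'.1 ≠ q) (z : A ⊗[ℂ] A) :
    (idComul P.deltaLin ((𝒜.midUnit q).right z)).left (c ⊗ₜ[ℂ] (c' ⊗ₜ[ℂ] c'')) = 0 := by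
  classical
  have : leftEval (c ⊗ₜ[ℂ] (c' ⊗ₜ[ℂ] c'')) ∘ₗ idComul P.deltaLin ∘ₗ (𝒜.midUnit q).right = 0 :=
    𝒜.tensor_ext fun u v u' v' a ha b hb => by
      rw [LinearMap.comp_apply, LinearMap.comp_apply, right_midUnit_tmul ha hb]
      split_ifs with h'
      · change TensorProduct.map (ofElem a).left (P.delta b).left (c ⊗ₜ[ℂ] (c' ⊗ₜ[ℂ] c'')) = _
        rw [TensorProduct.map_tmul, P.left_delta_eq_zero hb hc' hc'', TensorProduct.tmul_zero]
        · rfl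
        · rintro ⟨h1, -, h2⟩
          rcases h with h | h
          · exact h h2
          · exact h (h1.trans h'.2)
      · simp
  exact LinearMap.congr_fun this z

end homogeneous

/-- On a homogeneous triple with matching inner indices both sides are left multiplication by an
iterated column, and `col_coassoc` applies. If either pair of inner indices fails to match, both
sides vanish. -/
theorem assoc_left_comulIdDelta (a : A) (w : (A ⊗[ℂ] A) ⊗[ℂ] A) :
    TensorProduct.assoc ℂ A A A ((P.comulIdDelta a).left w) =
      (P.idComulDelta a).left (TensorProduct.assoc ℂ A A A w) := by
  classical
  refine triple_induction 𝒜 (p := fun w => TensorProduct.assoc ℂ A A A ((P.comulIdDelta a).left w) =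
    (P.idComulDelta a).left (TensorProduct.assoc ℂ A A A w)) w (by simp)
    (fun x y hx hy => by simp only [map_add, hx, hy]) ?_
  intro x y x' y' x'' y'' c hc c' hc' c'' hc''
  have h1 : ∀ q, (𝒜.midUnit q).right (P.col q a) = P.col q a := fun q => by
    rw [right_midUnit_col, if_pos rfl]
  rw [TensorProduct.assoc_tmul, P.left_comulIdDelta hc hc' hc'', P.left_idComulDelta hc hc' hc'']
  by_cases h2 : x.2 = x'.1
  · by_cases h3 : x'.2 = x''.1
    · rw [P.comulId_left_tmul hc hc' hc'' h2, P.idComul_left_tmul hc hc' hc'' h3, assoc_mul,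
        ← h3, col_coassoc, TensorProduct.assoc_tmul]
    · rw [← h1 x''.1, P.comulId_left_tmul_eq_zero hc hc' hc'' x''.1 (Or.inr h3), map_zero,
        ← h1 x.2, P.idComul_left_tmul_eq_zero hc hc' hc'' x.2 (Or.inl h3)]
  · rw [← h1 x''.1, P.comulId_left_tmul_eq_zero hc hc' hc'' x''.1 (Or.inl h2), map_zero,
        ← h1 x.2, P.idComul_left_tmul_eq_zero hc hc' hc'' x.2 (Or.inr (Ne.symm h2))]

theorem assoc_right_comulIdDelta (a : A) (w : (A ⊗[ℂ] A) ⊗[ℂ] A) :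
    TensorProduct.assoc ℂ A A A ((P.comulIdDelta a).right w) =
      (P.idComulDelta a).right (TensorProduct.assoc ℂ A A A w) := by
  refine (P.locallyUnital.tensor P.locallyUnital₂).eq_of_mul_right fun c => ?_
  obtain ⟨c, rfl⟩ := (TensorProduct.assoc ℂ A A A).surjective c
  rw [← assoc_mul, ← compat, ← compat, ← assoc_left_comulIdDelta, assoc_mul]

end PartialBialgebra

end PartialQG

/-! ### The counit, the multiplier bialgebra of `P`, and uniqueness of the correspondence. -/

namespace PartialQG

open Multiplier PartialAlgebra

variable {I A : Type*} [NonUnitalRing A] [Module ℂ A] [IsScalarTower ℂ A A] [SMulCommClass ℂ A A]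

namespace PartialBialgebra

variable {𝒜 : PartialAlgebra (I × I) A} (P : PartialBialgebra 𝒜)

theorem sliceR_counit_eq_zero {x y x' y' : I × I} {z : A ⊗[ℂ] A}
    (hz : z ∈ tensorSub (𝒜.comp x y) (𝒜.comp x' y')) (h : x'.1 ≠ x'.2 ∨ y'.1 ≠ y'.2) :
    sliceR P.counit z = 0 :=
  eqOn_tensorSub (f := sliceR P.counit) (g := 0) (fun a ha b hb => by
    rw [sliceR_tmul, P.counit_support x'.1 y'.1 x'.2 y'.2 h b hb, zero_smul,
      LinearMap.zero_apply]) hz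

theorem sliceL_counit_eq_zero {x y x' y' : I × I} {z : A ⊗[ℂ] A}
    (hz : z ∈ tensorSub (𝒜.comp x y) (𝒜.comp x' y')) (h : x.1 ≠ x.2 ∨ y.1 ≠ y.2) :
    sliceL P.counit z = 0 :=
  eqOn_tensorSub (f := sliceL P.counit) (g := 0) (fun a ha b hb => by
    rw [sliceL_tmul, P.counit_support x.1 y.1 x.2 y.2 h a ha, zero_smul,
      LinearMap.zero_apply]) hz

-- The support of the counit forces the inner indices `p, q` to be the lower indices of `a`, where
-- the counit axiom returns `a`. Slicing a column or row therefore leaves at most one term.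
open Classical in
theorem sliceR_counit_comul {k l m n : I} {a : A} (ha : a ∈ 𝒜.comp (k, m) (l, n)) (p q : I) :
    sliceR P.counit (P.comul p q a) = if p = m ∧ q = n then a else 0 := by
  split_ifs with h
  · obtain ⟨rfl, rfl⟩ := h
    exact P.counit_right _ _ _ _ a ha
  · exact P.sliceR_counit_eq_zero (P.comul_mem _ _ _ _ _ _ a ha) (not_and_or.1 h)

open Classical in
theorem sliceL_counit_comul {k l m n : I} {a : A} (ha : a ∈ 𝒜.comp (k, m) (l, n)) (p q : I) :
    sliceL P.counit (P.comul p q a) = if k = p ∧ l = q then a else 0 := by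
  split_ifs with h
  · obtain ⟨rfl, rfl⟩ := h
    exact P.counit_left _ _ _ _ a ha
  · exact P.sliceL_counit_eq_zero (P.comul_mem _ _ _ _ _ _ a ha) (not_and_or.1 h)

theorem sliceR_counit_col (q : I) (a : A) :
    sliceR P.counit (P.col q a) = (𝒜.unitLo q).right a := by
  classical
  refine LinearMap.congr_fun (f := sliceR P.counit ∘ₗ P.col q) (𝒜.linearMap_ext ?_) a
  rintro ⟨k, m⟩ ⟨l, n⟩ a ha
  rw [LinearMap.comp_apply, col, map_lfSum, right_unitLo ha, finsum_eq_single _ m]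
  · rw [P.sliceR_counit_comul ha]
    simp [eq_comm]
  · intro p hp
    rw [P.sliceR_counit_comul ha, if_neg fun h => hp h.1]

theorem sliceR_counit_row (p : I) (a : A) :
    sliceR P.counit (P.row p a) = (𝒜.unitLo p).left a := by
  classical
  refine LinearMap.congr_fun (f := sliceR P.counit ∘ₗ P.row p) (𝒜.linearMap_ext ?_) a
  rintro ⟨k, m⟩ ⟨l, n⟩ a ha
  rw [LinearMap.comp_apply, row, map_lfSum, left_unitLo ha, finsum_eq_single _ n]
  · rw [P.sliceR_counit_comul ha]
    simp [eq_comm]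
  · intro p hp
    rw [P.sliceR_counit_comul ha, if_neg fun h => hp h.2]

theorem sliceL_counit_col (q : I) (a : A) :
    sliceL P.counit (P.col q a) = (𝒜.unitUp q).right a := by
  classical
  refine LinearMap.congr_fun (f := sliceL P.counit ∘ₗ P.col q) (𝒜.linearMap_ext ?_) a
  rintro ⟨k, m⟩ ⟨l, n⟩ a ha
  rw [LinearMap.comp_apply, col, map_lfSum, right_unitUp ha, finsum_eq_single _ k]
  · rw [P.sliceL_counit_comul ha]
    simp
  · intro p hp
    rw [P.sliceL_counit_comul ha, if_neg fun h => hp h.1.symm]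

theorem sliceL_counit_row (p : I) (a : A) :
    sliceL P.counit (P.row p a) = (𝒜.unitUp p).left a := by
  classical
  refine LinearMap.congr_fun (f := sliceL P.counit ∘ₗ P.row p) (𝒜.linearMap_ext ?_) a
  rintro ⟨k, m⟩ ⟨l, n⟩ a ha
  rw [LinearMap.comp_apply, row, map_lfSum, left_unitUp ha, finsum_eq_single _ l]
  · rw [P.sliceL_counit_comul ha]
    simp
  · intro p hp
    rw [P.sliceL_counit_comul ha, if_neg fun h => hp h.2.symm]

theorem isSliceR_counit (a : A) : IsSliceR P.counit (P.delta a) (ofElem a) := by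
  classical
  refine (P.isSliceR_delta_iff _ _ _).2 fun x y b hb => ⟨?_, ?_⟩
  · rw [sliceR_counit_col, ← compat, left_unitLo hb, if_pos rfl, left_ofElem]
  · rw [sliceR_counit_row, compat, right_unitLo hb, if_pos rfl, right_ofElem]

theorem isSliceL_counit (a : A) : IsSliceL P.counit (P.delta a) (ofElem a) := by
  classical
  refine (P.isSliceL_delta_iff _ _ _).2 fun x y b hb => ⟨?_, ?_⟩
  · rw [sliceL_counit_col, ← compat, left_unitUp hb, if_pos rfl, left_ofElem]
  · rw [sliceL_counit_row, compat, right_unitUp hb, if_pos rfl, right_ofElem]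

theorem mul_one_mem_rightPart (r : I × I) (a : A) : a * P.one r ∈ 𝒜.rightPart {r} := by
  rw [rightPart_eq]
  suffices h : ∀ x y, ∀ a ∈ 𝒜.comp x y, a * P.one r ∈ 𝒜.part {p | p.2 ∈ ({r} : Set (I × I))} by
    refine 𝒜.induction_on (P := fun a => a * P.one r ∈ 𝒜.part {p | p.2 ∈ ({r} : Set (I × I))})
      a h ?_ fun a b ha hb => ?_
    · rw [zero_mul]
      exact Submodule.zero_mem _
    · rw [add_mul]
      exact Submodule.add_mem _ ha hb
  intro x y a ha
  by_cases h : y = r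
  · subst h
    rw [P.mul_one _ _ _ ha]
    exact comp_le_part (by simp) ha
  · rw [P.mul_one_ne ha h]
    exact Submodule.zero_mem _

theorem one_mul_mem_leftPart (r : I × I) (a : A) : P.one r * a ∈ 𝒜.leftPart {r} := by
  rw [leftPart_eq]
  suffices h : ∀ x y, ∀ a ∈ 𝒜.comp x y, P.one r * a ∈ 𝒜.part {p | p.1 ∈ ({r} : Set (I × I))} by
    refine 𝒜.induction_on (P := fun a => P.one r * a ∈ 𝒜.part {p | p.1 ∈ ({r} : Set (I × I))})
      a h ?_ fun a b ha hb => ?_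
    · rw [mul_zero]
      exact Submodule.zero_mem _
    · rw [mul_add]
      exact Submodule.add_mem _ ha hb
  intro x y a ha
  by_cases h : r = x
  · subst h
    rw [P.one_mul _ _ _ ha]
    exact comp_le_part (by simp) ha
  · rw [P.one_mul_ne ha h]
    exact Submodule.zero_mem _

theorem isNondegenerate (P : PartialBialgebra 𝒜) : 𝒜.IsNondegenerate :=
  ⟨fun r a ha h => by rw [← P.mul_one_of_mem_rightPart ha, h _ (P.one_mem_rightPart r)],
    fun r a ha h => by rw [← P.one_mul_of_mem_leftPart ha, h _ (P.one_mem_leftPart r)]⟩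

theorem isIdempotent (P : PartialBialgebra 𝒜) : 𝒜.IsIdempotent := by
  refine ⟨fun r => le_antisymm (Submodule.span_le.2 ?_) fun a ha => ?_,
    fun r => le_antisymm (Submodule.span_le.2 ?_) fun a ha => ?_⟩
  · rintro _ ⟨a, ha, b, hb, rfl⟩
    rw [← P.mul_one_of_mem_rightPart hb, ← mul_assoc]
    exact P.mul_one_mem_rightPart r _
  · exact Submodule.subset_span ⟨a, ha, P.one r, P.one_mem_rightPart r,
      (P.mul_one_of_mem_rightPart ha).symm⟩
  · rintro _ ⟨a, ha, b, hb, rfl⟩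
    rw [← P.one_mul_of_mem_leftPart ha, mul_assoc]
    exact P.one_mul_mem_leftPart r _
  · exact Submodule.subset_span ⟨P.one r, P.one_mem_leftPart r, a, ha,
      (P.one_mul_of_mem_leftPart ha).symm⟩

theorem counit_mul_of_mem (x : I × I) {a b : A} (ha : a ∈ 𝒜.rightPart {x})
    (hb : b ∈ 𝒜.leftPart {x}) : P.counit (a * b) = P.counit a * P.counit b := by
  rw [rightPart_eq] at ha
  rw [leftPart_eq] at hb
  refine (part_le (W := LinearMap.eqLocus (P.counit ∘ₗ LinearMap.mulRight ℂ b)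
    (LinearMap.mulRight ℂ (P.counit b) ∘ₗ P.counit))).2 (fun r s h a ha' => ?_) ha
  refine (part_le (W := LinearMap.eqLocus (P.counit ∘ₗ LinearMap.mulLeft ℂ a)
    (LinearMap.mulLeft ℂ (P.counit a) ∘ₗ P.counit))).2 (fun r' s' h' b hb' => ?_) hb
  simp only [Set.mem_ofPred_eq, Set.mem_singleton_iff] at h h'
  subst h h'
  exact P.counit_mul _ _ _ a ha' b hb'

/-- The regular partial multiplier bialgebra associated with a partial bialgebra. -/
noncomputable def toMultiplierBialgebra : RegularPartialMultiplierBialgebra 𝒜 where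
  comul := P.deltaHom
  counit := P.counit
  nondegenerate := P.isNondegenerate
  idempotent := P.isIdempotent
  corner_left a x := by rw [iSup_loL_upL]; exact P.finsum_col_mem a x
  corner_right a x := by rw [iSup_loR_upR]; exact P.finsum_row_mem a x
  morphism_right := P.delta_morphism_right
  morphism_left := P.delta_morphism_left
  restricted := P.delta_isRestricted
  coassoc a := by
    refine ⟨P.comulIdDelta a, P.idComulDelta a, ?_, ?_, fun x =>
      ⟨P.assoc_left_comulIdDelta a x, P.assoc_right_comulIdDelta a x⟩⟩
    · rw [deltaHom_apply, delta_eq_lfSum]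
      exact isExtensionValue_lfSum _ (comulId_mul _) _ _ _ _ _ _
    · rw [deltaHom_apply, delta_eq_lfSum]
      exact isExtensionValue_lfSum _ (idComul_mul _) _ _ _ _ _ _
  counit_support r s t u := P.counit_support r s t u
  counit_ne_zero r := by
    refine ⟨⟨P.one (r, r), ?_, by rw [P.counit_one]; exact one_ne_zero⟩,
      ⟨P.one (r, r), ?_, by rw [P.counit_one]; exact one_ne_zero⟩⟩
    · rw [loR_eq]
      exact comp_le_part (by simp) (P.one_mem _)
    · rw [loL_eq]
      exact comp_le_part (by simp) (P.one_mem _)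
  counit_mul x a ha b hb := P.counit_mul_of_mem x ha hb
  counit_right := P.isSliceR_counit
  counit_left := P.isSliceL_counit

theorem toMultiplierBialgebra_corresponds : Corresponds P.toMultiplierBialgebra P :=
  ⟨fun r t => P.units.ofElem_one (r, t), rfl, P.midUnit_delta_midUnit⟩

theorem toMultiplierBialgebra_isCompactType : P.toMultiplierBialgebra.IsCompactType :=
  fun r s => ⟨P.one (r, s), P.units.ofElem_one (r, s)⟩

end PartialBialgebra

/-- A multiplier bialgebra corresponding to `P` has the comultiplication `∑_{p,q} Δ_{pq}`. -/
theorem Corresponds.comul_eq {𝒜 : PartialAlgebra (I × I) A}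
    {H : RegularPartialMultiplierBialgebra 𝒜} {P : PartialBialgebra 𝒜} (h : Corresponds H P)
    (a : A) : H.comul a = P.delta a :=
  P.eq_delta a _ (H.corner_left a) (H.corner_right a) fun p q => h.2.2 p q a

/-- Uniqueness on both sides makes the two constructions inverse to each other with no further
computation. Here it rests on the recovery of `Δ` from its components, and in `right_unique` on
injectivity of `A ⊗ A → M(A ⊗ A)`. -/
theorem Corresponds.left_unique {𝒜 : PartialAlgebra (I × I) A}
    {H H' : RegularPartialMultiplierBialgebra 𝒜} {P : PartialBialgebra 𝒜} (h : Corresponds H P)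
    (h' : Corresponds H' P) : H = H' := by
  have h1 : H.comul = H'.comul := NonUnitalAlgHom.ext fun a => by rw [h.comul_eq, h'.comul_eq]
  have h2 : H.counit = H'.counit := h.2.1.symm.trans h'.2.1
  cases H
  cases H'
  congr

theorem Corresponds.right_unique {𝒜 : PartialAlgebra (I × I) A}
    {H : RegularPartialMultiplierBialgebra 𝒜} {P P' : PartialBialgebra 𝒜} (h : Corresponds H P)
    (h' : Corresponds H P') : P = P' := by
  have h1 : P.one = P'.one := funext fun x =>
    ofElem_injective P.locallyUnital ((h.1 x.1 x.2).trans (h'.1 x.1 x.2).symm)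
  have h2 : P.counit = P'.counit := h.2.1.trans h'.2.1.symm
  have h3 : P.comul = P'.comul := funext fun p => funext fun q => LinearMap.ext fun a =>
    ofElem_injective P.locallyUnital₂ ((h.2.2 p q a).trans (h'.2.2 p q a).symm)
  cases P
  cases P'
  congr

end PartialQG

/-! ### The antipode inverts the canonical maps. -/

namespace PartialQG

open Multiplier PartialAlgebra

variable {I A : Type*} [NonUnitalRing A] [Module ℂ A] [IsScalarTower ℂ A A] [SMulCommClass ℂ A A]

namespace PartialAlgebra

variable {𝒜 : PartialAlgebra (I × I) A}

theorem finite_left_unitUp (a : A) : {q | (𝒜.unitUp q).left a ≠ 0}.Finite := by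
  classical
  refine 𝒜.induction_on (P := fun a => {q | (𝒜.unitUp q).left a ≠ 0}.Finite) a ?_ (by simp)
    fun _ _ => finite_add
  intro x y a ha
  refine (Set.finite_singleton x.1).subset fun q (hq : _ ≠ 0) => ?_
  by_contra h
  exact hq (by rw [left_unitUp ha, if_neg (Ne.symm h)])

theorem finite_left_unitLo (a : A) : {q | (𝒜.unitLo q).left a ≠ 0}.Finite := by
  classical
  refine 𝒜.induction_on (P := fun a => {q | (𝒜.unitLo q).left a ≠ 0}.Finite) a ?_ (by simp)
    fun _ _ => finite_add
  intro x y a ha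
  refine (Set.finite_singleton x.2).subset fun q (hq : _ ≠ 0) => ?_
  by_contra h
  exact hq (by rw [left_unitLo ha, if_neg (Ne.symm h)])

theorem finite_right_unitUp (a : A) : {q | (𝒜.unitUp q).right a ≠ 0}.Finite := by
  classical
  refine 𝒜.induction_on (P := fun a => {q | (𝒜.unitUp q).right a ≠ 0}.Finite) a ?_ (by simp)
    fun _ _ => finite_add
  intro x y a ha
  refine (Set.finite_singleton y.1).subset fun q (hq : _ ≠ 0) => ?_
  by_contra h
  exact hq (by rw [right_unitUp ha, if_neg (Ne.symm h)])

theorem finite_right_unitLo (a : A) : {q | (𝒜.unitLo q).right a ≠ 0}.Finite := by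
  classical
  refine 𝒜.induction_on (P := fun a => {q | (𝒜.unitLo q).right a ≠ 0}.Finite) a ?_ (by simp)
    fun _ _ => finite_add
  intro x y a ha
  refine (Set.finite_singleton y.2).subset fun q (hq : _ ≠ 0) => ?_
  by_contra h
  exact hq (by rw [right_unitLo ha, if_neg (Ne.symm h)])

/-- The map `a ⊗ b ↦ f_i(a)(1 ⊗ b)`, where `i` is read off from `b` by the projections `u_i`. -/
noncomputable def mulSndMap {ι : Type*} (f : ι → A →ₗ[ℂ] A ⊗[ℂ] A) (u : ι → A →ₗ[ℂ] A)
    (hu : ∀ a, {i | u i a ≠ 0}.Finite) : A ⊗[ℂ] A →ₗ[ℂ] A ⊗[ℂ] A :=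
  lfSum (fun i => (LinearMap.mul' ℂ A).lTensor A ∘ₗ (TensorProduct.assoc ℂ A A A).toLinearMap ∘ₗ
    TensorProduct.map (f i) (u i)) (finite_of_tmul _ fun _ b => (hu b).subset
      fun i (hi : _ ≠ 0) h => hi (by
        rw [LinearMap.comp_apply, LinearMap.comp_apply, TensorProduct.map_tmul, h,
          TensorProduct.tmul_zero, map_zero, map_zero]))

/-- The map `a ⊗ b ↦ (a ⊗ 1)f_i(b)`, where `i` is read off from `a` by the projections `u_i`. -/
noncomputable def mulFstMap {ι : Type*} (f : ι → A →ₗ[ℂ] A ⊗[ℂ] A) (u : ι → A →ₗ[ℂ] A)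
    (hu : ∀ a, {i | u i a ≠ 0}.Finite) : A ⊗[ℂ] A →ₗ[ℂ] A ⊗[ℂ] A :=
  lfSum (fun i => (LinearMap.mul' ℂ A).rTensor A ∘ₗ
    (TensorProduct.assoc ℂ A A A).symm.toLinearMap ∘ₗ
    TensorProduct.map (u i) (f i)) (finite_of_tmul _ fun a _ => (hu a).subset
      fun i (hi : _ ≠ 0) h => hi (by
        rw [LinearMap.comp_apply, LinearMap.comp_apply, TensorProduct.map_tmul, h,
          TensorProduct.zero_tmul, map_zero, map_zero]))

theorem mul_assoc_tmul (z : A ⊗[ℂ] A) (b : A) :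
    (LinearMap.mul' ℂ A).lTensor A (TensorProduct.assoc ℂ A A A (z ⊗ₜ b)) = (inr b).right z := by
  induction z using TensorProduct.induction_on with
  | zero => simp
  | add x y hx hy => simp only [TensorProduct.add_tmul, map_add, hx, hy]
  | tmul x y => simp [right_inr]

theorem mul_assoc_symm_tmul (z : A ⊗[ℂ] A) (a : A) :
    (LinearMap.mul' ℂ A).rTensor A ((TensorProduct.assoc ℂ A A A).symm (a ⊗ₜ z)) =
      (inl a).left z := by
  induction z using TensorProduct.induction_on with
  | zero => simp
  | add x y hx hy => simp only [TensorProduct.tmul_add, map_add, hx, hy]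
  | tmul x y => simp [left_inl]

theorem mulSndMap_tmul {ι : Type*} (f : ι → A →ₗ[ℂ] A ⊗[ℂ] A) (u : ι → A →ₗ[ℂ] A) (hu)
    (a b : A) (i : ι) (h : u i b = b) (h' : ∀ j, j ≠ i → u j b = 0) :
    mulSndMap f u hu (a ⊗ₜ b) = (inr b).right (f i a) := by
  rw [mulSndMap, lfSum_eq_single _ _ _ i, LinearMap.comp_apply, LinearMap.comp_apply,
    TensorProduct.map_tmul, h, LinearEquiv.coe_coe, mul_assoc_tmul]
  intro j hj
  rw [LinearMap.comp_apply, LinearMap.comp_apply, TensorProduct.map_tmul, h' j hj,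
    TensorProduct.tmul_zero, map_zero, map_zero]

theorem mulFstMap_tmul {ι : Type*} (f : ι → A →ₗ[ℂ] A ⊗[ℂ] A) (u : ι → A →ₗ[ℂ] A) (hu)
    (a b : A) (i : ι) (h : u i a = a) (h' : ∀ j, j ≠ i → u j a = 0) :
    mulFstMap f u hu (a ⊗ₜ b) = (inl a).left (f i b) := by
  rw [mulFstMap, lfSum_eq_single _ _ _ i, LinearMap.comp_apply, LinearMap.comp_apply,
    TensorProduct.map_tmul, h, LinearEquiv.coe_coe, mul_assoc_symm_tmul]
  intro j hj
  rw [LinearMap.comp_apply, LinearMap.comp_apply, TensorProduct.map_tmul, h' j hj,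
    TensorProduct.zero_tmul, map_zero, map_zero]

end PartialAlgebra

namespace PartialBialgebra

variable {𝒜 : PartialAlgebra (I × I) A} (P : PartialBialgebra 𝒜)

/-- Summing over `p` frees the left inner index but keeps it common to both legs. The antipode
computations depend on this bookkeeping. -/
theorem col_mem {k l m n : I} {a : A} (ha : a ∈ 𝒜.comp (k, m) (l, n)) (q : I) :
    P.col q a ∈ 𝒜.pairSpan fun u v => u.1.1 = k ∧ u.2 = (l, q) ∧ v.1.2 = m ∧ v.2 = (q, n) ∧
      u.1.2 = v.1.1 := by
  refine finsum_induction (p := (· ∈ 𝒜.pairSpan _)) (Submodule.zero_mem _)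
    (fun _ _ => Submodule.add_mem _) fun p => ?_
  refine (tensorSub_le (W := 𝒜.pairSpan _)).2 ?_ (P.comul_mem p q k l m n a ha)
  exact fun u hu v hv => tmul_mem_pairSpan hu hv ⟨rfl, rfl, rfl, rfl, rfl⟩

theorem row_mem {k l m n : I} {a : A} (ha : a ∈ 𝒜.comp (k, m) (l, n)) (p : I) :
    P.row p a ∈ 𝒜.pairSpan fun u v => u.1 = (k, p) ∧ u.2.1 = l ∧ v.1 = (p, m) ∧ v.2.2 = n ∧
      u.2.2 = v.2.1 := by
  refine finsum_induction (p := (· ∈ 𝒜.pairSpan _)) (Submodule.zero_mem _)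
    (fun _ _ => Submodule.add_mem _) fun q => ?_
  refine (tensorSub_le (W := 𝒜.pairSpan _)).2 ?_ (P.comul_mem p q k l m n a ha)
  exact fun u hu v hv => tmul_mem_pairSpan hu hv ⟨rfl, rfl, rfl, rfl, rfl⟩

/-- The canonical map `a ⊗ b ↦ Δ(a)(1 ⊗ b)`. -/
noncomputable def canR : A ⊗[ℂ] A →ₗ[ℂ] A ⊗[ℂ] A :=
  mulSndMap P.col (fun q => (𝒜.unitUp q).left) finite_left_unitUp

/-- The canonical map `a ⊗ b ↦ (a ⊗ 1)Δ(b)`. -/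
noncomputable def canL : A ⊗[ℂ] A →ₗ[ℂ] A ⊗[ℂ] A :=
  mulFstMap P.row (fun q => (𝒜.unitLo q).right) finite_right_unitLo

theorem canR_tmul (a : A) {x y : I × I} {b : A} (hb : b ∈ 𝒜.comp x y) :
    P.canR (a ⊗ₜ b) = (inr b).right (P.col x.1 a) := by
  classical
  exact mulSndMap_tmul _ _ _ _ _ x.1 (by rw [left_unitUp hb, if_pos rfl])
    fun j hj => by rw [left_unitUp hb, if_neg hj.symm]

theorem canL_tmul {x y : I × I} {a : A} (ha : a ∈ 𝒜.comp x y) (b : A) :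
    P.canL (a ⊗ₜ b) = (inl a).left (P.row y.2 b) := by
  classical
  exact mulFstMap_tmul _ _ _ _ _ y.2 (by rw [right_unitLo ha, if_pos rfl])
    fun j hj => by rw [right_unitLo ha, if_neg hj.symm]

theorem ofElem_canR (a b : A) : ofElem (P.canR (a ⊗ₜ b)) = P.delta a * inr b := by
  refine 𝒜.induction_on (P := fun b => ofElem (P.canR (a ⊗ₜ b)) = P.delta a * inr b) b ?_
    (by simp [inr_zero])
    (fun b c hb hc => by rw [TensorProduct.tmul_add, map_add, map_add, inr_add, mul_add, hb, hc])
  intro x y b hb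
  rw [P.canR_tmul a hb, P.delta_mul_inr hb]

theorem ofElem_canL (a b : A) : ofElem (P.canL (a ⊗ₜ b)) = inl a * P.delta b := by
  refine 𝒜.induction_on (P := fun a => ofElem (P.canL (a ⊗ₜ b)) = inl a * P.delta b) a ?_
    (by simp [inl_zero])
    (fun b c hb hc => by rw [TensorProduct.add_tmul, map_add, map_add, inl_add, add_mul, hb, hc])
  intro x y a ha
  rw [P.canL_tmul ha, P.inl_mul_delta ha]

namespace IsAntipode

variable {P} {S : A →ₗ[ℂ] A} (hS : P.IsAntipode S)
include hS

theorem mul_lTensor_row {k l m n : I} {a : A} (ha : a ∈ 𝒜.comp (k, m) (l, n)) (p : I) :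
    LinearMap.mul' ℂ A (S.lTensor A (P.row p a)) = P.counit a • P.one (k, p) := by
  rw [← hS.2.1 k l m n a ha p]
  exact map_finsum (LinearMap.mul' ℂ A ∘ₗ S.lTensor A) (P.finite_right a p)

theorem mul_rTensor_col {k l m n : I} {a : A} (ha : a ∈ 𝒜.comp (k, m) (l, n)) (q : I) :
    LinearMap.mul' ℂ A (S.rTensor A (P.col q a)) = P.counit a • P.one (q, n) := by
  rw [← hS.2.2 k l m n a ha q]
  exact map_finsum (LinearMap.mul' ℂ A ∘ₗ S.rTensor A) (P.finite_left a q)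

/-- As for Hopf algebras, the inverse of `a ⊗ b ↦ a₁ ⊗ a₂b` is `a ⊗ b ↦ a₁ ⊗ S(a₂)b`:
coassociativity brings `S(a₂)a₃` or `a₂S(a₃)` together, and the antipode axiom reduces it to the
counit. -/
theorem canR_invOn : ∃ T : A ⊗[ℂ] A →ₗ[ℂ] A ⊗[ℂ] A,
    (∀ z ∈ 𝒜.pairSpan fun p p' => p.2.2 = p'.1.2, T (P.canR z) = z) ∧
    (∀ z ∈ 𝒜.pairSpan fun p p' => p.1.2 = p'.1.1, P.canR (T z) = z) ∧
    ∀ z ∈ 𝒜.pairSpan fun p p' => p.1.2 = p'.1.1, T z ∈ 𝒜.pairSpan fun p p' => p.2.2 = p'.1.2 := by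
  classical
  -- `S` turns the left inner index of the row into the lower right index of `S(a₂)`, so it must be
  -- the lower left index of `b`.
  let T := mulSndMap (fun p => S.lTensor A ∘ₗ P.row p) (fun q => (𝒜.unitLo q).left)
    finite_left_unitLo
  have hT : ∀ a x y b, b ∈ 𝒜.comp x y →
      T (a ⊗ₜ b) = (inr b).right (S.lTensor A (P.row x.2 a)) := fun a x y b hb =>
    mulSndMap_tmul _ _ _ _ _ x.2 (by rw [left_unitLo hb, if_pos rfl])
      fun j hj => by rw [left_unitLo hb, if_neg hj.symm]
  refine ⟨T, fun z hz => ?_, fun z hz => ?_, fun z hz => ?_⟩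
  · refine eqOn_pairSpan (f := T ∘ₗ P.canR) (g := LinearMap.id) ?_ hz
    rintro ⟨k, m⟩ ⟨l, n⟩ ⟨g, n'⟩ y' h a ha b hb
    dsimp only at h
    subst h
    rw [LinearMap.comp_apply, P.canR_tmul a hb, LinearMap.id_apply]
    -- The composite is `a₁ ⊗ S(a₂)a₃b`, with `a₁ ⊗ a₂` obtained by splitting the first leg of the
    -- column.
    have h1 : T ((inr b).right (P.col g a)) = (inr b).right
        ((LinearMap.mul' ℂ A ∘ₗ S.rTensor A).lTensor A
          (TensorProduct.assoc ℂ A A A ((P.row m).rTensor A (P.col g a)))) := by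
      refine eqOn_pairSpan (f := T ∘ₗ (inr b).right) (g := (inr b).right ∘ₗ
        (LinearMap.mul' ℂ A ∘ₗ S.rTensor A).lTensor A ∘ₗ
          (TensorProduct.assoc ℂ A A A).toLinearMap ∘ₗ (P.row m).rTensor A) ?_ (P.col_mem ha g)
      rintro x y ⟨r, m'⟩ _ ⟨-, -, h1, rfl, -⟩ u hu v hv
      dsimp only at h1
      subst h1
      rw [LinearMap.comp_apply, right_inr, LinearMap.lTensor_tmul, LinearMap.mulRight_apply,
        hT _ _ _ _ (𝒜.mul_mem hv hb)]
      simp only [LinearMap.comp_apply, LinearMap.rTensor_tmul, LinearEquiv.coe_coe]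
      generalize P.row m' u = w
      induction w using TensorProduct.induction_on with
      | zero => simp
      | add x y hx hy => simp only [TensorProduct.add_tmul, map_add, hx, hy]
      | tmul s t => simp [right_inr, mul_assoc]
    rw [h1, row_col_coassoc]
    -- After rebracketing, `a₂ ⊗ a₃` is itself a column of one element, to which the antipode axiom
    -- applies.
    have h2 : (inr b).right ((LinearMap.mul' ℂ A ∘ₗ S.rTensor A).lTensor A
        ((P.col g).lTensor A (P.row m a))) = sliceR P.counit (P.row m a) ⊗ₜ b := by
      refine eqOn_pairSpan (f := (inr b).right ∘ₗ (LinearMap.mul' ℂ A ∘ₗ S.rTensor A).lTensor A ∘ₗ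
        (P.col g).lTensor A) (g := (TensorProduct.mk ℂ A A).flip b ∘ₗ sliceR P.counit) ?_
        (P.row_mem ha m)
      rintro x y _ ⟨q, n'⟩ ⟨-, -, rfl, h4, -⟩ u hu v hv
      dsimp only at h4
      subst h4
      simp only [LinearMap.comp_apply, LinearMap.lTensor_tmul]
      rw [hS.mul_rTensor_col hv, sliceR_tmul, right_inr, LinearMap.lTensor_tmul,
        LinearMap.mulRight_apply, smul_mul_assoc, P.one_mul _ _ _ hb]
      simp
    rw [h2, sliceR_counit_row, left_unitLo ha, if_pos rfl]
  · refine eqOn_pairSpan (f := P.canR ∘ₗ T) (g := LinearMap.id) ?_ hz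
    rintro ⟨k, m⟩ ⟨l, n⟩ ⟨m', p⟩ y' h a ha b hb
    dsimp only at h
    subst h
    rw [LinearMap.comp_apply, hT _ _ _ _ hb, LinearMap.id_apply]
    have h1 : P.canR ((inr b).right (S.lTensor A (P.row p a))) = (inr b).right
        ((LinearMap.mul' ℂ A ∘ₗ S.lTensor A).lTensor A
          (TensorProduct.assoc ℂ A A A ((P.col n).rTensor A (P.row p a)))) := by
      refine eqOn_pairSpan (f := P.canR ∘ₗ (inr b).right ∘ₗ S.lTensor A) (g := (inr b).right ∘ₗ
        (LinearMap.mul' ℂ A ∘ₗ S.lTensor A).lTensor A ∘ₗ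
          (TensorProduct.assoc ℂ A A A).toLinearMap ∘ₗ (P.col n).rTensor A) ?_ (P.row_mem ha p)
      rintro x y _ ⟨q, n'⟩ ⟨-, -, rfl, h4, -⟩ u hu v hv
      dsimp only at h4
      subst h4
      rw [LinearMap.comp_apply, LinearMap.comp_apply, LinearMap.lTensor_tmul, right_inr,
        LinearMap.lTensor_tmul, LinearMap.mulRight_apply,
        P.canR_tmul u (𝒜.mul_mem (hS.1 _ _ _ _ v hv) hb)]
      simp only [LinearMap.comp_apply, LinearMap.rTensor_tmul, LinearEquiv.coe_coe]
      generalize P.col n' u = w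
      induction w using TensorProduct.induction_on with
      | zero => simp
      | add x y hx hy => simp only [TensorProduct.add_tmul, map_add, hx, hy]
      | tmul s t => simp [right_inr, mul_assoc]
    rw [h1, col_row_coassoc]
    have h2 : (inr b).right ((LinearMap.mul' ℂ A ∘ₗ S.lTensor A).lTensor A
        ((P.row p).lTensor A (P.col n a))) = sliceR P.counit (P.col n a) ⊗ₜ b := by
      refine eqOn_pairSpan (f := (inr b).right ∘ₗ (LinearMap.mul' ℂ A ∘ₗ S.lTensor A).lTensor A ∘ₗ
        (P.row p).lTensor A) (g := (TensorProduct.mk ℂ A A).flip b ∘ₗ sliceR P.counit) ?_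
        (P.col_mem ha n)
      rintro x y ⟨r, m'⟩ _ ⟨-, -, h4, rfl, -⟩ u hu v hv
      dsimp only at h4
      subst h4
      simp only [LinearMap.comp_apply, LinearMap.lTensor_tmul]
      rw [hS.mul_lTensor_row hv, sliceR_tmul, right_inr, LinearMap.lTensor_tmul,
        LinearMap.mulRight_apply]
      -- The antipode axiom gives a unit with upper index `r`, whereas `b` has upper left index
      -- `m'`; when these differ the counit vanishes.
      by_cases h5 : r = m'
      · subst h5
        rw [smul_mul_assoc, P.one_mul _ _ _ hb]
        simp
      · rw [P.counit_support _ _ _ _ (Or.inl h5) v hv]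
        simp
    rw [h2, sliceR_counit_col, right_unitLo ha, if_pos rfl]
  · refine map_mem_of_mem_pairSpan T ?_ hz
    rintro ⟨k, m⟩ ⟨l, n⟩ ⟨m', p⟩ y' h a ha b hb
    dsimp only at h
    subst h
    rw [hT _ _ _ _ hb]
    refine map_mem_of_mem_pairSpan ((inr b).right ∘ₗ S.lTensor A) ?_ (P.row_mem ha p)
    rintro ⟨k', p'⟩ ⟨l', q'⟩ ⟨r', m'⟩ ⟨q, n'⟩ ⟨-, -, h3, -, h5⟩ u hu v hv
    dsimp only at h3 h5
    simp only [Prod.mk.injEq] at h3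
    obtain ⟨rfl, rfl⟩ := h3
    subst h5
    exact tmul_mem_pairSpan hu (𝒜.mul_mem (hS.1 _ _ _ _ v hv) hb) rfl

/-- Mirror image of `canR_invOn`, with inverse `a ⊗ b ↦ aS(b₁) ⊗ b₂`; here the column index is the
upper right index of `a`. -/
theorem canL_invOn : ∃ T : A ⊗[ℂ] A →ₗ[ℂ] A ⊗[ℂ] A,
    (∀ z ∈ 𝒜.pairSpan fun p p' => p.2.1 = p'.1.1, T (P.canL z) = z) ∧
    (∀ z ∈ 𝒜.pairSpan fun p p' => p.2.2 = p'.2.1, P.canL (T z) = z) ∧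
    ∀ z ∈ 𝒜.pairSpan fun p p' => p.2.2 = p'.2.1, T z ∈ 𝒜.pairSpan fun p p' => p.2.1 = p'.1.1 := by
  classical
  let T := mulFstMap (fun p => S.rTensor A ∘ₗ P.col p) (fun q => (𝒜.unitUp q).right)
    finite_right_unitUp
  have hT : ∀ a x y b, a ∈ 𝒜.comp x y →
      T (a ⊗ₜ b) = (inl a).left (S.rTensor A (P.col y.1 b)) := fun a x y b hb =>
    mulFstMap_tmul _ _ _ _ _ y.1 (by rw [right_unitUp hb, if_pos rfl])
      fun j hj => by rw [right_unitUp hb, if_neg hj.symm]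
  refine ⟨T, fun z hz => ?_, fun z hz => ?_, fun z hz => ?_⟩
  · refine eqOn_pairSpan (f := T ∘ₗ P.canL) (g := LinearMap.id) ?_ hz
    rintro x' ⟨k', g⟩ ⟨k, m⟩ ⟨l, n⟩ h a ha b hb
    dsimp only at h
    subst h
    rw [LinearMap.comp_apply, P.canL_tmul ha b, LinearMap.id_apply]
    have h1 : T ((inl a).left (P.row g b)) = (inl a).left
        ((LinearMap.mul' ℂ A ∘ₗ S.lTensor A).rTensor A
          ((TensorProduct.assoc ℂ A A A).symm ((P.col l).lTensor A (P.row g b)))) := by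
      refine eqOn_pairSpan (f := T ∘ₗ (inl a).left) (g := (inl a).left ∘ₗ
        (LinearMap.mul' ℂ A ∘ₗ S.lTensor A).rTensor A ∘ₗ
          (TensorProduct.assoc ℂ A A A).symm.toLinearMap ∘ₗ (P.col l).lTensor A) ?_
          (P.row_mem hb g)
      rintro _ ⟨l', q⟩ x y ⟨rfl, h1, -, -, -⟩ u hu v hv
      dsimp only at h1
      subst h1
      rw [LinearMap.comp_apply, left_inl, LinearMap.rTensor_tmul, LinearMap.mulLeft_apply,
        hT _ _ _ _ (𝒜.mul_mem ha hu)]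
      simp only [LinearMap.comp_apply, LinearMap.lTensor_tmul, LinearEquiv.coe_coe]
      generalize P.col l' v = w
      induction w using TensorProduct.induction_on with
      | zero => simp
      | add x y hx hy => simp only [TensorProduct.tmul_add, map_add, hx, hy]
      | tmul s t => simp [left_inl]
    rw [h1, ← row_col_coassoc, LinearEquiv.symm_apply_apply]
    have h2 : (inl a).left ((LinearMap.mul' ℂ A ∘ₗ S.lTensor A).rTensor A
        ((P.row g).rTensor A (P.col l b))) = a ⊗ₜ sliceL P.counit (P.col l b) := by
      refine eqOn_pairSpan (f := (inl a).left ∘ₗ (LinearMap.mul' ℂ A ∘ₗ S.lTensor A).rTensor A ∘ₗ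
        (P.row g).rTensor A) (g := TensorProduct.mk ℂ A A a ∘ₗ sliceL P.counit) ?_
        (P.col_mem hb l)
      rintro ⟨k', p⟩ _ x y ⟨h1, rfl, -, -, -⟩ u hu v hv
      dsimp only at h1
      subst h1
      simp only [LinearMap.comp_apply, LinearMap.rTensor_tmul]
      rw [hS.mul_lTensor_row hu, sliceL_tmul, left_inl, LinearMap.rTensor_tmul,
        LinearMap.mulLeft_apply, mul_smul_comm, P.mul_one _ _ _ ha]
      simp [TensorProduct.smul_tmul']
    rw [h2, sliceL_counit_col, right_unitUp hb, if_pos rfl]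
  · refine eqOn_pairSpan (f := P.canL ∘ₗ T) (g := LinearMap.id) ?_ hz
    rintro x' ⟨g, l'⟩ ⟨k, m⟩ ⟨l, n⟩ h a ha b hb
    dsimp only at h
    subst h
    rw [LinearMap.comp_apply, hT _ _ _ _ ha, LinearMap.id_apply]
    have h1 : P.canL ((inl a).left (S.rTensor A (P.col g b))) = (inl a).left
        ((LinearMap.mul' ℂ A ∘ₗ S.rTensor A).rTensor A
          ((TensorProduct.assoc ℂ A A A).symm ((P.row k).lTensor A (P.col g b)))) := by
      refine eqOn_pairSpan (f := P.canL ∘ₗ (inl a).left ∘ₗ S.rTensor A) (g := (inl a).left ∘ₗ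
        (LinearMap.mul' ℂ A ∘ₗ S.rTensor A).rTensor A ∘ₗ
          (TensorProduct.assoc ℂ A A A).symm.toLinearMap ∘ₗ (P.row k).lTensor A) ?_
          (P.col_mem hb g)
      rintro ⟨k', p⟩ _ x y ⟨h1, rfl, -, -, -⟩ u hu v hv
      dsimp only at h1
      subst h1
      rw [LinearMap.comp_apply, LinearMap.comp_apply, LinearMap.rTensor_tmul, left_inl,
        LinearMap.rTensor_tmul, LinearMap.mulLeft_apply,
        P.canL_tmul (𝒜.mul_mem ha (hS.1 _ _ _ _ u hu)) v]
      simp only [LinearMap.comp_apply, LinearMap.lTensor_tmul, LinearEquiv.coe_coe]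
      generalize P.row k' v = w
      induction w using TensorProduct.induction_on with
      | zero => simp
      | add x y hx hy => simp only [TensorProduct.tmul_add, map_add, hx, hy]
      | tmul s t => simp [left_inl]
    rw [h1, ← col_row_coassoc, LinearEquiv.symm_apply_apply]
    have h2 : (inl a).left ((LinearMap.mul' ℂ A ∘ₗ S.rTensor A).rTensor A
        ((P.col g).rTensor A (P.row k b))) = a ⊗ₜ sliceL P.counit (P.row k b) := by
      refine eqOn_pairSpan (f := (inl a).left ∘ₗ (LinearMap.mul' ℂ A ∘ₗ S.rTensor A).rTensor A ∘ₗ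
        (P.col g).rTensor A) (g := TensorProduct.mk ℂ A A a ∘ₗ sliceL P.counit) ?_
        (P.row_mem hb k)
      rintro _ ⟨l'', q⟩ x y ⟨rfl, h1, -, -, -⟩ u hu v hv
      dsimp only at h1
      subst h1
      simp only [LinearMap.comp_apply, LinearMap.rTensor_tmul]
      rw [hS.mul_rTensor_col hu, sliceL_tmul, left_inl, LinearMap.rTensor_tmul,
        LinearMap.mulLeft_apply]
      by_cases h5 : l'' = q
      · subst h5
        rw [mul_smul_comm, P.mul_one _ _ _ ha]
        simp [TensorProduct.smul_tmul']
      · rw [P.counit_support _ _ _ _ (Or.inr h5) u hu]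
        simp
    rw [h2, sliceL_counit_row, left_unitUp hb, if_pos rfl]
  · refine map_mem_of_mem_pairSpan T ?_ hz
    rintro x' ⟨g, l'⟩ ⟨k, m⟩ ⟨l, n⟩ h a ha b hb
    dsimp only at h
    subst h
    rw [hT _ _ _ _ ha]
    refine map_mem_of_mem_pairSpan ((inl a).left ∘ₗ S.rTensor A) ?_ (P.col_mem hb g)
    rintro ⟨k', p⟩ ⟨l'', q⟩ ⟨p', m'⟩ y' ⟨-, h3, -, -, h5⟩ u hu v hv
    dsimp only at h3 h5
    simp only [Prod.mk.injEq] at h3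
    obtain ⟨rfl, rfl⟩ := h3
    subst h5
    exact tmul_mem_pairSpan (𝒜.mul_mem ha (hS.1 _ _ _ _ u hu)) hv rfl

end IsAntipode

theorem canR_mapsTo {z : A ⊗[ℂ] A} :
    P.canR z ∈ 𝒜.pairSpan fun p p' => p.1.2 = p'.1.1 := by
  refine map_mem_of_mem_pairSpan P.canR ?_ (mem_pairSpan_true (𝒜 := 𝒜) z)
  rintro x y x' y' - a ha b hb
  rw [P.canR_tmul a hb]
  refine map_mem_of_mem_pairSpan (inr b).right ?_ (P.col_mem_corner_left x'.1 a)
  intro u v u' v' h c hc d hd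
  rw [right_inr, LinearMap.lTensor_tmul, LinearMap.mulRight_apply]
  by_cases h' : v' = x'
  · subst h'
    exact tmul_mem_pairSpan hc (𝒜.mul_mem hd hb) h
  · rw [𝒜.mul_eq_zero hd hb h', TensorProduct.tmul_zero]
    exact Submodule.zero_mem _

theorem canL_mapsTo {z : A ⊗[ℂ] A} :
    P.canL z ∈ 𝒜.pairSpan fun p p' => p.2.2 = p'.2.1 := by
  refine map_mem_of_mem_pairSpan P.canL ?_ (mem_pairSpan_true (𝒜 := 𝒜) z)
  rintro x y x' y' - a ha b hb
  rw [P.canL_tmul ha b]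
  refine map_mem_of_mem_pairSpan (inl a).left ?_ (P.row_mem_corner_right y.2 b)
  intro u v u' v' h c hc d hd
  rw [left_inl, LinearMap.rTensor_tmul, LinearMap.mulLeft_apply]
  by_cases h' : y = u
  · subst h'
    exact tmul_mem_pairSpan (𝒜.mul_mem ha hc) hd h
  · rw [𝒜.mul_eq_zero ha hc h', TensorProduct.zero_tmul]
    exact Submodule.zero_mem _

theorem IsAntipode.canR_bijOn {P : PartialBialgebra 𝒜} {S : A →ₗ[ℂ] A} (hS : P.IsAntipode S) :
    Set.BijOn P.canR (𝒜.pairSpan fun p p' => p.2.2 = p'.1.2 : Submodule ℂ (A ⊗[ℂ] A))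
      (𝒜.pairSpan fun p p' => p.1.2 = p'.1.1 : Submodule ℂ (A ⊗[ℂ] A)) := by
  obtain ⟨T, h1, h2, h3⟩ := hS.canR_invOn
  exact Set.InvOn.bijOn (f' := T) ⟨h1, h2⟩ (fun z _ => P.canR_mapsTo) h3

theorem IsAntipode.canL_bijOn {P : PartialBialgebra 𝒜} {S : A →ₗ[ℂ] A} (hS : P.IsAntipode S) :
    Set.BijOn P.canL (𝒜.pairSpan fun p p' => p.2.1 = p'.1.1 : Submodule ℂ (A ⊗[ℂ] A))
      (𝒜.pairSpan fun p p' => p.2.2 = p'.2.1 : Submodule ℂ (A ⊗[ℂ] A)) := by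
  obtain ⟨T, h1, h2, h3⟩ := hS.canL_invOn
  exact Set.InvOn.bijOn (f' := T) ⟨h1, h2⟩ (fun z _ => P.canL_mapsTo) h3

end PartialBialgebra

end PartialQG

/-! ### The antipode from bijectivity of a canonical map. -/

namespace PartialQG

open Multiplier PartialAlgebra

/-- A linear map that is bijective between two subspaces has a linear inverse there. -/
theorem exists_inverse_of_bijOn {V : Type*} [AddCommGroup V] [Module ℂ V] (T : V →ₗ[ℂ] V)
    (D C : Submodule ℂ V) (h : Set.BijOn T D C) : ∃ T' : V →ₗ[ℂ] V,
      (∀ z ∈ D, T' (T z) = z) ∧ (∀ z ∈ C, T (T' z) = z) ∧ ∀ z ∈ C, T' z ∈ D := by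
  have hb : Function.Bijective (T.restrict (p := D) (q := C) h.mapsTo) := by
    constructor
    · rintro ⟨x, hx⟩ ⟨y, hy⟩ hxy
      exact Subtype.ext (h.injOn hx hy (congrArg Subtype.val hxy))
    · rintro ⟨y, hy⟩
      obtain ⟨x, hx, hxy⟩ := h.surjOn hy
      exact ⟨⟨x, hx⟩, Subtype.ext hxy⟩
  let e := LinearEquiv.ofBijective _ hb
  obtain ⟨T', hT'⟩ := LinearMap.exists_extend (D.subtype ∘ₗ e.symm.toLinearMap)
  have h1 : ∀ z (hz : z ∈ C), T' z = e.symm ⟨z, hz⟩ := fun z hz => LinearMap.congr_fun hT' ⟨z, hz⟩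
  refine ⟨T', fun z hz => ?_, fun z hz => ?_, fun z hz => ?_⟩
  · rw [h1 _ (h.mapsTo hz)]
    exact congrArg Subtype.val (e.symm_apply_apply ⟨z, hz⟩)
  · rw [h1 _ hz]
    exact congrArg Subtype.val (e.apply_symm_apply ⟨z, hz⟩)
  · rw [h1 _ hz]
    exact (e.symm ⟨z, hz⟩).2

variable {I A : Type*} [NonUnitalRing A] [Module ℂ A] [IsScalarTower ℂ A A] [SMulCommClass ℂ A A]

namespace PartialBialgebra

variable {𝒜 : PartialAlgebra (I × I) A} (P : PartialBialgebra 𝒜)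

theorem canR_right_inr (z : A ⊗[ℂ] A) {x y : I × I} {b : A} (hb : b ∈ 𝒜.comp x y) :
    P.canR ((inr b).right z) = (inr b).right (P.canR z) := by
  refine LinearMap.congr_fun (f := P.canR ∘ₗ (inr b).right) (g := (inr b).right ∘ₗ P.canR)
    (𝒜.tensor_ext ?_) z
  intro u v u' v' a ha c hc
  rw [LinearMap.comp_apply, LinearMap.comp_apply, P.canR_tmul a hc]
  have h1 : (inr b).right (a ⊗ₜ[ℂ] c) = a ⊗ₜ[ℂ] (c * b) := rfl
  have h2 : ∀ w : A ⊗[ℂ] A, (inr b).right ((inr c).right w) = (inr (c * b)).right w := fun w => by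
    rw [← right_mul, inr, inr, ← tmul_mul, ← ofElem_mul, _root_.one_mul]
    rfl
  rw [h1, h2]
  by_cases h : v' = x
  · subst h
    rw [P.canR_tmul a (𝒜.mul_mem hc hb)]
  · rw [𝒜.mul_eq_zero hc hb h, TensorProduct.tmul_zero, map_zero, inr_zero, right_zero]

theorem inr_right_mem_pairSpan {z : A ⊗[ℂ] A} (hz : z ∈ 𝒜.pairSpan fun p p' => p.2.2 = p'.1.2)
    {x y : I × I} {b : A} (hb : b ∈ 𝒜.comp x y) :
    (inr b).right z ∈ 𝒜.pairSpan fun p p' => p.2.2 = p'.1.2 := by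
  refine map_mem_of_mem_pairSpan (inr b).right ?_ hz
  intro u v u' v' h c hc d hd
  rw [right_inr, LinearMap.lTensor_tmul, LinearMap.mulRight_apply]
  by_cases h' : v' = x
  · subst h'
    exact tmul_mem_pairSpan hc (𝒜.mul_mem hd hb) h
  · rw [𝒜.mul_eq_zero hd hb h', TensorProduct.tmul_zero]
    exact Submodule.zero_mem _

/-- The canonical map intertwines the gradings of its domain and codomain. -/
theorem canR_proj (k l m g : I) (z : A ⊗[ℂ] A) :
    P.canR (TensorProduct.map (𝒜.proj {p | p.1 = (k, m) ∧ p.2.1 = l}) (𝒜.proj {p | p.1.1 = g}) z) =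
      TensorProduct.map (𝒜.proj {p | p.1.1 = k ∧ p.2 = (l, g)}) (𝒜.proj {p | p.1.2 = m})
        (P.canR z) := by
  classical
  refine LinearMap.congr_fun (f := P.canR ∘ₗ TensorProduct.map _ _)
    (g := TensorProduct.map _ _ ∘ₗ P.canR) (𝒜.tensor_ext ?_) z
  rintro ⟨k', m'⟩ ⟨l', n⟩ ⟨g', h'⟩ y a ha b hb
  rw [LinearMap.comp_apply, LinearMap.comp_apply, P.canR_tmul a hb, TensorProduct.map_tmul,
    𝒜.proj_apply _ ha, 𝒜.proj_apply _ hb]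
  have h1 := eqOn_pairSpan (f := TensorProduct.map (𝒜.proj {p | p.1.1 = k ∧ p.2 = (l, g)})
    (𝒜.proj {p | p.1.2 = m}) ∘ₗ (inr b).right)
    (g := if ((k' = k ∧ m' = m) ∧ l' = l) ∧ g' = g then (inr b).right else 0) (by
      rintro ⟨k'', p⟩ _ ⟨p', m''⟩ _ ⟨h1, rfl, h2, rfl, -⟩ u hu v hv
      dsimp only at h1 h2
      subst h1 h2
      rw [LinearMap.comp_apply, right_inr, LinearMap.lTensor_tmul, LinearMap.mulRight_apply,
        TensorProduct.map_tmul, 𝒜.proj_apply _ hu]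
      by_cases h3 : (g', n) = (g', h')
      · obtain ⟨-, rfl⟩ := Prod.mk.inj h3
        rw [𝒜.proj_apply _ (𝒜.mul_mem hv hb)]
        simp only [Set.mem_ofPred_eq, Prod.mk.injEq]
        by_cases hk : k'' = k <;> by_cases hm : m'' = m <;> by_cases hl : l' = l <;>
          by_cases hg : g' = g <;> simp [hk, hm, hl, hg, right_inr]
      · have h4 : (inr b).right (u ⊗ₜ[ℂ] v) = 0 := by
          rw [right_inr, LinearMap.lTensor_tmul, LinearMap.mulRight_apply,
            𝒜.mul_eq_zero hv hb h3, TensorProduct.tmul_zero]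
        rw [𝒜.mul_eq_zero hv hb h3, map_zero, TensorProduct.tmul_zero]
        split_ifs
        · exact h4.symm
        · rfl) (P.col_mem ha g')
  rw [LinearMap.comp_apply] at h1
  by_cases hk : ((k', m'), (l', n)) ∈ {p : (I × I) × I × I | p.1 = (k, m) ∧ p.2.1 = l}
  · have hk' : (k' = k ∧ m' = m) ∧ l' = l := ⟨Prod.mk.inj hk.1, hk.2⟩
    by_cases hg : g' = g
    · rw [if_pos hk, if_pos (show ((g', h'), y) ∈ {p : (I × I) × I × I | p.1.1 = g} from hg),
        P.canR_tmul a hb, h1, if_pos ⟨hk', hg⟩]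
    · rw [if_neg (show ((g', h'), y) ∉ {p : (I × I) × I × I | p.1.1 = g} from hg),
        TensorProduct.tmul_zero, map_zero, h1, if_neg fun h => hg h.2]
      rfl
  · have hk' : ¬((k' = k ∧ m' = m) ∧ l' = l) := fun h =>
      hk ⟨Prod.ext h.1.1 h.1.2, h.2⟩
    rw [if_neg hk, TensorProduct.zero_tmul, map_zero, h1, if_neg fun h => hk' h.1]
    rfl

/-- Coassociativity expresses that the canonical map is colinear in its first leg. Its inverse
inherits this, which produces the identity `T(a ⊗ 1) = a₁ ⊗ S(a₂)` in `exists_isAntipode`. -/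
theorem assoc_row_canR (p : I) (z : A ⊗[ℂ] A) :
    TensorProduct.assoc ℂ A A A ((P.row p).rTensor A (P.canR z)) =
      P.canR.lTensor A (TensorProduct.assoc ℂ A A A ((P.row p).rTensor A z)) := by
  refine LinearMap.congr_fun (f := (TensorProduct.assoc ℂ A A A).toLinearMap ∘ₗ
    (P.row p).rTensor A ∘ₗ P.canR) (g := P.canR.lTensor A ∘ₗ
      (TensorProduct.assoc ℂ A A A).toLinearMap ∘ₗ (P.row p).rTensor A) (𝒜.tensor_ext ?_) z
  intro x y x' y' a ha b hb
  simp only [LinearMap.comp_apply, LinearEquiv.coe_coe]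
  rw [P.canR_tmul a hb]
  have h1 : ∀ w : A ⊗[ℂ] A, TensorProduct.assoc ℂ A A A ((P.row p).rTensor A ((inr b).right w)) =
      (inr b).right.lTensor A (TensorProduct.assoc ℂ A A A ((P.row p).rTensor A w)) := by
    intro w
    induction w using TensorProduct.induction_on with
    | zero => simp
    | add x y hx hy => simp only [map_add, hx, hy]
    | tmul s t =>
      rw [right_inr, LinearMap.lTensor_tmul, LinearMap.rTensor_tmul, LinearMap.rTensor_tmul]
      generalize P.row p s = u
      induction u using TensorProduct.induction_on with
      | zero => simp
      | add x y hx hy => simp only [TensorProduct.add_tmul, map_add, hx, hy]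
      | tmul u v => simp [right_inr]
  rw [h1, row_col_coassoc, LinearMap.rTensor_tmul]
  generalize P.row p a = u
  induction u using TensorProduct.induction_on with
  | zero => simp
  | add x y hx hy => simp only [TensorProduct.add_tmul, map_add, hx, hy]
  | tmul u v => simp [P.canR_tmul v hb]

/-- This is `ε(a₁)a₂b = ab`. Applied to `T z`, it evaluates the product of the two legs of `T z` as
`(ε ⊗ id)z`. -/
theorem sliceL_counit_canR (z : A ⊗[ℂ] A) :
    sliceL P.counit (P.canR z) = LinearMap.mul' ℂ A z := by
  classical
  refine LinearMap.congr_fun (f := sliceL P.counit ∘ₗ P.canR) (𝒜.tensor_ext ?_) z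
  intro x y x' y' a ha b hb
  rw [LinearMap.comp_apply, P.canR_tmul a hb, sliceL_right_inr, sliceL_counit_col, ← compat,
    left_unitUp hb, if_pos rfl, LinearMap.mul'_apply]

theorem canR_one {k l m n : I} {a : A} (ha : a ∈ 𝒜.comp (k, m) (l, n)) (q : I) :
    P.canR (a ⊗ₜ P.one (q, n)) = P.col q a := by
  rw [P.canR_tmul a (P.one_mem _)]
  refine eqOn_pairSpan (f := (inr (P.one (q, n))).right) (g := LinearMap.id) ?_ (P.col_mem ha q)
  rintro x y x' _ ⟨-, -, -, rfl, -⟩ u hu v hv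
  rw [right_inr, LinearMap.lTensor_tmul, LinearMap.mulRight_apply, P.mul_one _ _ _ hv]
  rfl

/-- Bijectivity of one canonical map yields an antipode. -/
theorem exists_isAntipode (h : Set.BijOn P.canR
    (𝒜.pairSpan fun p p' => p.2.2 = p'.1.2 : Submodule ℂ (A ⊗[ℂ] A))
    (𝒜.pairSpan fun p p' => p.1.2 = p'.1.1 : Submodule ℂ (A ⊗[ℂ] A))) : ∃ S, P.IsAntipode S := by
  classical
  obtain ⟨T, hTl, hTr, hTm⟩ := exists_inverse_of_bijOn P.canR _ _ h
  -- If `T(a ⊗ b) = a₁ ⊗ S(a₂)b`, then `G(a ⊗ b) = S(a)b`; so `S` is to be read off from `G` on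
  -- units.
  let G := sliceL P.counit ∘ₗ T
  have hT_inr : ∀ z ∈ 𝒜.pairSpan fun p p' => p.1.2 = p'.1.1, ∀ x y, ∀ b ∈ 𝒜.comp x y,
      T ((inr b).right z) = (inr b).right (T z) := by
    intro z hz x y b hb
    rw [← hTl _ (inr_right_mem_pairSpan (hTm z hz) hb), P.canR_right_inr _ hb, hTr z hz]
  have hG_inr : ∀ z ∈ 𝒜.pairSpan fun p p' => p.1.2 = p'.1.1, ∀ x y, ∀ b ∈ 𝒜.comp x y,
      G ((inr b).right z) = G z * b := by
    intro z hz x y b hb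
    simp only [G, LinearMap.comp_apply]
    rw [hT_inr z hz x y b hb, sliceL_right_inr]
  -- By `canR_proj` the canonical map intertwines projections onto index classes, so its inverse
  -- also respects them.
  have hTg : ∀ k l m n r y, ∀ a ∈ 𝒜.comp (k, m) (l, n), ∀ b ∈ 𝒜.comp (m, r) y,
      T (a ⊗ₜ b) ∈ 𝒜.pairSpan fun u v => (u.1 = (k, r) ∧ u.2.1 = l) ∧ v.1.1 = n ∧
        u.2.2 = v.1.2 := by
    intro k l m n r y a ha b hb
    have hz : a ⊗ₜ[ℂ] b ∈ 𝒜.pairSpan fun p p' => p.1.2 = p'.1.1 := tmul_mem_pairSpan ha hb rfl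
    have hm : ∀ z ∈ 𝒜.pairSpan fun p p' => p.2.2 = p'.1.2,
        TensorProduct.map (𝒜.proj {p | p.1 = (k, r) ∧ p.2.1 = l}) (𝒜.proj {p | p.1.1 = n}) z ∈
          𝒜.pairSpan fun u v => (u.1 = (k, r) ∧ u.2.1 = l) ∧ v.1.1 = n ∧ u.2.2 = v.1.2 := by
      intro z hz
      refine map_mem_of_mem_pairSpan (TensorProduct.map (𝒜.proj {p | p.1 = (k, r) ∧ p.2.1 = l})
        (𝒜.proj {p | p.1.1 = n})) ?_ hz
      intro x y x' y' hxy c hc d hd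
      rw [TensorProduct.map_tmul, 𝒜.proj_apply _ hc, 𝒜.proj_apply _ hd]
      split_ifs with h1 h2
      · exact tmul_mem_pairSpan hc hd ⟨h1, h2, hxy⟩
      · simp
      · simp
      · simp
    have h1 := hm _ (hTm _ hz)
    have h2 : 𝒜.pairSpan (fun u v => (u.1 = (k, r) ∧ u.2.1 = l) ∧ v.1.1 = n ∧ u.2.2 = v.1.2) ≤
        𝒜.pairSpan fun p p' => p.2.2 = p'.1.2 := pairSpan_mono fun _ _ h => h.2.2
    have h3 := hTl _ (h2 h1)
    rw [P.canR_proj, hTr _ hz, TensorProduct.map_tmul, 𝒜.proj_apply _ ha, 𝒜.proj_apply _ hb,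
      if_pos (by simp), if_pos (by simp)] at h3
    rw [h3]
    exact h1
  have hG_left : ∀ k l m n r y, ∀ a ∈ 𝒜.comp (k, m) (l, n), ∀ b ∈ 𝒜.comp (m, r) y,
      P.one (n, l) * G (a ⊗ₜ b) = G (a ⊗ₜ b) := by
    intro k l m n r y a ha b hb
    refine eqOn_pairSpan (f := LinearMap.mulLeft ℂ (P.one (n, l)) ∘ₗ sliceL P.counit)
      (g := sliceL P.counit) ?_ (hTg k l m n r y a ha b hb)
    rintro ⟨k', r'⟩ ⟨l', t⟩ ⟨n', t'⟩ y' ⟨⟨-, h1⟩, h2, h3⟩ u hu v hv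
    dsimp only at h1 h2 h3
    subst h1 h2 h3
    rw [LinearMap.comp_apply, sliceL_tmul, LinearMap.mulLeft_apply, mul_smul_comm]
    by_cases h4 : l' = t
    · subst h4
      rw [P.one_mul _ _ _ hv]
    · rw [P.counit_support _ _ _ _ (Or.inr h4) u hu, zero_smul, zero_smul]
  -- The first leg of `T(a ⊗ b)` has left indices `(k, r)`, and the counit needs them equal.
  have hG_zero : ∀ k l m n r y, ∀ a ∈ 𝒜.comp (k, m) (l, n), ∀ b ∈ 𝒜.comp (m, r) y, r ≠ k →
      G (a ⊗ₜ b) = 0 := by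
    intro k l m n r y a ha b hb hr
    refine eqOn_pairSpan (f := sliceL P.counit) (g := 0) ?_ (hTg k l m n r y a ha b hb)
    rintro _ ⟨l', t⟩ ⟨n', t'⟩ y' ⟨⟨rfl, -⟩, -, -⟩ u hu v hv
    rw [sliceL_tmul, P.counit_support _ _ _ _ (Or.inl hr.symm) u hu, zero_smul]
    rfl
  -- For left index `x = (k, m)` the unit must be `1(m, k)`: its upper index matches the lower left
  -- index of `a`, and by `hG_zero` only the lower index `k` contributes.
  obtain ⟨S, hS⟩ := 𝒜.exists_linearMap fun x _ =>
    G ∘ₗ (TensorProduct.mk ℂ A A).flip (P.one (x.2, x.1))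
  have hS' : ∀ k l m n, ∀ a ∈ 𝒜.comp (k, m) (l, n), S a = G (a ⊗ₜ P.one (m, k)) :=
    fun k l m n a ha => hS _ _ a ha
  have hSmem : ∀ k l m n, ∀ a ∈ 𝒜.comp (k, m) (l, n), S a ∈ 𝒜.comp (n, l) (m, k) := by
    intro k l m n a ha
    rw [hS' k l m n a ha]
    refine P.units.mem_comp_iff.2 ⟨hG_left k l m n k (m, k) a ha _ (P.one_mem _), ?_⟩
    have hz : a ⊗ₜ[ℂ] P.one (m, k) ∈ 𝒜.pairSpan fun p p' => p.1.2 = p'.1.1 :=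
      tmul_mem_pairSpan ha (P.one_mem _) rfl
    have h1 := hG_inr _ hz _ _ _ (P.one_mem (m, k))
    rw [right_inr, LinearMap.lTensor_tmul, LinearMap.mulRight_apply,
      P.mul_one _ _ _ (P.one_mem _)] at h1
    exact h1.symm
  have hGS : ∀ k l m n r y, ∀ a ∈ 𝒜.comp (k, m) (l, n), ∀ b ∈ 𝒜.comp (m, r) y,
      G (a ⊗ₜ b) = S a * b := by
    intro k l m n r y a ha b hb
    by_cases hr : r = k
    · subst hr
      have hz : a ⊗ₜ[ℂ] P.one (m, r) ∈ 𝒜.pairSpan fun p p' => p.1.2 = p'.1.1 :=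
        tmul_mem_pairSpan ha (P.one_mem _) rfl
      rw [hS' _ _ _ _ a ha, ← hG_inr _ hz _ _ b hb, right_inr, LinearMap.lTensor_tmul,
        LinearMap.mulRight_apply, P.one_mul _ _ _ hb]
    · rw [hG_zero _ _ _ _ _ _ a ha b hb hr, 𝒜.mul_eq_zero (hSmem _ _ _ _ a ha) hb]
      intro h'
      exact hr (Prod.mk.inj h').2.symm
  refine ⟨S, hSmem, fun k l m n a ha p => ?_, fun k l m n a ha q => ?_⟩
  · have h0 : ∑ᶠ q, LinearMap.mul' ℂ A (S.lTensor A (P.comul p q a)) =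
        LinearMap.mul' ℂ A (S.lTensor A (P.row p a)) :=
      (map_finsum (LinearMap.mul' ℂ A ∘ₗ S.lTensor A) (P.finite_right a p)).symm
    have hz : a ⊗ₜ[ℂ] P.one (m, p) ∈ 𝒜.pairSpan fun p p' => p.1.2 = p'.1.1 :=
      tmul_mem_pairSpan ha (P.one_mem _) rfl
    -- Write `a ⊗ 1(m,p)` as the canonical map of `T(a ⊗ 1(m,p))` and use colinearity; `G` cancels
    -- the canonical map up to a counit.
    have h1 : S.lTensor A (P.row p a) = T (a ⊗ₜ P.one (m, p)) := by
      have h2 : S.lTensor A (P.row p a) = G.lTensor A (TensorProduct.assoc ℂ A A A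
          ((P.row p).rTensor A (a ⊗ₜ P.one (m, p)))) := by
        refine eqOn_pairSpan (f := S.lTensor A) (g := G.lTensor A ∘ₗ
          (TensorProduct.assoc ℂ A A A).toLinearMap ∘ₗ
            (TensorProduct.mk ℂ (A ⊗[ℂ] A) A).flip (P.one (m, p))) ?_ (P.row_mem ha p)
        rintro x y _ y' ⟨-, -, rfl, -, -⟩ u hu v hv
        simp only [LinearMap.comp_apply, LinearMap.flip_apply, TensorProduct.mk_apply,
          LinearEquiv.coe_coe, TensorProduct.assoc_tmul, LinearMap.lTensor_tmul]
        rw [hS' _ _ _ _ v hv]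
      rw [h2, ← hTr _ hz, assoc_row_canR, hTr _ hz]
      refine eqOn_pairSpan (f := G.lTensor A ∘ₗ P.canR.lTensor A ∘ₗ
        (TensorProduct.assoc ℂ A A A).toLinearMap ∘ₗ (P.row p).rTensor A) (g := LinearMap.id) ?_
        (hTg k l m n p (m, p) a ha _ (P.one_mem _))
      rintro _ ⟨l', t⟩ ⟨n', t'⟩ y' ⟨⟨rfl, -⟩, -, h3⟩ u hu v hv
      dsimp only at h3
      subst h3
      have h4 : G.lTensor A (P.canR.lTensor A (TensorProduct.assoc ℂ A A A (P.row p u ⊗ₜ v))) =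
          sliceR P.counit (P.row p u) ⊗ₜ v := by
        refine eqOn_pairSpan (f := G.lTensor A ∘ₗ P.canR.lTensor A ∘ₗ
          (TensorProduct.assoc ℂ A A A).toLinearMap ∘ₗ (TensorProduct.mk ℂ (A ⊗[ℂ] A) A).flip v)
          (g := (TensorProduct.mk ℂ A A).flip v ∘ₗ sliceR P.counit) ?_ (P.row_mem hu p)
        rintro x y x' ⟨q, t'⟩ ⟨-, -, -, h5, -⟩ c hc d hd
        dsimp only at h5
        subst h5
        simp only [LinearMap.comp_apply, LinearMap.flip_apply, TensorProduct.mk_apply,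
          LinearEquiv.coe_coe, TensorProduct.assoc_tmul, LinearMap.lTensor_tmul, G]
        rw [hTl _ (tmul_mem_pairSpan hd hv rfl), sliceL_tmul, sliceR_tmul,
          TensorProduct.smul_tmul]
      simp only [LinearMap.comp_apply, LinearMap.rTensor_tmul, LinearEquiv.coe_coe]
      rw [h4, sliceR_counit_row, left_unitLo hu, if_pos rfl]
      rfl
    -- Multiplying the legs of `T z` amounts to applying `ε ⊗ id` to `z = a ⊗ 1(m,p)`. For `k ≠ m`
    -- the counit of `a` vanishes, so `1(m,p)` may be replaced by `1(k,p)`.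
    rw [h0, h1, ← sliceL_counit_canR, hTr _ hz, sliceL_tmul]
    by_cases hk : k = m
    · rw [hk]
    · rw [P.counit_support _ _ _ _ (Or.inl hk) a ha, zero_smul, zero_smul]
  · have h0 : ∑ᶠ p, LinearMap.mul' ℂ A (S.rTensor A (P.comul p q a)) =
        LinearMap.mul' ℂ A (S.rTensor A (P.col q a)) :=
      (map_finsum (LinearMap.mul' ℂ A ∘ₗ S.rTensor A) (P.finite_left a q)).symm
    -- The column is the image of `a ⊗ 1(q,n)` under the canonical map, so `G` sends it to
    -- `ε(a)1(q,n)`.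
    have h1 : LinearMap.mul' ℂ A (S.rTensor A (P.col q a)) = G (P.col q a) := by
      refine (eqOn_pairSpan (f := G) (g := LinearMap.mul' ℂ A ∘ₗ S.rTensor A) ?_
        (P.col_mem ha q)).symm
      rintro ⟨k', p⟩ ⟨l', q'⟩ ⟨p', m'⟩ y' ⟨-, -, -, -, h3⟩ u hu v hv
      dsimp only at h3
      subst h3
      rw [hGS _ _ _ _ _ _ u hu v hv]
      rfl
    rw [h0, h1, ← P.canR_one ha]
    simp only [G, LinearMap.comp_apply]
    rw [hTl _ (tmul_mem_pairSpan ha (P.one_mem (q, n)) rfl), sliceL_tmul]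

end PartialBialgebra

end PartialQG

/-! ### The involution and the canonical maps of `Δᵒᵖ`. -/

namespace PartialQG

open Multiplier PartialAlgebra

variable {I A : Type*} [NonUnitalRing A] [Module ℂ A] [IsScalarTower ℂ A A] [SMulCommClass ℂ A A]

namespace RegularPartialMultiplierBialgebra

/-- For a partial multiplier Hopf algebra corresponding to `P` the antipode of `P` exists. -/
theorem IsHopf.exists_isAntipode {𝒜 : PartialAlgebra (I × I) A}
    {H : RegularPartialMultiplierBialgebra 𝒜} (hH : H.IsHopf) {P : PartialBialgebra 𝒜}
    (h : Corresponds H P) : ∃ S, P.IsAntipode S := by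
  obtain ⟨⟨T, hT, hb⟩, -⟩ := hH
  have h1 : T = P.canR := TensorProduct.ext' fun a b =>
    ofElem_injective P.locallyUnital₂ (by rw [hT, h.comul_eq, P.ofElem_canR])
  rw [h1, iSup_loR_loL, iSup_loL_upL] at hb
  exact P.exists_isAntipode hb

end RegularPartialMultiplierBialgebra

variable [StarRing A] [StarModule ℂ A]

/-- The conjugate linear involution `a ⊗ b ↦ b^* ⊗ a^*`. -/
noncomputable def flipStar (z : A ⊗[ℂ] A) : A ⊗[ℂ] A := TensorProduct.comm ℂ A A (star z)

theorem flipStar_tmul (a b : A) : flipStar (a ⊗ₜ[ℂ] b) = star b ⊗ₜ star a := rfl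

theorem flipStar_add (z w : A ⊗[ℂ] A) : flipStar (z + w) = flipStar z + flipStar w := by
  simp [flipStar]

theorem flipStar_zero : flipStar (0 : A ⊗[ℂ] A) = 0 := by
  simp [flipStar]

theorem flipStar_smul (c : ℂ) (z : A ⊗[ℂ] A) : flipStar (c • z) = star c • flipStar z := by
  simp [flipStar]

theorem flipStar_flipStar (z : A ⊗[ℂ] A) : flipStar (flipStar z) = z := by
  induction z using TensorProduct.induction_on with
  | zero => simp [flipStar_zero]
  | add x y hx hy => rw [flipStar_add, flipStar_add, hx, hy]
  | tmul a b => simp [flipStar_tmul]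

theorem star_mul_tensor (z w : A ⊗[ℂ] A) : star (z * w) = star w * star z := by
  induction z using TensorProduct.induction_on with
  | zero => simp
  | add x y hx hy => simp only [add_mul, mul_add, star_add, hx, hy]
  | tmul a b =>
    induction w using TensorProduct.induction_on with
    | zero => simp
    | add x y hx hy => simp only [add_mul, mul_add, star_add, hx, hy]
    | tmul c d => simp [Algebra.TensorProduct.tmul_mul_tmul, TensorProduct.star_tmul]

/-- Conjugation of a linear map by the involution `a ⊗ b ↦ b^* ⊗ a^*`. -/
noncomputable def conjFlipStar (T : A ⊗[ℂ] A →ₗ[ℂ] A ⊗[ℂ] A) : A ⊗[ℂ] A →ₗ[ℂ] A ⊗[ℂ] A where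
  toFun z := flipStar (T (flipStar z))
  map_add' z w := by simp only [flipStar_add, map_add]
  map_smul' c z := by simp [flipStar_smul]

theorem flipStar_mem {𝒜 : PartialAlgebra (I × I) A} (hA : 𝒜.IsStar)
    {R : (I × I) × I × I → (I × I) × I × I → Prop} {z : A ⊗[ℂ] A} (hz : z ∈ 𝒜.pairSpan R) :
    flipStar z ∈ 𝒜.pairSpan fun p p' => R p'.swap p.swap := by
  refine pairSpan_induction (P := fun z => flipStar z ∈ 𝒜.pairSpan fun p p' => R p'.swap p.swap)
    hz ?_ ?_ ?_
  · intro x y x' y' h a ha b hb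
    exact tmul_mem_pairSpan (hA _ _ _ hb) (hA _ _ _ ha) h
  · rw [flipStar_zero]
    exact Submodule.zero_mem _
  · intro z w hz hw
    rw [flipStar_add]
    exact Submodule.add_mem _ hz hw

theorem conjFlipStar_bijOn {𝒜 : PartialAlgebra (I × I) A} (hA : 𝒜.IsStar)
    {T : A ⊗[ℂ] A →ₗ[ℂ] A ⊗[ℂ] A} {R R' : (I × I) × I × I → (I × I) × I × I → Prop}
    (h : Set.BijOn T (𝒜.pairSpan R : Submodule ℂ (A ⊗[ℂ] A))
      (𝒜.pairSpan R' : Submodule ℂ (A ⊗[ℂ] A))) :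
    Set.BijOn (conjFlipStar T)
      (𝒜.pairSpan fun p p' => R p'.swap p.swap : Submodule ℂ (A ⊗[ℂ] A))
      (𝒜.pairSpan fun p p' => R' p'.swap p.swap : Submodule ℂ (A ⊗[ℂ] A)) := by
  have h1 : ∀ R : (I × I) × I × I → (I × I) × I × I → Prop,
      Set.BijOn (flipStar : A ⊗[ℂ] A → A ⊗[ℂ] A) (𝒜.pairSpan R : Submodule ℂ (A ⊗[ℂ] A))
        (𝒜.pairSpan fun p p' => R p'.swap p.swap : Submodule ℂ (A ⊗[ℂ] A)) := fun R =>
    Set.InvOn.bijOn (s := (𝒜.pairSpan R : Submodule ℂ (A ⊗[ℂ] A))) (f' := flipStar)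
      ⟨fun z _ => flipStar_flipStar z, fun z _ => flipStar_flipStar z⟩
      (fun z hz => flipStar_mem hA hz)
      fun z hz => flipStar_mem (R := fun p p' => R p'.swap p.swap) hA hz
  exact (h1 R').comp (h.comp (h1 fun p p' => R p'.swap p.swap))

theorem star_left_inl (a : A) (x : A ⊗[ℂ] A) :
    star ((inl (star a)).right (star x)) = (inl a).left x := by
  induction x using TensorProduct.induction_on with
  | zero => simp
  | add x y hx hy => rw [star_add, map_add, star_add, hx, hy, map_add]
  | tmul c d => simp [TensorProduct.star_tmul, right_inl, left_inl]

theorem star_right_inr (a : A) (x : A ⊗[ℂ] A) :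
    star ((inr (star a)).left (star x)) = (inr a).right x := by
  induction x using TensorProduct.induction_on with
  | zero => simp
  | add x y hx hy => rw [star_add, map_add, star_add, hx, hy, map_add]
  | tmul c d => simp [TensorProduct.star_tmul, right_inr, left_inr]

theorem comm_left_inl (a : A) (x : A ⊗[ℂ] A) : (inl a).left (TensorProduct.comm ℂ A A x) =
    TensorProduct.comm ℂ A A ((inr a).left x) := by
  induction x using TensorProduct.induction_on with
  | zero => simp
  | add x y hx hy => simp only [map_add, hx, hy]
  | tmul c d => simp [left_inr, left_inl]

theorem comm_right_inr (a : A) (x : A ⊗[ℂ] A) : (inr a).right (TensorProduct.comm ℂ A A x) =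
    TensorProduct.comm ℂ A A ((inl a).right x) := by
  induction x using TensorProduct.induction_on with
  | zero => simp
  | add x y hx hy => simp only [map_add, hx, hy]
  | tmul c d => simp [right_inr, right_inl]

theorem PartialAlgebra.star_left_unitLo {𝒜 : PartialAlgebra (I × I) A} (hA : 𝒜.IsStar) (p : I)
    (a : A) : star ((𝒜.unitLo p).left a) = (𝒜.unitLo p).right (star a) := by
  classical
  refine 𝒜.induction_on (P := fun a => star ((𝒜.unitLo p).left a) = (𝒜.unitLo p).right (star a))
    a ?_ (by simp) fun a b ha hb => by simp only [map_add, star_add, ha, hb]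
  intro x y a ha
  rw [left_unitLo ha, right_unitLo (hA _ _ _ ha)]
  split_ifs <;> simp

theorem PartialAlgebra.star_left_unitUp {𝒜 : PartialAlgebra (I × I) A} (hA : 𝒜.IsStar) (p : I)
    (a : A) : star ((𝒜.unitUp p).left a) = (𝒜.unitUp p).right (star a) := by
  classical
  refine 𝒜.induction_on (P := fun a => star ((𝒜.unitUp p).left a) = (𝒜.unitUp p).right (star a))
    a ?_ (by simp) fun a b ha hb => by simp only [map_add, star_add, ha, hb]
  intro x y a ha
  rw [left_unitUp ha, right_unitUp (hA _ _ _ ha)]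
  split_ifs <;> simp

theorem PartialAlgebra.star_left_midUnit {𝒜 : PartialAlgebra (I × I) A} (hA : 𝒜.IsStar) (p : I)
    (z : A ⊗[ℂ] A) : star ((𝒜.midUnit p).left z) = (𝒜.midUnit p).right (star z) := by
  induction z using TensorProduct.induction_on with
  | zero => simp
  | add x y hx hy => simp only [map_add, star_add, hx, hy]
  | tmul a b =>
    simp only [midUnit, left_tmul, right_tmul, TensorProduct.map_tmul, TensorProduct.star_tmul,
      star_left_unitLo hA, star_left_unitUp hA]

theorem PartialAlgebra.star_right_midUnit {𝒜 : PartialAlgebra (I × I) A} (hA : 𝒜.IsStar) (p : I)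
    (z : A ⊗[ℂ] A) : star ((𝒜.midUnit p).right z) = (𝒜.midUnit p).left (star z) := by
  rw [← star_star z, ← star_left_midUnit hA, star_star, star_star]

namespace PartialBialgebra

variable {𝒜 : PartialAlgebra (I × I) A} (P : PartialBialgebra 𝒜)

theorem star_row (hP : ∀ p q a, star (P.comul p q a) = P.comul q p (star a)) (p : I) (a : A) :
    star (P.row p a) = P.col p (star a) :=
  ((starAddEquiv : A ⊗[ℂ] A ≃+ A ⊗[ℂ] A).map_finsum _).trans
    (finsum_congr fun q => hP p q a)

theorem star_col (hP : ∀ p q a, star (P.comul p q a) = P.comul q p (star a)) (p : I) (a : A) :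
    star (P.col p a) = P.row p (star a) := by
  rw [← star_star (P.row p (star a)), P.star_row hP, star_star]

theorem left_delta_star (hP : ∀ p q a, star (P.comul p q a) = P.comul q p (star a)) (a : A)
    (x : A ⊗[ℂ] A) : (P.delta (star a)).left x = star ((P.delta a).right (star x)) := by
  rw [left_delta, right_delta]
  refine Eq.trans (finsum_congr fun q => ?_)
    ((starAddEquiv : A ⊗[ℂ] A ≃+ A ⊗[ℂ] A).map_finsum _).symm
  rw [starAddEquiv_apply, star_mul_tensor, star_star, P.star_row hP]

theorem right_delta_star (hP : ∀ p q a, star (P.comul p q a) = P.comul q p (star a)) (a : A)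
    (x : A ⊗[ℂ] A) : (P.delta (star a)).right x = star ((P.delta a).left (star x)) := by
  have h := P.left_delta_star hP (star a) (star x)
  rw [star_star, star_star] at h
  rw [h, star_star]

/-- The adjoint of `(b^* ⊗ 1)Δ(a^*)` is `Δ(a)(b ⊗ 1)`, and the flip turns this into `Δᵒᵖ(a)(1 ⊗ b)`.
Bijectivity for `Δᵒᵖ` thus follows from that for `Δ`, without inverting the antipode. -/
theorem ofElem_conjFlipStar_canL
    (hP : ∀ p q a, star (P.comul p q a) = P.comul q p (star a)) (a b : A) :
    ofElem (conjFlipStar P.canL (a ⊗ₜ b)) = (P.delta a).flip * inr b := by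
  refine ext_left P.locallyUnital₂ fun x => ?_
  have h1 : conjFlipStar P.canL (a ⊗ₜ b) =
      TensorProduct.comm ℂ A A (star (P.canL (star b ⊗ₜ star a))) := rfl
  have h2 : ∀ y, star (P.canL (star b ⊗ₜ star a)) * y = (P.delta a).left ((inl b).left y) := by
    intro y
    have h3 : star y * P.canL (star b ⊗ₜ star a) =
        (P.delta (star a)).right ((inl (star b)).right (star y)) := by
      rw [← right_mul, ← ofElem_canL]
      rfl
    rw [← star_star (star (P.canL (star b ⊗ₜ star a)) * y), star_mul_tensor, star_star, h3,
      P.right_delta_star hP, star_star, star_left_inl]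
  have h4 : x = TensorProduct.comm ℂ A A (TensorProduct.comm ℂ A A x) := by simp
  rw [left_ofElem, h1]
  nth_rewrite 1 [h4]
  rw [← comm_mul, h2, comm_left_inl]
  rfl

theorem ofElem_conjFlipStar_canR
    (hP : ∀ p q a, star (P.comul p q a) = P.comul q p (star a)) (a b : A) :
    ofElem (conjFlipStar P.canR (a ⊗ₜ b)) = inl a * (P.delta b).flip := by
  refine ext_right P.locallyUnital₂ fun x => ?_
  have h1 : conjFlipStar P.canR (a ⊗ₜ b) =
      TensorProduct.comm ℂ A A (star (P.canR (star b ⊗ₜ star a))) := rfl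
  have h2 : ∀ y, y * star (P.canR (star b ⊗ₜ star a)) = (P.delta b).right ((inr a).right y) := by
    intro y
    have h3 : P.canR (star b ⊗ₜ star a) * star y =
        (P.delta (star b)).left ((inr (star a)).left (star y)) := by
      rw [← left_mul, ← ofElem_canR]
      rfl
    rw [← star_star (y * star (P.canR (star b ⊗ₜ star a))), star_mul_tensor, star_star, h3,
      P.left_delta_star hP, star_star, star_right_inr]
  have h4 : x = TensorProduct.comm ℂ A A (TensorProduct.comm ℂ A A x) := by simp
  rw [right_ofElem, h1]
  nth_rewrite 1 [h4]
  rw [← comm_mul, h2, comm_right_inr]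
  rfl

theorem IsPartialHopfStar.isHopfStar {P : PartialBialgebra 𝒜} (hP : P.IsPartialHopfStar) :
    P.toMultiplierBialgebra.IsHopfStar := by
  obtain ⟨⟨S, hS⟩, hA, hs⟩ := hP
  refine ⟨⟨⟨P.canR, P.ofElem_canR, ?_⟩, ⟨P.canL, P.ofElem_canL, ?_⟩,
    ⟨conjFlipStar P.canL, P.ofElem_conjFlipStar_canL hs, ?_⟩,
    ⟨conjFlipStar P.canR, P.ofElem_conjFlipStar_canR hs, ?_⟩⟩, hA,
    fun a x => ⟨P.left_delta_star hs a x, P.right_delta_star hs a x⟩⟩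
  · rw [iSup_loR_loL, iSup_loL_upL]
    exact hS.canR_bijOn
  · rw [iSup_upR_upL, iSup_loR_upR]
    exact hS.canL_bijOn
  · rw [iSup_upR_upL, iSup_upL_loL]
    simpa [eq_comm] using conjFlipStar_bijOn hA hS.canL_bijOn
  · rw [iSup_loR_loL, iSup_upR_loR]
    simpa [eq_comm] using conjFlipStar_bijOn hA hS.canR_bijOn

end PartialBialgebra

theorem Corresponds.isPartialHopfStar {𝒜 : PartialAlgebra (I × I) A}
    {H : RegularPartialMultiplierBialgebra 𝒜} {P : PartialBialgebra 𝒜} (h : Corresponds H P)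
    (hH : H.IsHopfStar) : P.IsPartialHopfStar := by
  obtain ⟨h1, hA, hs⟩ := hH
  refine ⟨h1.exists_isAntipode h, hA, fun p q a => ?_⟩
  refine ofElem_injective P.locallyUnital₂ (ext_left P.locallyUnital₂ fun x => ?_)
  have h2 : star (P.comul p q a) * x = star (star x * P.comul p q a) := by
    rw [star_mul_tensor, star_star]
  have h3 : star x * P.comul p q a = (𝒜.midUnit q).right ((H.comul a).right
      ((𝒜.midUnit p).right (star x))) := by
    rw [← right_ofElem, h.2.2]
    rfl
  rw [left_ofElem, h2, h3, star_right_midUnit hA, h.2.2]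
  have h4 := (hs a ((𝒜.midUnit p).left x)).1
  rw [star_left_midUnit hA] at h4
  rw [← h4]
  rfl

end PartialQG

/-! ### From (I) to (II): the multiplier `Δ(1(k,m))` and the components. -/

namespace PartialQG

open Multiplier PartialAlgebra

variable {I A : Type*} [NonUnitalRing A] [Module ℂ A] [IsScalarTower ℂ A A] [SMulCommClass ℂ A A]

namespace PartialAlgebra.Units

variable {𝒜 : PartialAlgebra (I × I) A} (U : 𝒜.Units)

/-- The unit `1(k, p) ⊗ 1(p, m)` of a component of `A ⊗^I A`. -/
noncomputable def mid (k p m : I) : A ⊗[ℂ] A := U.one (k, p) ⊗ₜ U.one (p, m)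

theorem locallyUnital₂ {𝒜 : PartialAlgebra (I × I) A} (U : 𝒜.Units) :
    LocallyUnital (A ⊗[ℂ] A) := U.locallyUnital.tensor U.locallyUnital

theorem mid_mul_mid (k p m : I) : U.mid k p m * U.mid k p m = U.mid k p m := by
  rw [mid, Algebra.TensorProduct.tmul_mul_tmul, U.one_mul_one, U.one_mul_one]

theorem mid_mul {k p m : I} {y y' : I × I} {z : A ⊗[ℂ] A}
    (hz : z ∈ tensorSub (𝒜.comp (k, p) y) (𝒜.comp (p, m) y')) : U.mid k p m * z = z := by
  refine eqOn_tensorSub (f := LinearMap.mulLeft ℂ (U.mid k p m)) (g := LinearMap.id) ?_ hz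
  intro a ha b hb
  rw [LinearMap.mulLeft_apply, mid, Algebra.TensorProduct.tmul_mul_tmul, U.one_mul _ _ _ ha,
    U.one_mul _ _ _ hb, LinearMap.id_apply]

open Classical in
theorem mid_mul_tmul (k p m : I) {k' t t' m' : I} {y y' : I × I} {a b : A}
    (ha : a ∈ 𝒜.comp (k', t) y) (hb : b ∈ 𝒜.comp (t', m') y') : U.mid k p m * (a ⊗ₜ b) =
      if (k = k' ∧ m = m') ∧ p = t ∧ p = t' then a ⊗ₜ b else 0 := by
  rw [mid, Algebra.TensorProduct.tmul_mul_tmul]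
  split_ifs with h
  · obtain ⟨⟨rfl, rfl⟩, rfl, rfl⟩ := h
    rw [U.one_mul _ _ _ ha, U.one_mul _ _ _ hb]
  · by_cases h1 : (k, p) = (k', t)
    · obtain ⟨rfl, rfl⟩ := Prod.mk.inj h1
      rw [U.one_mul_ne hb, TensorProduct.tmul_zero]
      intro h2
      obtain ⟨rfl, rfl⟩ := Prod.mk.inj h2
      exact h ⟨⟨rfl, rfl⟩, rfl, rfl⟩
    · rw [U.one_mul_ne ha h1, TensorProduct.zero_tmul]

theorem mid_mem (k p m : I) :
    U.mid k p m ∈ tensorSub (𝒜.comp (k, p) (k, p)) (𝒜.comp (p, m) (p, m)) :=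
  tmul_mem_tensorSub (U.one_mem _) (U.one_mem _)

theorem mul_mul_mem (x y x' y' : I × I) (z : A ⊗[ℂ] A) :
    (U.one x ⊗ₜ U.one x') * z * (U.one y ⊗ₜ U.one y') ∈ tensorSub (𝒜.comp x y) (𝒜.comp x' y') := by
  induction z using TensorProduct.induction_on with
  | zero => simp
  | add z w hz hw =>
    rw [mul_add, add_mul]
    exact Submodule.add_mem _ hz hw
  | tmul a b =>
    rw [Algebra.TensorProduct.tmul_mul_tmul, Algebra.TensorProduct.tmul_mul_tmul]
    exact tmul_mem_tensorSub (U.one_mul_mul_one_mem x y a) (U.one_mul_mul_one_mem x' y' b)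

end PartialAlgebra.Units

namespace RegularPartialMultiplierBialgebra

variable {𝒜 : PartialAlgebra (I × I) A} (H : RegularPartialMultiplierBialgebra 𝒜) (U : 𝒜.Units)

theorem left_comul_corner (a : A) (x : A ⊗[ℂ] A) :
    (H.comul a).left x ∈ 𝒜.pairSpan fun p p' => p.1.2 = p'.1.1 := by
  rw [← iSup_loL_upL]
  exact H.corner_left a x

theorem right_comul_corner (a : A) (x : A ⊗[ℂ] A) :
    (H.comul a).right x ∈ 𝒜.pairSpan fun p p' => p.2.2 = p'.2.1 := by
  rw [← iSup_loR_upR]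
  exact H.corner_right a x

theorem left_comul_mul (a b : A) (x : A ⊗[ℂ] A) :
    (H.comul (a * b)).left x = (H.comul a).left ((H.comul b).left x) := by
  rw [map_mul, left_mul]

/-- By `morphism_left`, `_xB` with `x = (k, m)` is spanned by the vectors `Δ(a)b` with `a = 1(x)a`,
so `Δ(1(x))` fixes all of it, and `U.mid k p m` lies in it. -/
theorem left_comul_one_mid_self (k p m : I) :
    (H.comul (U.one (k, m))).left (U.mid k p m) = U.mid k p m := by
  have h1 : (⨆ q, 𝒜.tensorComp (k, m) q) ≤
      LinearMap.eqLocus (H.comul (U.one (k, m))).left LinearMap.id := by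
    rw [← H.morphism_left (k, m), Submodule.span_le]
    rintro _ ⟨x, -, a, ha, rfl⟩
    rw [leftPart_eq] at ha
    have h2 : U.one (k, m) * a = a := by
      refine part_le (W := LinearMap.eqLocus (LinearMap.mulLeft ℂ (U.one (k, m)))
        LinearMap.id) |>.2 ?_ ha
      rintro r s rfl b hb
      exact U.one_mul _ _ _ hb
    change (H.comul (U.one (k, m))).left ((H.comul a).left x) = (H.comul a).left x
    rw [← left_comul_mul, h2]
  refine h1 ((le_iSup (fun q => 𝒜.tensorComp (k, m) q) (k, m)) ?_)
  exact le_iSup₂ (f := fun t u => tensorSub (𝒜.comp (k, t) (k, u)) (𝒜.comp (t, m) (u, m))) p p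
    (U.mid_mem k p m)

-- For equal inner indices the tensor is fixed by some `Δ(1(k',m'))`, and orthogonality of units
-- decides the rest. For different inner indices it is killed because `Δ(1(k,m)) = Δ(1(k,m))E`.
open Classical in
theorem left_comul_one_tmul (k m : I) {k' t t' m' : I} {y y' : I × I} {a b : A}
    (ha : a ∈ 𝒜.comp (k', t) y) (hb : b ∈ 𝒜.comp (t', m') y') :
    (H.comul (U.one (k, m))).left (a ⊗ₜ b) =
      if (k = k' ∧ m = m') ∧ t = t' then a ⊗ₜ b else 0 := by
  have h0 : t = t' → a ⊗ₜ[ℂ] b = (H.comul (U.one (k', m'))).left (a ⊗ₜ b) := by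
    rintro rfl
    have h1 : U.mid k' t m' * (a ⊗ₜ b) = a ⊗ₜ b := U.mid_mul (tmul_mem_tensorSub ha hb)
    rw [← h1, left_mul_apply U.locallyUnital₂, H.left_comul_one_mid_self]
  by_cases ht : t = t'
  · split_ifs with h
    · obtain ⟨⟨rfl, rfl⟩, -⟩ := h
      exact (h0 ht).symm
    · have h2 : (k, m) ≠ (k', m') := fun h3 => h ⟨Prod.mk.inj h3, ht⟩
      rw [h0 ht, ← left_comul_mul, U.one_mul_ne (U.one_mem _) h2, map_zero, left_zero]
  · rw [if_neg fun h => ht h.2]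
    refine U.locallyUnital₂.eq_of_mul_left fun z => ?_
    rw [compat, mul_zero]
    refine eqOn_pairSpan (f := LinearMap.mulRight ℂ (a ⊗ₜ[ℂ] b)) (g := 0) ?_
      (H.right_comul_corner (U.one (k, m)) z)
    rintro u ⟨l, s⟩ u' ⟨s', n⟩ h c hc d hd
    dsimp only at h
    subst h
    rw [LinearMap.mulRight_apply, Algebra.TensorProduct.tmul_mul_tmul, LinearMap.zero_apply]
    by_cases h3 : (l, s) = (k', t)
    · rw [𝒜.mul_eq_zero hd hb, TensorProduct.tmul_zero]
      rintro h4
      exact ht ((Prod.mk.inj h3).2.symm.trans (Prod.mk.inj h4).1)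
    · rw [𝒜.mul_eq_zero hc ha h3, TensorProduct.zero_tmul]

/-- Two multipliers agree if they do so on homogeneous tensors. -/
theorem _root_.PartialQG.PartialAlgebra.Units.multiplier_ext {𝒜 : PartialAlgebra (I × I) A}
    (U : 𝒜.Units) {m n : Multiplier (A ⊗[ℂ] A)}
    (h : ∀ k t y t' l y', ∀ a ∈ 𝒜.comp (k, t) y, ∀ b ∈ 𝒜.comp (t', l) y',
      m.left (a ⊗ₜ b) = n.left (a ⊗ₜ b)) : m = n :=
  ext_left U.locallyUnital₂ fun x => LinearMap.congr_fun (𝒜.tensor_ext (f := m.left)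
    (g := n.left) fun u v u' v' a ha b hb => h u.1 u.2 v u'.1 u'.2 v' a ha b hb) x

/-- This is where compact type enters: `Δ(1(k,m))(1_p ⊗ 1^p)` is the element `1(k,p) ⊗ 1(p,m)`, so
every `Δ(a)(1_q ⊗ 1^q)` lies in `A ⊗ A`. -/
theorem comul_one_mul_midUnit (k m p : I) :
    H.comul (U.one (k, m)) * 𝒜.midUnit p = ofElem (U.mid k p m) := by
  classical
  refine U.multiplier_ext fun k' t y t' l y' a ha b hb => ?_
  rw [left_mul, left_midUnit_tmul ha hb, left_ofElem, U.mid_mul_tmul k p m ha hb]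
  simp only
  split_ifs with h1 h2 h2
  · rw [H.left_comul_one_tmul U k m ha hb, if_pos ⟨h2.1, h2.2.1.symm.trans h2.2.2⟩]
  · rw [H.left_comul_one_tmul U k m ha hb, if_neg]
    rintro ⟨h3, rfl⟩
    exact h2 ⟨h3, by simp_all, by simp_all⟩
  · exact absurd ⟨h2.2.1.symm, h2.2.2.symm⟩ h1
  · rw [map_zero]

theorem midUnit_mul_comul_one (k m p : I) :
    𝒜.midUnit p * H.comul (U.one (k, m)) = ofElem (U.mid k p m) := by
  classical
  refine U.multiplier_ext fun k' t y t' l y' a ha b hb => ?_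
  rw [left_mul, H.left_comul_one_tmul U k m ha hb, left_ofElem, U.mid_mul_tmul k p m ha hb]
  split_ifs with h1 h2 h2
  · rw [left_midUnit_tmul ha hb, if_pos ⟨h2.2.1.symm, h2.2.2.symm⟩]
  · rw [left_midUnit_tmul ha hb, if_neg]
    rintro ⟨h3, h4⟩
    exact h2 ⟨h1.1, h3.symm, h4.symm⟩
  · exact absurd ⟨h2.1, h2.2.1.symm.trans h2.2.2⟩ h1
  · rw [map_zero]

theorem comul_one_mul_inr (k m : I) :
    H.comul (U.one (k, m)) * inr (U.one (k, m)) = ofElem (U.mid k k m) := by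
  classical
  refine U.multiplier_ext fun k' t y t' l y' a ha b hb => ?_
  rw [left_mul, left_inr, LinearMap.lTensor_tmul, LinearMap.mulLeft_apply, left_ofElem,
    U.mid_mul_tmul k k m ha hb]
  by_cases h : (k, m) = (t', l)
  · obtain ⟨rfl, rfl⟩ := Prod.mk.inj h
    rw [U.one_mul _ _ _ hb, H.left_comul_one_tmul U k m ha hb]
    simp only [and_true]
    exact if_congr ⟨fun h => ⟨h.1, h.2.symm⟩, fun h => ⟨h.1, h.2.symm⟩⟩ rfl rfl
  · rw [U.one_mul_ne hb h, TensorProduct.tmul_zero, map_zero, if_neg]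
    rintro ⟨⟨-, rfl⟩, -, rfl⟩
    exact h rfl

theorem comul_one_mul_inl (k m : I) :
    H.comul (U.one (k, m)) * inl (U.one (k, m)) = ofElem (U.mid k m m) := by
  classical
  refine U.multiplier_ext fun k' t y t' l y' a ha b hb => ?_
  rw [left_mul, left_inl, LinearMap.rTensor_tmul, LinearMap.mulLeft_apply, left_ofElem,
    U.mid_mul_tmul k m m ha hb]
  by_cases h : (k, m) = (k', t)
  · obtain ⟨rfl, rfl⟩ := Prod.mk.inj h
    rw [U.one_mul _ _ _ ha, H.left_comul_one_tmul U k m ha hb]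
    simp only [true_and]
  · rw [U.one_mul_ne ha h, TensorProduct.zero_tmul, map_zero, if_neg]
    rintro ⟨⟨rfl, -⟩, rfl, -⟩
    exact h rfl

/-- The components `Δ_{pq}` of the comultiplication. -/
theorem exists_components (U : 𝒜.Units) (p q : I) : ∃ D : A →ₗ[ℂ] A ⊗[ℂ] A, ∀ k l m n,
    ∀ a ∈ 𝒜.comp (k, m) (l, n), D a = U.mid k p m * (H.comul a).left (U.mid l q n) := by
  let L : A ⊗[ℂ] A → A →ₗ[ℂ] A ⊗[ℂ] A := fun z =>
    { toFun := fun a => (H.comul a).left z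
      map_add' := fun a b => by rw [map_add, left_add]
      map_smul' := fun c a => by rw [map_smul, left_smul, RingHom.id_apply] }
  obtain ⟨D, hD⟩ := 𝒜.exists_linearMap fun x y =>
    LinearMap.mulLeft ℂ (U.mid x.1 p x.2) ∘ₗ L (U.mid y.1 q y.2)
  exact ⟨D, fun k l m n a ha => hD _ _ a ha⟩

end RegularPartialMultiplierBialgebra

end PartialQG

/-! ### The components form a partial bialgebra. -/

namespace PartialQG

open Multiplier PartialAlgebra

variable {I A : Type*} [NonUnitalRing A] [Module ℂ A] [IsScalarTower ℂ A A] [SMulCommClass ℂ A A]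

namespace RegularPartialMultiplierBialgebra

variable {𝒜 : PartialAlgebra (I × I) A} (H : RegularPartialMultiplierBialgebra 𝒜) (U : 𝒜.Units)

/-- The component `Δ_{pq}` of the comultiplication. -/
noncomputable def component (p q : I) : A →ₗ[ℂ] A ⊗[ℂ] A := (H.exists_components U p q).choose

variable {k l m n : I} {a : A}

theorem component_eq (ha : a ∈ 𝒜.comp (k, m) (l, n)) (p q : I) :
    H.component U p q a = U.mid k p m * (H.comul a).left (U.mid l q n) :=
  (H.exists_components U p q).choose_spec k l m n a ha

theorem comul_eq_one_mul (ha : a ∈ 𝒜.comp (k, m) (l, n)) :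
    H.comul a = H.comul (U.one (k, m)) * H.comul a := by
  rw [← map_mul, U.one_mul _ _ _ ha]

theorem comul_eq_mul_one (ha : a ∈ 𝒜.comp (k, m) (l, n)) :
    H.comul a = H.comul a * H.comul (U.one (l, n)) := by
  rw [← map_mul, U.mul_one _ _ _ ha]

theorem midUnit_mul_comul (ha : a ∈ 𝒜.comp (k, m) (l, n)) (p : I) :
    𝒜.midUnit p * H.comul a = ofElem ((H.comul a).right (U.mid k p m)) := by
  rw [H.comul_eq_one_mul U ha, ← mul_assoc, midUnit_mul_comul_one, ofElem_mul' U.locallyUnital₂,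
    ← H.comul_eq_one_mul U ha]

theorem comul_mul_midUnit (ha : a ∈ 𝒜.comp (k, m) (l, n)) (q : I) :
    H.comul a * 𝒜.midUnit q = ofElem ((H.comul a).left (U.mid l q n)) := by
  rw [H.comul_eq_mul_one U ha, mul_assoc, comul_one_mul_midUnit, mul_ofElem U.locallyUnital₂,
    ← H.comul_eq_mul_one U ha]

theorem left_midUnit_left_comul (ha : a ∈ 𝒜.comp (k, m) (l, n)) (p : I) (x : A ⊗[ℂ] A) :
    (𝒜.midUnit p).left ((H.comul a).left x) = U.mid k p m * (H.comul a).left x := by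
  rw [← left_mul, H.midUnit_mul_comul U ha, left_ofElem, ← compat]

theorem ofElem_component (p q : I) (a : A) : ofElem (H.component U p q a) =
    𝒜.midUnit p * H.comul a * 𝒜.midUnit q := by
  refine 𝒜.induction_on (P := fun a => ofElem (H.component U p q a) =
    𝒜.midUnit p * H.comul a * 𝒜.midUnit q) a ?_ (by simp)
    fun a b ha hb => by rw [map_add, map_add, ha, hb, map_add, mul_add, add_mul]
  rintro ⟨k, m⟩ ⟨l, n⟩ a ha
  rw [mul_assoc, H.comul_mul_midUnit U ha, mul_ofElem U.locallyUnital₂,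
    H.left_midUnit_left_comul U ha, ← H.component_eq U ha]

theorem component_eq_midUnit (ha : a ∈ 𝒜.comp (k, m) (l, n)) (p q : I) :
    H.component U p q a = (𝒜.midUnit p).left ((H.comul a).left (U.mid l q n)) := by
  rw [H.left_midUnit_left_comul U ha, H.component_eq U ha]

theorem component_eq_right (ha : a ∈ 𝒜.comp (k, m) (l, n)) (p q : I) :
    H.component U p q a = (𝒜.midUnit q).right ((H.comul a).right (U.mid k p m)) := by
  refine ofElem_injective U.locallyUnital₂ ?_
  rw [ofElem_component, H.midUnit_mul_comul U ha, ofElem_mul' U.locallyUnital₂]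

theorem left_comul_mul_apply (U : 𝒜.Units) (a : A) (x y : A ⊗[ℂ] A) :
    (H.comul a).left (x * y) = (H.comul a).left x * y := left_mul_apply U.locallyUnital₂ _ _ _

theorem component_mem (ha : a ∈ 𝒜.comp (k, m) (l, n)) (p q : I) : H.component U p q a ∈
    tensorSub (𝒜.comp (k, p) (l, q)) (𝒜.comp (p, m) (q, n)) := by
  rw [H.component_eq U ha, ← U.mid_mul_mid l q n, H.left_comul_mul_apply U, ← mul_assoc]
  exact U.mul_mul_mem _ _ _ _ _

/-- `Δ(a)(1_q ⊗ 1^q)` is a single element in the range of `E`, hence a finite sum of its pieces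
under the `1_p ⊗ 1^p`. The finiteness axiom has the same source. -/
theorem left_comul_mid_eq_finsum (ha : a ∈ 𝒜.comp (k, m) (l, n)) (q : I) :
    (H.comul a).left (U.mid l q n) = ∑ᶠ p, H.component U p q a := by
  rw [← finsum_left_midUnit (H.left_comul_corner a (U.mid l q n))]
  exact finsum_congr fun p => (H.component_eq_midUnit U ha p q).symm

theorem finite_component_left (a : A) (q : I) : {p | H.component U p q a ≠ 0}.Finite := by
  refine 𝒜.induction_on (P := fun a => {p | H.component U p q a ≠ 0}.Finite) a ?_ (by simp) ?_
  · rintro ⟨k, m⟩ ⟨l, n⟩ a ha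
    simp only [H.component_eq_midUnit U ha]
    exact finite_left_midUnit (𝒜 := 𝒜) ((H.comul a).left (U.mid l q n))
  · intro a b ha hb
    refine (ha.union hb).subset fun p hp => ?_
    by_contra h
    simp only [Set.mem_union, Set.mem_ofPred_eq, not_or, not_not] at h
    exact hp (by rw [map_add, h.1, h.2, add_zero])

theorem finite_component_right (a : A) (p : I) : {q | H.component U p q a ≠ 0}.Finite := by
  refine 𝒜.induction_on (P := fun a => {q | H.component U p q a ≠ 0}.Finite) a ?_ (by simp) ?_
  · rintro ⟨k, m⟩ ⟨l, n⟩ a ha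
    simp only [H.component_eq_right U ha]
    exact finite_right_midUnit (𝒜 := 𝒜) ((H.comul a).right (U.mid k p m))
  · intro a b ha hb
    refine (ha.union hb).subset fun p hp => ?_
    by_contra h
    simp only [Set.mem_union, Set.mem_ofPred_eq, not_or, not_not] at h
    exact hp (by rw [map_add, h.1, h.2, add_zero])

theorem component_one_same (k l m : I) : H.component U l l (U.one (k, m)) = U.mid k l m := by
  rw [H.component_eq_midUnit U (U.one_mem (k, m)), H.left_comul_one_mid_self]
  classical
  rw [left_midUnit_tensorSub (U.mid_mem k l m), if_pos ⟨rfl, rfl⟩]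

theorem component_one_ne (k m : I) {l l' : I} (h : l ≠ l') :
    H.component U l l' (U.one (k, m)) = 0 := by
  rw [H.component_eq_midUnit U (U.one_mem (k, m)), H.left_comul_one_mid_self]
  classical
  rw [left_midUnit_tensorSub (U.mid_mem k l' m), if_neg fun h' => h h'.1.symm]

theorem counit_mul_of_mem_comp {x y z : I × I} {a b : A} (ha : a ∈ 𝒜.comp x y)
    (hb : b ∈ 𝒜.comp y z) : H.counit (a * b) = H.counit a * H.counit b := by
  refine H.counit_mul y a ?_ b ?_
  · rw [rightPart_eq]
    exact comp_le_part (by simp) ha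
  · rw [leftPart_eq]
    exact comp_le_part (by simp) hb

/-- On components of `A_k` where the counit can be non-zero, `ε(b) = ε(b)ε(1(k,k))`. If `ε(1(k,k)) ≠
1`, the counit would vanish on `A_k`. -/
theorem counit_one (k : I) : H.counit (U.one (k, k)) = 1 := by
  obtain ⟨⟨a, ha, h⟩, -⟩ := H.counit_ne_zero k
  by_contra h1
  refine h ?_
  rw [loR_eq] at ha
  refine (part_le (W := LinearMap.ker H.counit)).2 ?_ ha
  rintro ⟨r, t⟩ ⟨s, u⟩ hu b hb
  simp only [Set.mem_ofPred_eq] at hu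
  subst hu
  rw [LinearMap.mem_ker]
  by_cases hs : s = u
  · subst hs
    have h2 := H.counit_mul_of_mem_comp hb (U.one_mem _)
    rw [U.mul_one _ _ _ hb] at h2
    by_contra h3
    exact h1 (mul_left_cancel₀ h3 (by rw [← h2, _root_.mul_one]))
  · exact H.counit_support _ _ _ _ (Or.inr hs) b hb

/-- The components `Δ_tq(b)` add up to `Δ(b)` cut on the right, to which `Δ(a)` may be applied term
by term. -/
theorem component_mul (p q : I) {x y z : I × I} {a b : A} (ha : a ∈ 𝒜.comp x y)
    (hb : b ∈ 𝒜.comp y z) :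
    H.component U p q (a * b) = ∑ᶠ t, H.component U p t a * H.component U t q b := by
  obtain ⟨k, m⟩ := x
  obtain ⟨l, n⟩ := y
  obtain ⟨l', n'⟩ := z
  have h1 : ∀ t, H.component U p t a * H.component U t q b =
      (LinearMap.mulLeft ℂ (U.mid k p m) ∘ₗ (H.comul a).left) (H.component U t q b) := by
    intro t
    rw [H.component_eq U ha, mul_assoc, ← H.left_comul_mul_apply U, U.mid_mul (H.component_mem U hb t q)]
    rfl
  rw [finsum_congr h1, ← map_finsum _ (H.finite_component_left U b q),
    ← H.left_comul_mid_eq_finsum U hb, H.component_eq U (𝒜.mul_mem ha hb), left_comul_mul]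
  rfl

/-- Multiplying `Δ(a)` by `1 ⊗ 1(l,n)` selects the column `l`, and the support of the counit then
leaves only the row `k`. -/
theorem counit_left_component (ha : a ∈ 𝒜.comp (k, m) (l, n)) :
    sliceL H.counit (H.component U k l a) = a := by
  have h1 : ofElem ((H.comul a).left (U.mid l l n)) = H.comul a * inr (U.one (l, n)) := by
    nth_rewrite 2 [H.comul_eq_mul_one U ha]
    rw [mul_assoc, comul_one_mul_inr, mul_ofElem U.locallyUnital₂]
  have h2 := (H.counit_left a _ _).1 h1
  rw [left_ofElem, U.mul_one _ _ _ ha, H.left_comul_mid_eq_finsum U ha,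
    map_finsum _ (H.finite_component_left U a l), finsum_eq_single _ k] at h2
  · exact h2
  · intro p hp
    refine eqOn_tensorSub (f := sliceL H.counit) (g := 0) ?_ (H.component_mem U ha p l)
    intro b hb c hc
    rw [sliceL_tmul, H.counit_support _ _ _ _ (Or.inl hp.symm) b hb, zero_smul]
    rfl

theorem counit_right_component (ha : a ∈ 𝒜.comp (k, m) (l, n)) :
    sliceR H.counit (H.component U m n a) = a := by
  have h1 : ofElem ((H.comul a).left (U.mid l n n)) = H.comul a * inl (U.one (l, n)) := by
    nth_rewrite 2 [H.comul_eq_mul_one U ha]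
    rw [mul_assoc, comul_one_mul_inl, mul_ofElem U.locallyUnital₂]
  have h2 := (H.counit_right a _ _).1 h1
  rw [left_ofElem, U.mul_one _ _ _ ha, H.left_comul_mid_eq_finsum U ha,
    map_finsum _ (H.finite_component_left U a n), finsum_eq_single _ m] at h2
  · exact h2
  · intro p hp
    refine eqOn_tensorSub (f := sliceR H.counit) (g := 0) ?_ (H.component_mem U ha p n)
    intro b hb c hc
    rw [sliceR_tmul, H.counit_support _ _ _ _ (Or.inl hp) c hc, zero_smul]
    rfl

theorem mid_mem_tensorI (k p m : I) : U.mid k p m ∈ 𝒜.tensorI := by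
  refine le_iSup₂ (f := fun x y => 𝒜.tensorComp x y) (k, m) (k, m) ?_
  exact le_iSup₂ (f := fun t u => tensorSub (𝒜.comp (k, t) (k, u)) (𝒜.comp (t, m) (u, m))) p p
    (U.mid_mem k p m)

theorem comulId_component (ha : a ∈ 𝒜.comp (k, m) (l, n)) (p q r s : I) :
    (H.component U p q).rTensor A (H.component U r s a) =
      (U.mid k p r ⊗ₜ U.one (r, m)) * (comulId (H.comul : A →ₗ[ℂ] Multiplier (A ⊗[ℂ] A))
        (H.component U r s a)).left (U.mid l q s ⊗ₜ U.one (s, n)) := by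
  let L : A ⊗[ℂ] A →ₗ[ℂ] (A ⊗[ℂ] A) ⊗[ℂ] A :=
    { toFun := fun w => (U.mid k p r ⊗ₜ U.one (r, m)) *
        (comulId (H.comul : A →ₗ[ℂ] Multiplier (A ⊗[ℂ] A)) w).left (U.mid l q s ⊗ₜ U.one (s, n))
      map_add' := fun x y => by rw [map_add, left_add, mul_add]
      map_smul' := fun c x => by rw [map_smul, left_smul, mul_smul_comm, RingHom.id_apply] }
  refine eqOn_tensorSub (g := L) ?_ (H.component_mem U ha r s)
  intro b hb c hc
  change _ = (U.mid k p r ⊗ₜ U.one (r, m)) * (comulId (H.comul : A →ₗ[ℂ] Multiplier (A ⊗[ℂ] A))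
    (b ⊗ₜ c)).left (U.mid l q s ⊗ₜ U.one (s, n))
  have h1 : (comulId (H.comul : A →ₗ[ℂ] Multiplier (A ⊗[ℂ] A)) (b ⊗ₜ c)).left
      (U.mid l q s ⊗ₜ U.one (s, n)) = (H.comul b).left (U.mid l q s) ⊗ₜ (c * U.one (s, n)) := rfl
  rw [h1, U.mul_one _ _ _ hc, Algebra.TensorProduct.tmul_mul_tmul, U.one_mul _ _ _ hc,
    ← H.component_eq U hb, LinearMap.rTensor_tmul]

theorem idComul_component (ha : a ∈ 𝒜.comp (k, m) (l, n)) (p q r s : I) :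
    (H.component U r s).lTensor A (H.component U p q a) =
      (U.one (k, p) ⊗ₜ U.mid p r m) * (idComul (H.comul : A →ₗ[ℂ] Multiplier (A ⊗[ℂ] A))
        (H.component U p q a)).left (U.one (l, q) ⊗ₜ U.mid q s n) := by
  let L : A ⊗[ℂ] A →ₗ[ℂ] A ⊗[ℂ] (A ⊗[ℂ] A) :=
    { toFun := fun w => (U.one (k, p) ⊗ₜ U.mid p r m) *
        (idComul (H.comul : A →ₗ[ℂ] Multiplier (A ⊗[ℂ] A)) w).left (U.one (l, q) ⊗ₜ U.mid q s n)
      map_add' := fun x y => by rw [map_add, left_add, mul_add]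
      map_smul' := fun c x => by rw [map_smul, left_smul, mul_smul_comm, RingHom.id_apply] }
  refine eqOn_tensorSub (g := L) ?_ (H.component_mem U ha p q)
  intro b hb c hc
  change _ = (U.one (k, p) ⊗ₜ U.mid p r m) * (idComul (H.comul : A →ₗ[ℂ] Multiplier (A ⊗[ℂ] A))
    (b ⊗ₜ c)).left (U.one (l, q) ⊗ₜ U.mid q s n)
  have h1 : (idComul (H.comul : A →ₗ[ℂ] Multiplier (A ⊗[ℂ] A)) (b ⊗ₜ c)).left
      (U.one (l, q) ⊗ₜ U.mid q s n) = (b * U.one (l, q)) ⊗ₜ (H.comul c).left (U.mid q s n) := rfl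
  rw [h1, U.mul_one _ _ _ hb, Algebra.TensorProduct.tmul_mul_tmul, U.one_mul _ _ _ hb,
    ← H.component_eq U hc, LinearMap.lTensor_tmul]

theorem comulId_component_ne (ha : a ∈ 𝒜.comp (k, m) (l, n)) (p q s : I) {r r' : I}
    (h : r ≠ r') : (U.mid k p r ⊗ₜ U.one (r, m)) *
      (comulId (H.comul : A →ₗ[ℂ] Multiplier (A ⊗[ℂ] A))
        (H.component U r' s a)).left (U.mid l q s ⊗ₜ U.one (s, n)) = 0 := by
  let L : A ⊗[ℂ] A →ₗ[ℂ] (A ⊗[ℂ] A) ⊗[ℂ] A :=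
    { toFun := fun w => (U.mid k p r ⊗ₜ U.one (r, m)) *
        (comulId (H.comul : A →ₗ[ℂ] Multiplier (A ⊗[ℂ] A)) w).left (U.mid l q s ⊗ₜ U.one (s, n))
      map_add' := fun x y => by rw [map_add, left_add, mul_add]
      map_smul' := fun c x => by rw [map_smul, left_smul, mul_smul_comm, RingHom.id_apply] }
  refine eqOn_tensorSub (f := L) (g := 0) ?_ (H.component_mem U ha r' s)
  intro b hb c hc
  change (U.mid k p r ⊗ₜ[ℂ] U.one (r, m)) *
    ((H.comul b).left (U.mid l q s) ⊗ₜ[ℂ] (c * U.one (s, n))) = 0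
  rw [U.mul_one _ _ _ hc, Algebra.TensorProduct.tmul_mul_tmul,
    U.one_mul_ne hc fun h' => h (Prod.mk.inj h').1, TensorProduct.tmul_zero]

theorem idComul_component_ne (ha : a ∈ 𝒜.comp (k, m) (l, n)) (q r s : I) {p p' : I}
    (h : p ≠ p') : (U.one (k, p) ⊗ₜ U.mid p r m) *
      (idComul (H.comul : A →ₗ[ℂ] Multiplier (A ⊗[ℂ] A))
        (H.component U p' q a)).left (U.one (l, q) ⊗ₜ U.mid q s n) = 0 := by
  let L : A ⊗[ℂ] A →ₗ[ℂ] A ⊗[ℂ] (A ⊗[ℂ] A) :=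
    { toFun := fun w => (U.one (k, p) ⊗ₜ U.mid p r m) *
        (idComul (H.comul : A →ₗ[ℂ] Multiplier (A ⊗[ℂ] A)) w).left (U.one (l, q) ⊗ₜ U.mid q s n)
      map_add' := fun x y => by rw [map_add, left_add, mul_add]
      map_smul' := fun c x => by rw [map_smul, left_smul, mul_smul_comm, RingHom.id_apply] }
  refine eqOn_tensorSub (f := L) (g := 0) ?_ (H.component_mem U ha p' q)
  intro b hb c hc
  change (U.one (k, p) ⊗ₜ[ℂ] U.mid p r m) *
    ((b * U.one (l, q)) ⊗ₜ[ℂ] (H.comul c).left (U.mid q s n)) = 0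
  rw [U.mul_one _ _ _ hb, Algebra.TensorProduct.tmul_mul_tmul,
    U.one_mul_ne hb fun h' => h (Prod.mk.inj h').2, TensorProduct.zero_tmul]

/-- Cut multiplier coassociativity between `1(k,p) ⊗ 1(p,r) ⊗ 1(r,m)` on the left and `1(l,q) ⊗
1(q,s) ⊗ 1(s,n)` on the right; each iterated extension then leaves one component of one component.
-/
theorem component_coassoc_of_mem (ha : a ∈ 𝒜.comp (k, m) (l, n)) (p q r s : I) :
    TensorProduct.assoc ℂ A A A ((H.component U p q).rTensor A (H.component U r s a)) =
      (H.component U r s).lTensor A (H.component U p q a) := by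
  obtain ⟨F, G, hF, hG, hFG⟩ := H.coassoc a
  -- The triple unit is fixed by `(Δ ⊗ id)(1(l,s) ⊗ 1(s,n))`, which brings it into the reach of the
  -- defining property of `F`.
  have h1 : F.left (U.mid l q s ⊗ₜ U.one (s, n)) =
      (comulId (H.comul : A →ₗ[ℂ] Multiplier (A ⊗[ℂ] A))
        ((H.comul a).left (U.mid l s n))).left (U.mid l q s ⊗ₜ U.one (s, n)) := by
    rw [← (hF _ (mid_mem_tensorI U l s n)).1, left_mul]
    congr 1
    change _ = (H.comul (U.one (l, s))).left (U.mid l q s) ⊗ₜ (U.one (s, n) * U.one (s, n))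
    rw [left_comul_one_mid_self, U.one_mul_one]
  have h2 : G.left (U.one (l, q) ⊗ₜ U.mid q s n) =
      (idComul (H.comul : A →ₗ[ℂ] Multiplier (A ⊗[ℂ] A))
        ((H.comul a).left (U.mid l q n))).left (U.one (l, q) ⊗ₜ U.mid q s n) := by
    rw [← (hG _ (mid_mem_tensorI U l q n)).1, left_mul]
    congr 1
    change _ = (U.one (l, q) * U.one (l, q)) ⊗ₜ (H.comul (U.one (q, n))).left (U.mid q s n)
    rw [left_comul_one_mid_self, U.one_mul_one]
  have h3 : (H.component U p q).rTensor A (H.component U r s a) =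
      (U.mid k p r ⊗ₜ U.one (r, m)) * F.left (U.mid l q s ⊗ₜ U.one (s, n)) := by
    let L : A ⊗[ℂ] A →ₗ[ℂ] (A ⊗[ℂ] A) ⊗[ℂ] A :=
      { toFun := fun w => (U.mid k p r ⊗ₜ U.one (r, m)) *
          (comulId (H.comul : A →ₗ[ℂ] Multiplier (A ⊗[ℂ] A)) w).left (U.mid l q s ⊗ₜ U.one (s, n))
        map_add' := fun x y => by rw [map_add, left_add, mul_add]
        map_smul' := fun c x => by rw [map_smul, left_smul, mul_smul_comm, RingHom.id_apply] }
    rw [h1, H.left_comul_mid_eq_finsum U ha, H.comulId_component U ha]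
    change L _ = L _
    rw [map_finsum L (H.finite_component_left U a s), finsum_eq_single _ r]
    exact fun r' h => H.comulId_component_ne U ha p q s h.symm
  have h4 : (H.component U r s).lTensor A (H.component U p q a) =
      (U.one (k, p) ⊗ₜ U.mid p r m) * G.left (U.one (l, q) ⊗ₜ U.mid q s n) := by
    let L : A ⊗[ℂ] A →ₗ[ℂ] A ⊗[ℂ] (A ⊗[ℂ] A) :=
      { toFun := fun w => (U.one (k, p) ⊗ₜ U.mid p r m) *
          (idComul (H.comul : A →ₗ[ℂ] Multiplier (A ⊗[ℂ] A)) w).left (U.one (l, q) ⊗ₜ U.mid q s n)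
        map_add' := fun x y => by rw [map_add, left_add, mul_add]
        map_smul' := fun c x => by rw [map_smul, left_smul, mul_smul_comm, RingHom.id_apply] }
    rw [h2, H.left_comul_mid_eq_finsum U ha, H.idComul_component U ha]
    change L _ = L _
    rw [map_finsum L (H.finite_component_left U a q), finsum_eq_single _ p]
    exact fun p' h => H.idComul_component_ne U ha q r s h.symm
  rw [h3, h4, assoc_mul, (hFG _).1]
  rfl

/-- The partial bialgebra of the components `Δ_{pq}`. -/
noncomputable def toPartialBialgebra : PartialBialgebra 𝒜 where
  one := U.one
  comul := H.component U
  counit := H.counit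
  one_mem := U.one_mem
  one_mul := U.one_mul
  mul_one := U.mul_one
  comul_mem p q _ _ _ _ _ ha := H.component_mem U ha p q
  coassoc p q r s a := LinearMap.congr_fun (𝒜.linearMap_ext
    (f := (TensorProduct.assoc ℂ A A A).toLinearMap ∘ₗ (H.component U p q).rTensor A ∘ₗ
      H.component U r s) (g := (H.component U r s).lTensor A ∘ₗ H.component U p q)
    fun _ _ _ ha => H.component_coassoc_of_mem U ha p q r s) a
  counit_support k l m n := H.counit_support k l m n
  counit_left _ _ _ _ _ ha := H.counit_left_component U ha
  counit_right _ _ _ _ _ ha := H.counit_right_component U ha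
  comul_one_same k l m := H.component_one_same U k l m
  comul_one_ne k _ _ m h := H.component_one_ne U k m h
  counit_mul _ _ _ _ ha _ hb := H.counit_mul_of_mem_comp ha hb
  counit_one k := H.counit_one U k
  finite_left := H.finite_component_left U
  finite_right := H.finite_component_right U
  comul_mul p q _ _ _ _ ha _ hb := H.component_mul U p q ha hb

theorem corresponds_toPartialBialgebra : Corresponds H (H.toPartialBialgebra U) :=
  ⟨fun r t => U.ofElem_one (r, t), rfl, H.ofElem_component U⟩

theorem IsCompactType.exists_corresponds {H : RegularPartialMultiplierBialgebra 𝒜}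
    (h : H.IsCompactType) : ∃ P, Corresponds H P := by
  obtain ⟨U, -⟩ := 𝒜.exists_units fun x => h x.1 x.2
  exact ⟨_, H.corresponds_toPartialBialgebra U⟩

end RegularPartialMultiplierBialgebra

end PartialQG

/-! ### Invariance of functionals in terms of components. -/

namespace PartialQG

open Multiplier PartialAlgebra

variable {I A : Type*} [NonUnitalRing A] [Module ℂ A] [IsScalarTower ℂ A A] [SMulCommClass ℂ A A]

namespace PartialAlgebra

variable {𝒜 : PartialAlgebra (I × I) A}

/-- The functional is supported on the `A(r r; s s)`. -/
def IsDiagonal (𝒜 : PartialAlgebra (I × I) A) (φ : A →ₗ[ℂ] ℂ) : Prop :=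
  ∀ r s t u, (r ≠ s ∨ t ≠ u) → ∀ a ∈ 𝒜.comp (r, t) (s, u), φ a = 0

theorem IsDiagonal.sliceR_eq_zero {φ : A →ₗ[ℂ] ℂ} (hφ : 𝒜.IsDiagonal φ) {x y x' y' : I × I}
    {z : A ⊗[ℂ] A} (hz : z ∈ tensorSub (𝒜.comp x y) (𝒜.comp x' y')) (h : x'.1 ≠ y'.1) :
    sliceR φ z = 0 :=
  eqOn_tensorSub (f := sliceR φ) (g := 0) (fun a _ b hb => by
    rw [sliceR_tmul, hφ _ _ _ _ (Or.inl h) b hb, zero_smul, LinearMap.zero_apply]) hz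

theorem IsDiagonal.sliceL_eq_zero {φ : A →ₗ[ℂ] ℂ} (hφ : 𝒜.IsDiagonal φ) {x y x' y' : I × I}
    {z : A ⊗[ℂ] A} (hz : z ∈ tensorSub (𝒜.comp x y) (𝒜.comp x' y')) (h : x.2 ≠ y.2) :
    sliceL φ z = 0 :=
  eqOn_tensorSub (f := sliceL φ) (g := 0) (fun a ha b _ => by
    rw [sliceL_tmul, hφ _ _ _ _ (Or.inr h) a ha, zero_smul, LinearMap.zero_apply]) hz

theorem sliceR_mem (φ : A →ₗ[ℂ] ℂ) {x y x' y' : I × I} {z : A ⊗[ℂ] A}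
    (hz : z ∈ tensorSub (𝒜.comp x y) (𝒜.comp x' y')) : sliceR φ z ∈ 𝒜.comp x y := by
  refine (tensorSub_le (W := (𝒜.comp x y).comap (sliceR φ))).2 ?_ hz
  intro a ha b _
  rw [Submodule.mem_comap, sliceR_tmul]
  exact Submodule.smul_mem _ _ ha

theorem sliceL_mem (φ : A →ₗ[ℂ] ℂ) {x y x' y' : I × I} {z : A ⊗[ℂ] A}
    (hz : z ∈ tensorSub (𝒜.comp x y) (𝒜.comp x' y')) : sliceL φ z ∈ 𝒜.comp x' y' := by
  refine (tensorSub_le (W := (𝒜.comp x' y').comap (sliceL φ))).2 ?_ hz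
  intro a _ b hb
  rw [Submodule.mem_comap, sliceL_tmul]
  exact Submodule.smul_mem _ _ hb

theorem finite_map_left_unitUp (φ : A →ₗ[ℂ] ℂ) (a : A) :
    {r | φ ((𝒜.unitUp r).left a) ≠ 0}.Finite :=
  (finite_left_unitUp (𝒜 := 𝒜) a).subset fun r hr h => hr (by rw [h, map_zero])

theorem finite_map_right_unitUp (φ : A →ₗ[ℂ] ℂ) (a : A) :
    {r | φ ((𝒜.unitUp r).right a) ≠ 0}.Finite :=
  (finite_right_unitUp (𝒜 := 𝒜) a).subset fun r hr h => hr (by rw [h, map_zero])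

theorem finite_map_left_unitLo (φ : A →ₗ[ℂ] ℂ) (a : A) :
    {r | φ ((𝒜.unitLo r).left a) ≠ 0}.Finite :=
  (finite_left_unitLo (𝒜 := 𝒜) a).subset fun r hr h => hr (by rw [h, map_zero])

theorem finite_map_right_unitLo (φ : A →ₗ[ℂ] ℂ) (a : A) :
    {r | φ ((𝒜.unitLo r).right a) ≠ 0}.Finite :=
  (finite_right_unitLo (𝒜 := 𝒜) a).subset fun r hr h => hr (by rw [h, map_zero])

theorem left_finsum_unitUp {c : I → ℂ} (hc : {r | c r ≠ 0}.Finite) {x y : I × I} {b : A}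
    (hb : b ∈ 𝒜.comp x y) : (∑ᶠ r, c r • 𝒜.unitUp r).left b = c x.1 • b := by
  classical
  have h1 : (∑ᶠ r, c r • 𝒜.unitUp r).left b = ∑ᶠ r, (c r • 𝒜.unitUp r).left b :=
    map_finsum (leftEval b) (hc.subset fun r hr h => hr (by simp [h]))
  rw [h1, finsum_eq_single _ x.1]
  · rw [left_smul, left_unitUp hb, if_pos rfl]
  · intro r hr
    rw [left_smul, left_unitUp hb, if_neg hr.symm, smul_zero]

theorem right_finsum_unitUp {c : I → ℂ} (hc : {r | c r ≠ 0}.Finite) {x y : I × I} {b : A}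
    (hb : b ∈ 𝒜.comp x y) : (∑ᶠ r, c r • 𝒜.unitUp r).right b = c y.1 • b := by
  classical
  have h1 : (∑ᶠ r, c r • 𝒜.unitUp r).right b = ∑ᶠ r, (c r • 𝒜.unitUp r).right b :=
    map_finsum (rightEval b) (hc.subset fun r hr h => hr (by simp [h]))
  rw [h1, finsum_eq_single _ y.1]
  · rw [right_smul, right_unitUp hb, if_pos rfl]
  · intro r hr
    rw [right_smul, right_unitUp hb, if_neg hr.symm, smul_zero]

theorem left_finsum_unitLo {c : I → ℂ} (hc : {r | c r ≠ 0}.Finite) {x y : I × I} {b : A}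
    (hb : b ∈ 𝒜.comp x y) : (∑ᶠ r, c r • 𝒜.unitLo r).left b = c x.2 • b := by
  classical
  have h1 : (∑ᶠ r, c r • 𝒜.unitLo r).left b = ∑ᶠ r, (c r • 𝒜.unitLo r).left b :=
    map_finsum (leftEval b) (hc.subset fun r hr h => hr (by simp [h]))
  rw [h1, finsum_eq_single _ x.2]
  · rw [left_smul, left_unitLo hb, if_pos rfl]
  · intro r hr
    rw [left_smul, left_unitLo hb, if_neg hr.symm, smul_zero]

theorem right_finsum_unitLo {c : I → ℂ} (hc : {r | c r ≠ 0}.Finite) {x y : I × I} {b : A}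
    (hb : b ∈ 𝒜.comp x y) : (∑ᶠ r, c r • 𝒜.unitLo r).right b = c y.2 • b := by
  classical
  have h1 : (∑ᶠ r, c r • 𝒜.unitLo r).right b = ∑ᶠ r, (c r • 𝒜.unitLo r).right b :=
    map_finsum (rightEval b) (hc.subset fun r hr h => hr (by simp [h]))
  rw [h1, finsum_eq_single _ y.2]
  · rw [right_smul, right_unitLo hb, if_pos rfl]
  · intro r hr
    rw [right_smul, right_unitLo hb, if_neg hr.symm, smul_zero]

end PartialAlgebra

namespace PartialBialgebra

variable {𝒜 : PartialAlgebra (I × I) A} (P : PartialBialgebra 𝒜) {φ : A →ₗ[ℂ] ℂ}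

/-- The second leg of `Δ_pq(a)` has upper indices `p` and `q`; a diagonal functional needs them
equal. -/
theorem sliceR_col (hφ : 𝒜.IsDiagonal φ) (q : I) (a : A) :
    sliceR φ (P.col q a) = sliceR φ (P.comul q q a) := by
  refine LinearMap.congr_fun (𝒜.linearMap_ext (f := sliceR φ ∘ₗ P.col q)
    (g := sliceR φ ∘ₗ P.comul q q) ?_) a
  rintro ⟨k, m⟩ ⟨l, n⟩ a ha
  rw [LinearMap.comp_apply, col, map_lfSum, finsum_eq_single _ q]
  · rfl
  · exact fun p hp => hφ.sliceR_eq_zero (P.comul_mem p q k l m n a ha) hp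

theorem sliceR_row (hφ : 𝒜.IsDiagonal φ) (q : I) (a : A) :
    sliceR φ (P.row q a) = sliceR φ (P.comul q q a) := by
  refine LinearMap.congr_fun (𝒜.linearMap_ext (f := sliceR φ ∘ₗ P.row q)
    (g := sliceR φ ∘ₗ P.comul q q) ?_) a
  rintro ⟨k, m⟩ ⟨l, n⟩ a ha
  rw [LinearMap.comp_apply, row, map_lfSum, finsum_eq_single _ q]
  · rfl
  · exact fun p hp => hφ.sliceR_eq_zero (P.comul_mem q p k l m n a ha) hp.symm

theorem sliceL_col (hφ : 𝒜.IsDiagonal φ) (q : I) (a : A) :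
    sliceL φ (P.col q a) = sliceL φ (P.comul q q a) := by
  refine LinearMap.congr_fun (𝒜.linearMap_ext (f := sliceL φ ∘ₗ P.col q)
    (g := sliceL φ ∘ₗ P.comul q q) ?_) a
  rintro ⟨k, m⟩ ⟨l, n⟩ a ha
  rw [LinearMap.comp_apply, col, map_lfSum, finsum_eq_single _ q]
  · rfl
  · exact fun p hp => hφ.sliceL_eq_zero (P.comul_mem p q k l m n a ha) hp

theorem sliceL_row (hφ : 𝒜.IsDiagonal φ) (q : I) (a : A) :
    sliceL φ (P.row q a) = sliceL φ (P.comul q q a) := by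
  refine LinearMap.congr_fun (𝒜.linearMap_ext (f := sliceL φ ∘ₗ P.row q)
    (g := sliceL φ ∘ₗ P.comul q q) ?_) a
  rintro ⟨k, m⟩ ⟨l, n⟩ a ha
  rw [LinearMap.comp_apply, row, map_lfSum, finsum_eq_single _ q]
  · rfl
  · exact fun p hp => hφ.sliceL_eq_zero (P.comul_mem q p k l m n a ha) hp.symm

/-- Left invariance in terms of the components of the comultiplication. -/
def IsLeftInvariant (φ : A →ₗ[ℂ] ℂ) : Prop := 𝒜.IsDiagonal φ ∧
  ∀ k l m n, ∀ a ∈ 𝒜.comp (k, m) (l, n), ∀ p, sliceR φ (P.comul p p a) = φ a • P.one (k, p)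

/-- Right invariance in terms of the components of the comultiplication. -/
def IsRightInvariant (φ : A →ₗ[ℂ] ℂ) : Prop := 𝒜.IsDiagonal φ ∧
  ∀ k l m n, ∀ a ∈ 𝒜.comp (k, m) (l, n), ∀ p, sliceL φ (P.comul p p a) = φ a • P.one (p, m)

theorem isInvariantIntegral_iff : P.IsInvariantIntegral φ ↔
    P.IsLeftInvariant φ ∧ P.IsRightInvariant φ ∧ ∀ k, φ (P.one (k, k)) = 1 := by
  constructor
  · rintro ⟨h1, h2, h3, h4⟩
    exact ⟨⟨fun r s t u => h1 r s t u, h3⟩, ⟨fun r s t u => h1 r s t u, h4⟩, h2⟩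
  · rintro ⟨⟨h1, h3⟩, ⟨-, h4⟩, h2⟩
    exact ⟨fun r s t u => h1 r s t u, h2, h3, h4⟩

variable {P}

-- The coefficient `c r` stands for either `φ(1^r a)` or `φ(a 1^r)`; both satisfy `hc'` because `φ`
-- is diagonal, so one argument covers both formulas.
open Classical in
theorem IsLeftInvariant.isSliceR {φ : A →ₗ[ℂ] ℂ} (hφ : P.IsLeftInvariant φ) {c : I → A →ₗ[ℂ] ℂ}
    (hc : ∀ a, {r | c r a ≠ 0}.Finite)
    (hc' : ∀ k l m n, ∀ a ∈ 𝒜.comp (k, m) (l, n), ∀ r, c r a = if k = r then φ a else 0) (a : A) :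
    IsSliceR φ (P.delta a) (∑ᶠ r, c r a • 𝒜.unitUp r) := by
  rw [isSliceR_delta_iff]
  intro x y b hb
  rw [P.sliceR_col hφ.1, P.sliceR_row hφ.1, left_finsum_unitUp (hc a) hb,
    right_finsum_unitUp (hc a) hb]
  refine 𝒜.induction_on (P := fun a => sliceR φ (P.comul x.2 x.2 a) * b = c x.1 a • b ∧
    b * sliceR φ (P.comul y.2 y.2 a) = c y.1 a • b) a ?_ (by simp) ?_
  · rintro ⟨k, m⟩ ⟨l, n⟩ a ha
    rw [hφ.2 _ _ _ _ a ha, hφ.2 _ _ _ _ a ha, hc' _ _ _ _ a ha, hc' _ _ _ _ a ha,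
      smul_mul_assoc, mul_smul_comm]
    constructor
    · split_ifs with h
      · subst h
        rw [P.one_mul _ _ _ hb]
      · rw [P.one_mul_ne hb fun h' => h (Prod.mk.inj h').1, smul_zero, zero_smul]
    · split_ifs with h
      · subst h
        rw [P.mul_one _ _ _ hb]
      · rw [P.mul_one_ne hb fun h' => h (Prod.mk.inj h').1.symm, smul_zero, zero_smul]
  · rintro a a' ⟨h1, h2⟩ ⟨h3, h4⟩
    simp only [map_add, add_mul, mul_add, h1, h2, h3, h4, add_smul, and_self]

open Classical in
theorem IsRightInvariant.isSliceL {φ : A →ₗ[ℂ] ℂ} (hφ : P.IsRightInvariant φ)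
    {c : I → A →ₗ[ℂ] ℂ} (hc : ∀ a, {r | c r a ≠ 0}.Finite)
    (hc' : ∀ k l m n, ∀ a ∈ 𝒜.comp (k, m) (l, n), ∀ r, c r a = if m = r then φ a else 0) (a : A) :
    IsSliceL φ (P.delta a) (∑ᶠ r, c r a • 𝒜.unitLo r) := by
  rw [isSliceL_delta_iff]
  intro x y b hb
  rw [P.sliceL_col hφ.1, P.sliceL_row hφ.1, left_finsum_unitLo (hc a) hb,
    right_finsum_unitLo (hc a) hb]
  refine 𝒜.induction_on (P := fun a => sliceL φ (P.comul x.1 x.1 a) * b = c x.2 a • b ∧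
    b * sliceL φ (P.comul y.1 y.1 a) = c y.2 a • b) a ?_ (by simp) ?_
  · rintro ⟨k, m⟩ ⟨l, n⟩ a ha
    rw [hφ.2 _ _ _ _ a ha, hφ.2 _ _ _ _ a ha, hc' _ _ _ _ a ha, hc' _ _ _ _ a ha,
      smul_mul_assoc, mul_smul_comm]
    constructor
    · split_ifs with h
      · subst h
        rw [P.one_mul _ _ _ hb]
      · rw [P.one_mul_ne hb fun h' => h (Prod.mk.inj h').2, smul_zero, zero_smul]
    · split_ifs with h
      · subst h
        rw [P.mul_one _ _ _ hb]
      · rw [P.mul_one_ne hb fun h' => h (Prod.mk.inj h').2.symm, smul_zero, zero_smul]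
  · rintro a a' ⟨h1, h2⟩ ⟨h3, h4⟩
    simp only [map_add, add_mul, mul_add, h1, h2, h3, h4, add_smul, and_self]

end PartialBialgebra

namespace Corresponds

variable {𝒜 : PartialAlgebra (I × I) A} {H : RegularPartialMultiplierBialgebra 𝒜}
  {P : PartialBialgebra 𝒜} {φ : A →ₗ[ℂ] ℂ}

theorem isLeftInvariant_iff (h : Corresponds H P) : H.IsLeftInvariant φ ↔ P.IsLeftInvariant φ := by
  classical
  constructor
  · rintro ⟨h1, h2, -⟩
    have hd : 𝒜.IsDiagonal φ := fun r s t u => h1 r s t u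
    refine ⟨hd, fun k l m n a ha p => ?_⟩
    have h3 := h2 a
    rw [h.comul_eq, P.isSliceR_delta_iff] at h3
    -- Testing against `1(l,p)` selects the column `p` and recovers the slice of `Δ_pp(a)` itself.
    have h4 := (h3 _ _ _ (P.one_mem (l, p))).1
    rw [left_finsum_unitUp (finite_map_left_unitUp φ a) (P.one_mem (l, p)), P.sliceR_col hd,
      P.mul_one _ _ _ (sliceR_mem φ (P.comul_mem p p k l m n a ha)), left_unitUp ha] at h4
    rw [h4]
    by_cases hk : k = l
    · subst hk
      rw [if_pos rfl]
    · rw [if_neg hk, map_zero, zero_smul, hd _ _ _ _ (Or.inl hk) a ha, zero_smul]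
  · intro hφ
    refine ⟨fun r s t u => hφ.1 r s t u, fun a => ?_, fun a => ?_⟩
    · rw [h.comul_eq]
      refine hφ.isSliceR (c := fun r => φ ∘ₗ (𝒜.unitUp r).left) (finite_map_left_unitUp φ) ?_ a
      intro k l m n a ha r
      rw [LinearMap.comp_apply, left_unitUp ha, apply_ite φ, map_zero]
    · rw [h.comul_eq]
      refine hφ.isSliceR (c := fun r => φ ∘ₗ (𝒜.unitUp r).right) (finite_map_right_unitUp φ) ?_ a
      intro k l m n a ha r
      rw [LinearMap.comp_apply, right_unitUp ha, apply_ite φ, map_zero]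
      by_cases hk : k = l
      · rw [hk]
      · rw [hφ.1 _ _ _ _ (Or.inl hk) a ha, ite_self, ite_self]

theorem isRightInvariant (h : Corresponds H P) (hφ : P.IsRightInvariant φ) :
    H.IsRightInvariant φ := by
  classical
  refine ⟨fun r s t u => hφ.1 r s t u, fun a => ?_, fun a => ?_⟩
  · rw [h.comul_eq]
    refine hφ.isSliceL (c := fun r => φ ∘ₗ (𝒜.unitLo r).left) (finite_map_left_unitLo φ) ?_ a
    intro k l m n a ha r
    rw [LinearMap.comp_apply, left_unitLo ha, apply_ite φ, map_zero]
  · rw [h.comul_eq]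
    refine hφ.isSliceL (c := fun r => φ ∘ₗ (𝒜.unitLo r).right) (finite_map_right_unitLo φ) ?_ a
    intro k l m n a ha r
    rw [LinearMap.comp_apply, right_unitLo ha, apply_ite φ, map_zero]
    by_cases hk : m = n
    · rw [hk]
    · rw [hφ.1 _ _ _ _ (Or.inr hk) a ha, ite_self, ite_self]

end Corresponds

end PartialQG

/-! ### Positive functionals and the form `φ ⊗ φ`. -/

namespace PartialQG

open Multiplier PartialAlgebra

variable {A : Type*} [NonUnitalRing A] [Module ℂ A] [IsScalarTower ℂ A A] [SMulCommClass ℂ A A]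

/-- A tensor annihilated by all slices `id ⊗ ω` with `ω ∈ S` is annihilated by every map that
annihilates `A ⊗ ⋂_{ω ∈ S} ker ω`. -/
theorem map_eq_zero_of_slices {K : Type*} [AddCommGroup K] [Module ℂ K] (S : Set (A →ₗ[ℂ] ℂ))
    {w : A ⊗[ℂ] A} (hw : ∀ ω ∈ S, sliceR ω w = 0) (L : A ⊗[ℂ] A →ₗ[ℂ] K)
    (hL : ∀ e c, (∀ ω ∈ S, ω c = 0) → L (e ⊗ₜ c) = 0) : L w = 0 := by
  classical
  let b := Module.Basis.ofVectorSpace ℂ A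
  let f := TensorProduct.equivFinsuppOfBasisLeft (N := A) b
  -- Expanding `w` along a basis of the first leg, the vanishing of its slices says that all
  -- coefficients lie in the common kernel.
  have h1 : ∀ (ω : A →ₗ[ℂ] ℂ) z i, b.repr (sliceR ω z) i = ω (f z i) := by
    intro ω z i
    induction z using TensorProduct.induction_on with
    | zero => simp
    | add x y hx hy => simp only [map_add, Finsupp.add_apply, hx, hy]
    | tmul x y =>
      rw [sliceR_tmul, TensorProduct.equivFinsuppOfBasisLeft_apply_tmul_apply]
      simp [mul_comm]
  have h2 : w = f.symm (f w) := (f.symm_apply_apply w).symm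
  rw [h2, TensorProduct.equivFinsuppOfBasisLeft_symm_apply, Finsupp.sum, map_sum]
  refine Finset.sum_eq_zero fun i _ => hL _ _ fun ω hω => ?_
  rw [← h1, hw ω hω, map_zero, Finsupp.zero_apply]

/-- The functional `φ ⊗ φ`. -/
noncomputable def tensorFunctional (φ : A →ₗ[ℂ] ℂ) : A ⊗[ℂ] A →ₗ[ℂ] ℂ := φ ∘ₗ sliceR φ

theorem tensorFunctional_tmul (φ : A →ₗ[ℂ] ℂ) (a b : A) :
    tensorFunctional φ (a ⊗ₜ b) = φ a * φ b := by
  rw [tensorFunctional, LinearMap.comp_apply, sliceR_tmul, map_smul, smul_eq_mul, mul_comm]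

variable [StarRing A] [StarModule ℂ A]

namespace IsPositive

variable {φ : A →ₗ[ℂ] ℂ}

/-- Polarization: the values on `x + y` and on `x + iy` are real, which fixes the imaginary and real
parts of `φ(y^*x)` against those of `φ(x^*y)`. No unit of `A` is needed. -/
theorem conj_apply (hφ : IsPositive φ) (x y : A) :
    star (φ (star y * x)) = φ (star x * y) := by
  have him : ∀ z, (φ (star z * z)).im = 0 := fun z => ((Complex.le_def.1 (hφ z)).2).symm
  have h1 := him (x + y)
  have h2 := him (x + Complex.I • y)
  have hx := him x
  have hy := him y
  simp only [star_add, add_mul, mul_add, map_add, star_smul, smul_mul_assoc, mul_smul_comm,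
    map_smul, smul_eq_mul, Complex.add_im, hx, hy] at h1 h2
  simp at h2
  refine Complex.ext ?_ ?_
  · simp
    linarith
  · simp
    linarith

/-- The positive semidefinite inner product of a positive functional. -/
@[reducible]
noncomputable def preCore (hφ : IsPositive φ) : PreInnerProductSpace.Core ℂ A where
  inner x y := φ (star x * y)
  conj_inner_symm x y := hφ.conj_apply x y
  re_inner_nonneg x := (Complex.le_def.1 (hφ x)).1
  add_left x y z := by rw [star_add, add_mul, map_add]
  smul_left x y r := by simp [smul_mul_assoc]

theorem apply_star_mul_eq_zero (hφ : IsPositive φ) {x : A} (hx : φ (star x * x) = 0) (y : A) :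
    φ (star x * y) = 0 := by
  let _ := hφ.preCore
  have h : ‖φ (star x * y)‖ * ‖φ (star y * x)‖ ≤
      RCLike.re (φ (star x * x)) * RCLike.re (φ (star y * y)) :=
    InnerProductSpace.Core.inner_mul_inner_self_le x y
  rw [hx, ← hφ.conj_apply x y, norm_star, map_zero, zero_mul] at h
  have h3 : ‖φ (star y * x)‖ = 0 := by nlinarith [norm_nonneg (φ (star y * x))]
  rw [← hφ.conj_apply x y, norm_eq_zero.1 h3, star_zero]

theorem eq_zero_of_faithful (hφ : IsPositive φ) (hf : IsFaithful φ) {x : A}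
    (hx : φ (star x * x) = 0) : x = 0 :=
  star_eq_zero.1 (hf.1 _ fun y => hφ.apply_star_mul_eq_zero hx y)

/-- The inner product of a faithful positive functional. -/
@[reducible]
noncomputable def core (hφ : IsPositive φ) (hf : IsFaithful φ) : InnerProductSpace.Core ℂ A where
  toCore := hφ.preCore
  definite _ hx := hφ.eq_zero_of_faithful hf hx

end IsPositive

theorem IsPositive.tensorFunctional_conj {φ : A →ₗ[ℂ] ℂ} (hφ : IsPositive φ) (z w : A ⊗[ℂ] A) :
    star (tensorFunctional φ (star w * z)) = tensorFunctional φ (star z * w) := by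
  induction z using TensorProduct.induction_on with
  | zero => simp
  | add x y hx hy => simp only [mul_add, star_add, add_mul, map_add, hx, hy]
  | tmul a b =>
    induction w using TensorProduct.induction_on with
    | zero => simp
    | add x y hx hy => simp only [mul_add, star_add, add_mul, map_add, hx, hy]
    | tmul c d =>
      simp only [TensorProduct.star_tmul, Algebra.TensorProduct.tmul_mul_tmul,
        tensorFunctional_tmul]
      rw [← hφ.conj_apply a c, ← hφ.conj_apply b d, star_mul']

theorem tensor_pos {E : Type*} [NormedAddCommGroup E] [InnerProductSpace ℂ E]
    (z : E ⊗[ℂ] E) : 0 ≤ (inner ℂ z z : ℂ) ∧ ((inner ℂ z z : ℂ) = 0 → z = 0) :=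
  ⟨Complex.le_def.2 ⟨inner_self_nonneg (𝕜 := ℂ) (x := z),
    (inner_self_im (𝕜 := ℂ) z).symm⟩,
    (inner_self_eq_zero (𝕜 := ℂ) (E := E ⊗[ℂ] E)).1⟩

/-- A faithful positive `φ` makes `A` an inner product space, and `φ ⊗ φ` induces its tensor product
inner product, which is again positive definite. -/
theorem IsPositive.tensorFunctional_pos {φ : A →ₗ[ℂ] ℂ} (hφ : IsPositive φ) (hf : IsFaithful φ)
    (z : A ⊗[ℂ] A) : 0 ≤ tensorFunctional φ (star z * z) ∧
      (tensorFunctional φ (star z * z) = 0 → z = 0) := by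
  let _ := hφ.core hf
  let _ := InnerProductSpace.Core.toNormedAddCommGroup (𝕜 := ℂ) (F := A)
  let _ := InnerProductSpace.ofCore (hφ.core hf).toCore
  have h : ∀ z w : A ⊗[ℂ] A, tensorFunctional φ (star z * w) = inner ℂ z w := by
    intro z w
    induction z using TensorProduct.induction_on with
    | zero => simp
    | add x y hx hy => rw [star_add, add_mul, map_add, hx, hy, inner_add_left]
    | tmul a b =>
      induction w using TensorProduct.induction_on with
      | zero => simp
      | add x y hx hy => rw [mul_add, map_add, hx, hy, inner_add_right]
      | tmul c d =>
        rw [TensorProduct.star_tmul, Algebra.TensorProduct.tmul_mul_tmul, tensorFunctional_tmul]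
        rfl
  rw [h]
  exact tensor_pos z

end PartialQG

/-! ### Faithfulness of a normalized positive left invariant functional. -/

namespace PartialQG

open Multiplier PartialAlgebra

variable {I A : Type*} [NonUnitalRing A] [Module ℂ A] [IsScalarTower ℂ A A] [SMulCommClass ℂ A A]

namespace PartialAlgebra

variable {𝒜 : PartialAlgebra (I × I) A}

theorem IsDiagonal.apply_eq_zero {φ : A →ₗ[ℂ] ℂ} (hφ : 𝒜.IsDiagonal φ) {x y : I × I} (h : x ≠ y)
    {a : A} (ha : a ∈ 𝒜.comp x y) : φ a = 0 := by
  refine hφ x.1 y.1 x.2 y.2 ?_ a ha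
  by_contra h'
  rw [not_or, not_not, not_not] at h'
  exact h (Prod.ext h'.1 h'.2)

theorem IsDiagonal.apply_mul_one {φ : A →ₗ[ℂ] ℂ} (hφ : 𝒜.IsDiagonal φ) (U : 𝒜.Units) (x : I × I)
    (a : A) : φ (a * U.one x) = φ (U.one x * a) := by
  refine 𝒜.induction_on (P := fun a => φ (a * U.one x) = φ (U.one x * a)) a ?_ (by simp)
    fun a b ha hb => by rw [add_mul, mul_add, map_add, map_add, ha, hb]
  intro y z a ha
  by_cases h : y = z
  · subst h
    by_cases h' : y = x
    · subst h'
      rw [U.one_mul _ _ _ ha, U.mul_one _ _ _ ha]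
    · rw [U.one_mul_ne ha (Ne.symm h'), U.mul_one_ne ha h']
  · by_cases h' : z = x
    · subst h'
      rw [U.mul_one _ _ _ ha, U.one_mul_ne ha (Ne.symm h), hφ.apply_eq_zero h ha, map_zero]
    · rw [U.mul_one_ne ha h']
      by_cases h'' : y = x
      · subst h''
        rw [U.one_mul _ _ _ ha, hφ.apply_eq_zero h ha, map_zero]
      · rw [U.one_mul_ne ha (Ne.symm h'')]

theorem Units.finite_one_mul_mul_one (U : 𝒜.Units) (a : A) :
    {p : (I × I) × I × I | U.one p.1 * a * U.one p.2 ≠ 0}.Finite := by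
  refine 𝒜.induction_on (P := fun a => {p : (I × I) × I × I |
    U.one p.1 * a * U.one p.2 ≠ 0}.Finite) a ?_ (by simp) ?_
  · intro x y a ha
    refine (Set.finite_singleton (x, y)).subset fun p hp => ?_
    by_contra h
    refine hp ?_
    by_cases h1 : p.1 = x
    · have h2 : p.2 ≠ y := fun h2 => h (Prod.ext h1 h2)
      rw [h1, U.one_mul _ _ _ ha, U.mul_one_ne ha h2.symm]
    · rw [U.one_mul_ne ha h1, zero_mul]
  · intro a b ha hb
    refine (ha.union hb).subset fun p hp => ?_
    by_contra h
    simp only [Set.mem_union, Set.mem_ofPred_eq, not_or, not_not] at h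
    exact hp (by rw [mul_add, add_mul, h.1, h.2, add_zero])

theorem Units.finsum_one_mul_mul_one (U : 𝒜.Units) (a : A) :
    ∑ᶠ p : (I × I) × I × I, U.one p.1 * a * U.one p.2 = a := by
  refine 𝒜.induction_on (P := fun a => ∑ᶠ p : (I × I) × I × I, U.one p.1 * a * U.one p.2 = a)
    a ?_ (by simp) ?_
  · intro x y a ha
    rw [finsum_eq_single _ (x, y)]
    · rw [U.one_mul _ _ _ ha, U.mul_one _ _ _ ha]
    · intro p h
      by_cases h1 : p.1 = x
      · have h2 : p.2 ≠ y := fun h2 => h (Prod.ext h1 h2)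
        rw [h1, U.one_mul _ _ _ ha, U.mul_one_ne ha h2.symm]
      · rw [U.one_mul_ne ha h1, zero_mul]
  · intro a b ha hb
    simp only [mul_add, add_mul]
    rw [finsum_add_distrib (U.finite_one_mul_mul_one a) (U.finite_one_mul_mul_one b), ha, hb]

theorem Units.map_eq_zero (U : 𝒜.Units) {K : Type*} [AddCommGroup K] [Module ℂ K] (f : A →ₗ[ℂ] K)
    {a : A} (h : ∀ x y, f (U.one x * a * U.one y) = 0) : f a = 0 := by
  rw [← U.finsum_one_mul_mul_one a, map_finsum f (U.finite_one_mul_mul_one a)]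
  exact finsum_eq_zero_of_forall_eq_zero fun p => h _ _

end PartialAlgebra

/-- The map `c ⊗ (x ⊗ y) ↦ S(c)x ⊗ y`. -/
noncomputable def mulLeftOn (S : A →ₗ[ℂ] A) : A ⊗[ℂ] (A ⊗[ℂ] A) →ₗ[ℂ] A ⊗[ℂ] A :=
  (LinearMap.mul' ℂ A).rTensor A ∘ₗ (TensorProduct.assoc ℂ A A A).symm.toLinearMap ∘ₗ
    S.rTensor (A ⊗[ℂ] A)

theorem mulLeftOn_mul (S : A →ₗ[ℂ] A) (c : A) (z w : A ⊗[ℂ] A) :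
    mulLeftOn S (c ⊗ₜ (z * w)) = mulLeftOn S (c ⊗ₜ z) * w := by
  induction z using TensorProduct.induction_on with
  | zero => simp
  | add x y hx hy => simp only [add_mul, TensorProduct.tmul_add, map_add, hx, hy]
  | tmul a b =>
    induction w using TensorProduct.induction_on with
    | zero => simp
    | add x y hx hy => simp only [mul_add, TensorProduct.tmul_add, map_add, hx, hy]
    | tmul a' b' => simp [mulLeftOn, Algebra.TensorProduct.tmul_mul_tmul, mul_assoc]

theorem mulLeftOn_assoc (S : A →ₗ[ℂ] A) (v : A ⊗[ℂ] A) (b : A) :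
    mulLeftOn S (TensorProduct.assoc ℂ A A A (v ⊗ₜ b)) =
      LinearMap.mul' ℂ A (S.rTensor A v) ⊗ₜ b := by
  induction v using TensorProduct.induction_on with
  | zero => simp
  | add x y hx hy => simp only [TensorProduct.add_tmul, map_add, hx, hy]
  | tmul c d => simp [mulLeftOn]

theorem sliceR_mulLeftOn (S : A →ₗ[ℂ] A) (φ : A →ₗ[ℂ] ℂ) (c : A) (z : A ⊗[ℂ] A) :
    sliceR φ (mulLeftOn S (c ⊗ₜ z)) = S c * sliceR φ z := by
  induction z using TensorProduct.induction_on with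
  | zero => simp
  | add x y hx hy => simp only [TensorProduct.tmul_add, map_add, mul_add, hx, hy]
  | tmul a b => simp [mulLeftOn, sliceR_tmul, mul_smul_comm]

theorem sliceR_comp_mulLeft (φ : A →ₗ[ℂ] ℂ) (b : A) (z : A ⊗[ℂ] A) :
    sliceR (φ ∘ₗ LinearMap.mulLeft ℂ b) z = sliceR φ ((inr b).left z) := by
  induction z using TensorProduct.induction_on with
  | zero => simp
  | add x y hx hy => simp only [map_add, hx, hy]
  | tmul c d => simp [left_inr, sliceR_tmul]

namespace PartialBialgebra

variable {𝒜 : PartialAlgebra (I × I) A} {P : PartialBialgebra 𝒜} {S : A →ₗ[ℂ] A}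

/-- The identity `(1 ⊗ b)Δ(a) = (S(b₁) ⊗ 1)Δ(b₂a)`. -/
theorem IsAntipode.one_tmul_mul_col (hS : P.IsAntipode S) {g h p m : I} {b : A}
    (hb : b ∈ 𝒜.comp (g, h) (p, m)) (k u : I) (a : A) : (P.one (k, p) ⊗ₜ b) * P.col u a =
      mulLeftOn S ((P.comul g u ∘ₗ LinearMap.mulRight ℂ a).lTensor A (P.col k b)) := by
  classical
  have h1 : ∀ w : A ⊗[ℂ] A,
      mulLeftOn S ((P.comul g u ∘ₗ LinearMap.mulRight ℂ a).lTensor A w) =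
        mulLeftOn S ((P.row g).lTensor A w) * P.col u a := by
    intro w
    induction w using TensorProduct.induction_on with
    | zero => simp
    | add x y hx hy => simp only [map_add, add_mul, hx, hy]
    | tmul c d =>
      rw [LinearMap.lTensor_tmul, LinearMap.lTensor_tmul, LinearMap.comp_apply,
        LinearMap.mulRight_apply, comul_mul_eq, mulLeftOn_mul]
  rw [h1, ← P.col_row_coassoc]
  congr 1
  have h2 : sliceL P.counit (P.row g b) = b := by
    rw [P.sliceL_counit_row, left_unitUp hb, if_pos rfl]
  nth_rewrite 1 [← h2]
  refine eqOn_pairSpan (f := TensorProduct.mk ℂ A A (P.one (k, p)) ∘ₗ sliceL P.counit)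
    (g := mulLeftOn S ∘ₗ (TensorProduct.assoc ℂ A A A).toLinearMap ∘ₗ (P.col k).rTensor A) ?_
    (P.row_mem hb g)
  rintro _ ⟨p', t⟩ x' y' ⟨rfl, rfl, -, -, -⟩ c hc d hd
  simp only [LinearMap.comp_apply, LinearMap.rTensor_tmul, LinearEquiv.coe_coe,
    TensorProduct.mk_apply]
  rw [mulLeftOn_assoc, hS.mul_rTensor_col hc, sliceL_tmul, TensorProduct.tmul_smul,
    TensorProduct.smul_tmul']
  by_cases ht : p' = t
  · rw [ht]
  · rw [P.counit_support _ _ _ _ (Or.inr ht) c hc, zero_smul, zero_smul, TensorProduct.zero_tmul]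

/-- By `one_tmul_mul_col`, the slice is a sum of terms `S(b₁)(id ⊗ φ)Δ(b₂a)`; left invariance makes
each a multiple of `φ(b₂a) = 0`. -/
theorem IsAntipode.slice_col_eq_zero (hS : P.IsAntipode S) {φ : A →ₗ[ℂ] ℂ}
    (hφ : P.IsLeftInvariant φ) {k l m n : I} {a : A} (ha : a ∈ 𝒜.comp (k, m) (l, n))
    (h : ∀ b, φ (b * a) = 0) (u : I) (b : A) :
    sliceR (φ ∘ₗ LinearMap.mulLeft ℂ b) (P.col u a) = 0 := by
  rw [sliceR_comp_mulLeft]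
  refine 𝒜.induction_on (P := fun b => sliceR φ ((inr b).left (P.col u a)) = 0) b ?_
    (by rw [inr_zero, left_zero, map_zero])
    fun b c hb hc => by rw [inr_add, left_add, map_add, hb, hc, add_zero]
  rintro ⟨g, h'⟩ ⟨p, m'⟩ b hb
  have h1 : (inr b).left (P.col u a) = (P.one (k, p) ⊗ₜ b) * P.col u a := by
    refine eqOn_pairSpan (f := (inr b).left) (g := LinearMap.mulLeft ℂ (P.one (k, p) ⊗ₜ b)) ?_
      (P.col_mem ha u)
    rintro ⟨k', t⟩ y ⟨t', m''⟩ y' ⟨h2, -, -, -, h3⟩ c hc d hd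
    dsimp only at h2 h3
    subst h2 h3
    rw [left_inr, LinearMap.lTensor_tmul, LinearMap.mulLeft_apply, LinearMap.mulLeft_apply,
      Algebra.TensorProduct.tmul_mul_tmul]
    by_cases h4 : (p, m') = (t, m'')
    · obtain ⟨rfl, -⟩ := Prod.mk.inj h4
      rw [P.one_mul _ _ _ hc]
    · rw [𝒜.mul_eq_zero hb hd h4, TensorProduct.tmul_zero, TensorProduct.tmul_zero]
  rw [h1, hS.one_tmul_mul_col hb]
  generalize P.col k b = w
  refine LinearMap.congr_fun (f := sliceR φ ∘ₗ mulLeftOn S ∘ₗ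
    (P.comul g u ∘ₗ LinearMap.mulRight ℂ a).lTensor A) (g := 0) (𝒜.tensor_ext ?_) w
  rintro x y ⟨k', m''⟩ y' c hc d hd
  simp only [LinearMap.comp_apply, LinearMap.lTensor_tmul, LinearMap.mulRight_apply,
    LinearMap.zero_apply]
  rw [sliceR_mulLeftOn]
  by_cases h2 : y' = (k, m)
  · subst h2
    have h3 := 𝒜.mul_mem hd ha
    by_cases h4 : g = u
    · subst h4
      rw [hφ.2 _ _ _ _ _ h3, h, zero_smul, mul_zero]
    · rw [hφ.1.sliceR_eq_zero (P.comul_mem g u _ _ _ _ _ h3) h4, mul_zero]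
  · rw [𝒜.mul_eq_zero hd ha h2, map_zero, map_zero, mul_zero]

/-- Let `N` be the set of such `a`. By `slice_col_eq_zero`, columns of homogeneous elements of `N`
lie in `A ⊗ N`. Hence `φ(S(a₁)a₂) = 0`, which says that the counit vanishes on `N`; applying `id ⊗
ε` to a column then gives `a = 0`. -/
theorem IsAntipode.eq_zero_of_forall_mul (hS : P.IsAntipode S) {φ : A →ₗ[ℂ] ℂ}
    (hφ : P.IsLeftInvariant φ) (h1 : ∀ k, φ (P.one (k, k)) = 1) {a : A}
    (h : ∀ b, φ (b * a) = 0) : a = 0 := by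
  classical
  have hN : ∀ {a : A}, (∀ b, φ (b * a) = 0) → ∀ x y b,
      φ (b * (P.units.one x * a * P.units.one y)) = 0 := by
    intro a h x y b
    -- A diagonal functional lets the right unit move to the far left, so `N` is stable under
    -- cutting by units.
    rw [← mul_assoc, hφ.1.apply_mul_one, ← mul_assoc, ← mul_assoc, h]
  have hε : ∀ {a : A}, (∀ b, φ (b * a) = 0) → P.counit a = 0 := by
    intro a h
    refine P.units.map_eq_zero P.counit fun x y => ?_
    have h2 := hN h x y
    have h3 := P.units.one_mul_mul_one_mem x y a
    generalize P.units.one x * a * P.units.one y = c at h2 h3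
    obtain ⟨k, m⟩ := x
    obtain ⟨l, n⟩ := y
    -- The column `n` is chosen because the antipode axiom then produces `1(n,n)`, on which `φ` is
    -- normalized.
    have h4 := map_eq_zero_of_slices {ω | ∃ b, ω = φ ∘ₗ LinearMap.mulLeft ℂ b} (w := P.col n c)
      (by rintro _ ⟨b, rfl⟩; exact hS.slice_col_eq_zero hφ h3 h2 n b)
      (φ ∘ₗ LinearMap.mul' ℂ A ∘ₗ S.rTensor A) fun e d hd => hd _ ⟨S e, rfl⟩
    rw [LinearMap.comp_apply, LinearMap.comp_apply, hS.mul_rTensor_col h3, map_smul, h1,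
      smul_eq_mul, _root_.mul_one] at h4
    exact h4
  refine P.units.map_eq_zero LinearMap.id fun x y => ?_
  have h2 := hN h x y
  have h3 := P.units.one_mul_mul_one_mem x y a
  rw [LinearMap.id_apply]
  generalize P.units.one x * a * P.units.one y = c at h2 h3
  obtain ⟨k, m⟩ := x
  obtain ⟨l, n⟩ := y
  have h4 := map_eq_zero_of_slices {ω | ∃ b, ω = φ ∘ₗ LinearMap.mulLeft ℂ b} (w := P.col n c)
    (by rintro _ ⟨b, rfl⟩; exact hS.slice_col_eq_zero hφ h3 h2 n b) (sliceR P.counit)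
    fun e d hd => by rw [sliceR_tmul, hε fun b => hd _ ⟨b, rfl⟩, zero_smul]
  rwa [P.sliceR_counit_col, right_unitLo h3, if_pos rfl] at h4

theorem IsAntipode.isFaithful [StarRing A] [StarModule ℂ A] (hS : P.IsAntipode S)
    {φ : A →ₗ[ℂ] ℂ} (hφ : P.IsLeftInvariant φ) (h1 : ∀ k, φ (P.one (k, k)) = 1)
    (hpos : IsPositive φ) : IsFaithful φ := by
  refine ⟨fun a h => ?_, fun a h => hS.eq_zero_of_forall_mul hφ h1 h⟩
  rw [← star_eq_zero]
  refine hS.eq_zero_of_forall_mul hφ h1 fun b => ?_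
  have h2 := hpos.conj_apply (star b) (star a)
  rw [star_star, star_star, h, star_zero] at h2
  exact h2.symm

end PartialBialgebra

end PartialQG

/-! ### Rescaling, right invariance and normalization. -/

namespace PartialQG

open Multiplier PartialAlgebra

variable {I A : Type*} [NonUnitalRing A] [Module ℂ A] [IsScalarTower ℂ A A] [SMulCommClass ℂ A A]

namespace PartialAlgebra

variable {𝒜 : PartialAlgebra (I × I) A} {φ : A →ₗ[ℂ] ℂ}

theorem IsDiagonal.sliceL_eq_zero_of_ne (hφ : 𝒜.IsDiagonal φ) {x y x' y' : I × I}
    {z : A ⊗[ℂ] A} (hz : z ∈ tensorSub (𝒜.comp x y) (𝒜.comp x' y')) (h : x ≠ y) :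
    sliceL φ z = 0 :=
  eqOn_tensorSub (f := sliceL φ) (g := 0) (fun a ha b _ => by
    rw [sliceL_tmul, hφ.apply_eq_zero h ha, zero_smul, LinearMap.zero_apply]) hz

theorem Units.star_one [StarRing A] (hA : 𝒜.IsStar) (U : 𝒜.Units) (x : I × I) :
    star (U.one x) = U.one x := by
  have h1 : U.one x * star (U.one x) = star (U.one x) := U.one_mul _ _ _ (hA _ _ _ (U.one_mem x))
  have h2 := congrArg star h1
  rw [star_mul, star_star] at h2
  exact h1.symm.trans h2

/-- Rescaling of a functional by a function of the lower right index. -/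
noncomputable def rescale (𝒜 : PartialAlgebra (I × I) A) (γ : I → ℝ) (φ : A →ₗ[ℂ] ℂ) : A →ₗ[ℂ] ℂ :=
  (𝒜.exists_linearMap fun _ y => (γ y.2 : ℂ) • φ).choose

theorem rescale_apply (γ : I → ℝ) (φ : A →ₗ[ℂ] ℂ) {x y : I × I} {a : A} (ha : a ∈ 𝒜.comp x y) :
    𝒜.rescale γ φ a = γ y.2 * φ a :=
  (𝒜.exists_linearMap fun _ y => (γ y.2 : ℂ) • φ).choose_spec x y a ha

theorem rescale_apply_of_mem (γ : I → ℝ) (φ : A →ₗ[ℂ] ℂ) {s : I} {a : A} (ha : a ∈ 𝒜.loR s) :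
    𝒜.rescale γ φ a = γ s * φ a := by
  rw [loR_eq] at ha
  refine part_le (W := LinearMap.eqLocus (𝒜.rescale γ φ) ((γ s : ℂ) • φ)) |>.2 ?_ ha
  rintro x y rfl b hb
  exact rescale_apply γ φ hb

theorem rescale_mul_one (U : 𝒜.Units) (γ : I → ℝ) (φ : A →ₗ[ℂ] ℂ) (y : I × I) (a : A) :
    𝒜.rescale γ φ (a * U.one y) = γ y.2 * φ (a * U.one y) := by
  refine 𝒜.induction_on (P := fun a => 𝒜.rescale γ φ (a * U.one y) = γ y.2 * φ (a * U.one y)) a ?_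
    (by simp) fun a b ha hb => by rw [add_mul, map_add, map_add, mul_add, ha, hb]
  intro x z a ha
  by_cases h : z = y
  · subst h
    rw [U.mul_one _ _ _ ha, rescale_apply γ φ ha]
  · rw [U.mul_one_ne ha h, map_zero, map_zero, mul_zero]

theorem IsDiagonal.rescale (hφ : 𝒜.IsDiagonal φ) (γ : I → ℝ) : 𝒜.IsDiagonal (𝒜.rescale γ φ) :=
  fun r s t u h a ha => by rw [rescale_apply γ φ ha, hφ r s t u h a ha, mul_zero]

/-- Off-diagonal corners of `a^*a` do not contribute, and the diagonal corner at `x` is `(a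
1(x))^*(a 1(x))`, on which rescaling is multiplication by one positive number. -/
theorem IsDiagonal.isPositive_rescale [StarRing A] [StarModule ℂ A] (hφ : 𝒜.IsDiagonal φ)
    (hA : 𝒜.IsStar) (U : 𝒜.Units) {γ : I → ℝ} (hγ : ∀ s, 0 < γ s) (hpos : IsPositive φ) :
    IsPositive (𝒜.rescale γ φ) := by
  intro a
  rw [← U.finsum_one_mul_mul_one (star a * a), map_finsum _ (U.finite_one_mul_mul_one _)]
  refine finsum_induction (p := fun c : ℂ => 0 ≤ c) le_rfl (fun _ _ => add_nonneg) ?_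
  rintro ⟨x, y⟩
  by_cases h : x = y
  · subst h
    have h1 : U.one x * (star a * a) * U.one x = star (a * U.one x) * (a * U.one x) := by
      rw [star_mul, U.star_one hA]
      simp only [mul_assoc]
    rw [h1, ← mul_assoc, rescale_mul_one, mul_assoc]
    exact mul_nonneg (Complex.zero_le_real.2 (hγ _).le) (hpos _)
  · rw [(hφ.rescale γ).apply_eq_zero h (U.one_mul_mul_one_mem x y _)]

theorem IsDiagonal.isFaithful_rescale (hφ : 𝒜.IsDiagonal φ) (U : 𝒜.Units) {γ : I → ℝ}
    (hγ : ∀ s, 0 < γ s) (hf : IsFaithful φ) : IsFaithful (𝒜.rescale γ φ) := by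
  have hγ' : ∀ s, (γ s : ℂ) ≠ 0 := fun s => Complex.ofReal_ne_zero.2 (hγ s).ne'
  constructor
  · intro a h
    refine hf.1 a fun b => ?_
    refine 𝒜.induction_on (P := fun b => φ (a * b) = 0) b ?_ (by simp)
      fun b c hb hc => by rw [mul_add, map_add, hb, hc, add_zero]
    intro x y b hb
    have h1 := rescale_mul_one U γ φ y (a * b)
    rw [mul_assoc, U.mul_one _ _ _ hb, h] at h1
    exact (_root_.mul_eq_zero.1 h1.symm).resolve_left (hγ' _)
  · intro a h
    refine U.eq_of_mul_one fun y => ?_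
    rw [zero_mul]
    refine hf.2 _ fun b => ?_
    have h1 := rescale_mul_one U γ φ y (b * a)
    rw [(hφ.rescale γ).apply_mul_one, ← mul_assoc, h] at h1
    rw [← mul_assoc]
    exact (_root_.mul_eq_zero.1 h1.symm).resolve_left (hγ' _)

end PartialAlgebra

namespace PartialBialgebra

variable {𝒜 : PartialAlgebra (I × I) A} {P : PartialBialgebra 𝒜} {φ : A →ₗ[ℂ] ℂ}

/-- The second leg of `Δ_pp(a)` has the same lower right index as `a`, so the same factor appears on
both sides. -/
theorem IsLeftInvariant.rescale (hφ : P.IsLeftInvariant φ) (γ : I → ℝ) :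
    P.IsLeftInvariant (𝒜.rescale γ φ) := by
  refine ⟨hφ.1.rescale γ, fun k l m n a ha p => ?_⟩
  have h1 : sliceR (𝒜.rescale γ φ) (P.comul p p a) = (γ n : ℂ) • sliceR φ (P.comul p p a) :=
    eqOn_tensorSub (f := sliceR (𝒜.rescale γ φ)) (g := (γ n : ℂ) • sliceR φ) (fun u _ v hv => by
      rw [LinearMap.smul_apply, sliceR_tmul, sliceR_tmul, rescale_apply γ φ hv, mul_smul])
      (P.comul_mem p p k l m n a ha)
  rw [h1, hφ.2 _ _ _ _ a ha, rescale_apply γ φ ha, mul_smul]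

theorem one_ne_zero (P : PartialBialgebra 𝒜) (k : I) : P.one (k, k) ≠ 0 := fun h => by
  have h1 := P.counit_one k
  rw [h, map_zero] at h1
  exact zero_ne_one h1

/-- Left invariance applied to `Δ_ss(1(r,s)) = 1(r,s) ⊗ 1(s,s)`. One factor for each `s` therefore
normalizes all `1(r,s)` with `r ∼ s`. -/
theorem IsLeftInvariant.apply_one_eq (hφ : P.IsLeftInvariant φ) {r s : I}
    (h : P.one (r, s) ≠ 0) : φ (P.one (r, s)) = φ (P.one (s, s)) := by
  have h1 := hφ.2 _ _ _ _ _ (P.one_mem (r, s)) s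
  rw [P.comul_one_same, sliceR_tmul] at h1
  exact (smul_left_injective ℂ h h1).symm

theorem eq_zero_of_one_left {x y : I × I} (h : P.one x = 0) {a : A} (ha : a ∈ 𝒜.comp x y) :
    a = 0 := by
  rw [← P.one_mul _ _ _ ha, h, zero_mul]

theorem comul_eq_zero_of_one {k l m n p : I} (h : P.one (k, p) = 0) {a : A}
    (ha : a ∈ 𝒜.comp (k, m) (l, n)) (q : I) : P.comul p q a = 0 :=
  eqOn_tensorSub (f := LinearMap.id) (g := 0) (fun u hu v _ => by
    rw [eq_zero_of_one_left h hu, TensorProduct.zero_tmul, map_zero, map_zero])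
    (P.comul_mem p q k l m n a ha)

/-- Symmetry of `∼`: the antipode axiom recovers `1(p,m)` from `Δ_pp(1(m,m)) = 1(m,p) ⊗ 1(p,m)`. -/
theorem IsAntipode.one_eq_zero_symm {S : A →ₗ[ℂ] A} (hS : P.IsAntipode S) {m p : I}
    (h : P.one (m, p) = 0) : P.one (p, m) = 0 := by
  have h1 := hS.mul_rTensor_col (P.one_mem (m, m)) p
  have h2 : P.col p (P.one (m, m)) = 0 := by
    rw [col, lfSum_eq_single _ _ _ p fun j hj => P.comul_one_ne _ _ _ _ hj, P.comul_one_same, h,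
      TensorProduct.zero_tmul]
  rw [h2, map_zero, map_zero, P.counit_one, one_smul] at h1
  exact h1.symm

theorem sliceL_lTensor {B C : Type*} [AddCommGroup B] [Module ℂ B] [AddCommGroup C] [Module ℂ C]
    (ω : A →ₗ[ℂ] ℂ) (g : B →ₗ[ℂ] C) (z : A ⊗[ℂ] B) :
    (TensorProduct.lid ℂ C) (ω.rTensor C (g.lTensor A z)) =
      g (TensorProduct.lid ℂ B (ω.rTensor B z)) := by
  induction z using TensorProduct.induction_on with
  | zero => simp
  | add x y hx hy => simp only [map_add, hx, hy]
  | tmul a b => simp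

theorem sliceL_sliceL_assoc (ω : A →ₗ[ℂ] ℂ) (v : A ⊗[ℂ] A) (b : A) :
    sliceL ω (sliceL ω (TensorProduct.assoc ℂ A A A (v ⊗ₜ b))) = tensorFunctional ω v • b := by
  induction v using TensorProduct.induction_on with
  | zero => simp
  | add x y hx hy => simp only [TensorProduct.add_tmul, map_add, hx, hy, add_smul]
  | tmul c d =>
    rw [tensorFunctional_tmul, mul_smul]
    simp [sliceL]

theorem IsLeftInvariant.tensorFunctional_comul (hφ : P.IsLeftInvariant φ) {k l m n : I} {a : A}
    (ha : a ∈ 𝒜.comp (k, m) (l, n)) (p : I) :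
    tensorFunctional φ (P.comul p p a) = φ a * φ (P.one (k, p)) := by
  rw [tensorFunctional, LinearMap.comp_apply, hφ.2 _ _ _ _ a ha, map_smul, smul_eq_mul]

/-- Write `R_p = (φ ⊗ id)Δ_pp`. Coassociativity turns `R_q R_p` into `((φ ⊗ φ)Δ_pp ⊗ id)Δ_qq`, and
left invariance makes `(φ ⊗ φ)Δ_pp` a multiple of `φ`. -/
theorem IsLeftInvariant.sliceL_sliceL (hφ : P.IsLeftInvariant φ) {k l m n : I} {a : A}
    (ha : a ∈ 𝒜.comp (k, m) (l, n)) (p q : I) :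
    sliceL φ (P.comul q q (sliceL φ (P.comul p p a))) =
      φ (P.one (k, p)) • sliceL φ (P.comul q q a) := by
  have h1 : sliceL φ (P.comul q q (sliceL φ (P.comul p p a))) =
      sliceL φ (sliceL φ ((P.comul q q).lTensor A (P.comul p p a))) :=
    congrArg (sliceL φ) (sliceL_lTensor φ (P.comul q q) (P.comul p p a)).symm
  rw [h1, ← P.coassoc]
  refine eqOn_tensorSub (f := sliceL φ ∘ₗ sliceL φ ∘ₗ (TensorProduct.assoc ℂ A A A).toLinearMap ∘ₗ
    (P.comul p p).rTensor A) (g := φ (P.one (k, p)) • sliceL φ) ?_ (P.comul_mem q q k l m n a ha)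
  intro u hu v _
  simp only [LinearMap.comp_apply, LinearMap.rTensor_tmul, LinearEquiv.coe_coe]
  rw [sliceL_sliceL_assoc, hφ.tensorFunctional_comul hu, LinearMap.smul_apply, sliceL_tmul,
    smul_smul, mul_comm]

theorem tensorFunctional_one_tmul_mul_col (hφ : 𝒜.IsDiagonal φ) {p m l n : I} {x : A}
    (hx : x ∈ 𝒜.comp (p, m) (l, n)) (u : I) (c : A) :
    tensorFunctional φ ((P.one (p, u) ⊗ₜ c) * P.col u x) =
      φ (c * sliceL φ (P.comul u u x)) := by
  rw [← P.sliceL_col hφ]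
  refine eqOn_pairSpan (f := tensorFunctional φ ∘ₗ LinearMap.mulLeft ℂ (P.one (p, u) ⊗ₜ c))
    (g := φ ∘ₗ LinearMap.mulLeft ℂ c ∘ₗ sliceL φ) ?_ (P.col_mem hx u)
  rintro ⟨p', q⟩ _ x' y' ⟨h1, rfl, -, -, -⟩ v hv w _
  dsimp only at h1
  subst h1
  simp only [LinearMap.comp_apply, LinearMap.mulLeft_apply, Algebra.TensorProduct.tmul_mul_tmul]
  rw [tensorFunctional_tmul, sliceL_tmul, mul_smul_comm, map_smul, smul_eq_mul]
  by_cases h : u = q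
  · subst h
    rw [P.one_mul _ _ _ hv]
  · rw [P.one_mul_ne hv fun h' => h (Prod.mk.inj h').2, map_zero,
      hφ.apply_eq_zero (fun h' => h (Prod.mk.inj h').2.symm) hv]

variable [StarRing A] [StarModule ℂ A]

/-- Pythagoras for the form `φ ⊗ φ`: by left invariance the column has the norm of `x`, and `1(p,u)
⊗ y` has the norm of `y` and is orthogonal to the difference. -/
theorem IsLeftInvariant.tensorFunctional_star_mul (hφ : P.IsLeftInvariant φ) (hpos : IsPositive φ)
    (hA : 𝒜.IsStar) (hs : ∀ p q a, star (P.comul p q a) = P.comul q p (star a)) {p m n u : I}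
    (hu : φ (P.one (p, u)) = 1) {x : A} (hx : x ∈ 𝒜.comp (p, m) (p, n)) {y : A}
    (hy : y = sliceL φ (P.comul u u x)) :
    tensorFunctional φ (star (P.col u x - P.one (p, u) ⊗ₜ y) * (P.col u x - P.one (p, u) ⊗ₜ y)) =
      φ (star x * x) - φ (star y * y) := by
  have h1 : star (P.one (p, u) ⊗ₜ[ℂ] y) = P.one (p, u) ⊗ₜ star y := by
    rw [TensorProduct.star_tmul]
    congr 1
    exact P.units.star_one hA _
  have t1 : tensorFunctional φ (star (P.col u x) * P.col u x) = φ (star x * x) := by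
    rw [P.star_col hs, ← comul_mul_eq,
      hφ.tensorFunctional_comul (𝒜.mul_mem (hA _ _ _ hx) hx), hu, _root_.mul_one]
  have t2 : tensorFunctional φ (star (P.one (p, u) ⊗ₜ[ℂ] y) * P.col u x) = φ (star y * y) := by
    rw [h1, tensorFunctional_one_tmul_mul_col hφ.1 hx, ← hy]
  have t3 : tensorFunctional φ (star (P.col u x) * P.one (p, u) ⊗ₜ[ℂ] y) = φ (star y * y) := by
    rw [← hpos.tensorFunctional_conj, t2, hpos.conj_apply]
  have t4 : tensorFunctional φ (star (P.one (p, u) ⊗ₜ[ℂ] y) * P.one (p, u) ⊗ₜ[ℂ] y) =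
      φ (star y * y) := by
    rw [h1, Algebra.TensorProduct.tmul_mul_tmul, P.one_mul _ _ _ (P.one_mem _),
      tensorFunctional_tmul, hu, _root_.one_mul]
  rw [star_sub, sub_mul, mul_sub, mul_sub, map_sub, map_sub, map_sub, t1, t2, t3, t4]
  ring

/-- A normalized faithful positive left invariant functional is right invariant. -/
theorem IsLeftInvariant.isRightInvariant (hφ : P.IsLeftInvariant φ) (hpos : IsPositive φ)
    (hf : IsFaithful φ) (hP : P.IsPartialHopfStar)
    (h1 : ∀ r s, P.one (r, s) ≠ 0 → φ (P.one (r, s)) = 1) : P.IsRightInvariant φ := by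
  classical
  obtain ⟨⟨S, hS⟩, hA, hs⟩ := hP
  refine ⟨hφ.1, fun k l m n a ha p => ?_⟩
  by_cases hkl : k = l
  swap
  · rw [hφ.1.sliceL_eq_zero_of_ne (P.comul_mem p p k l m n a ha)
      (fun h => hkl (Prod.mk.inj h).1), hφ.1 _ _ _ _ (Or.inl hkl) a ha, zero_smul]
  subst hkl
  by_cases hkm : P.one (k, m) = 0
  · rw [eq_zero_of_one_left hkm ha, map_zero, map_zero, map_zero, zero_smul]
  by_cases hkp : P.one (k, p) = 0
  · rw [comul_eq_zero_of_one hkp ha, map_zero]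
    by_cases hpm : P.one (p, m) = 0
    · rw [hpm, smul_zero]
    · exfalso
      have hmp : P.one (m, p) ≠ 0 := fun h => hpm (hS.one_eq_zero_symm h)
      -- Transitivity of `∼`: the functional `φ ⊗ φ` has value `1` on `1(k,m) ⊗ 1(m,p) =
      -- Δ_mm(1(k,p))`, so `1(k,p)` cannot vanish.
      have h2 := congrArg (tensorFunctional φ) (P.comul_one_same k m p)
      rw [hkp, map_zero, map_zero, tensorFunctional_tmul, h1 _ _ hkm, h1 _ _ hmp] at h2
      norm_num at h2
  obtain ⟨x, hx⟩ : ∃ x, x = sliceL φ (P.comul p p a) := ⟨_, rfl⟩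
  have hxm : x ∈ 𝒜.comp (p, m) (p, n) := hx ▸ sliceL_mem φ (P.comul_mem p p k k m n a ha)
  have hxa : φ x = φ a := by
    have h2 := hφ.tensorFunctional_comul ha p
    rw [h1 _ _ hkp, _root_.mul_one] at h2
    rw [← h2, hx]
    generalize P.comul p p a = w
    refine LinearMap.congr_fun (f := φ ∘ₗ sliceL φ) (TensorProduct.ext' fun u v => ?_) w
    rw [LinearMap.comp_apply, sliceL_tmul, tensorFunctional_tmul, map_smul, smul_eq_mul]
  rw [← hx]
  by_cases hx0 : x = 0
  · rw [← hxa, hx0, map_zero, zero_smul]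
  have hpn : P.one (p, n) ≠ 0 := fun h => hx0 (by rw [← P.mul_one _ _ _ hxm, h, mul_zero])
  -- The index `n` is the one for which `id ⊗ ε` maps the column of `x` back to `x`.
  obtain ⟨y, hy⟩ : ∃ y, y = sliceL φ (P.comul n n x) := ⟨_, rfl⟩
  have hym : y ∈ 𝒜.comp (n, m) (n, n) := hy ▸ sliceL_mem φ (P.comul_mem n n p p m n x hxm)
  -- Since `x` is already in the range of `R_p`, applying `R_n` and then `R_p` returns it.
  have hxy : x = sliceL φ (P.comul p p y) := by
    rw [hy, hφ.sliceL_sliceL hxm, h1 _ _ hpn, one_smul]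
    nth_rewrite 2 [hx]
    rw [hφ.sliceL_sliceL ha, h1 _ _ hkp, one_smul, hx]
  have hnp : P.one (n, p) ≠ 0 := fun h => hx0 (by
    rw [hxy, comul_eq_zero_of_one h hym, map_zero])
  have e1 := hφ.tensorFunctional_star_mul hpos hA hs (h1 _ _ hpn) hxm hy
  have e2 := hφ.tensorFunctional_star_mul hpos hA hs (h1 _ _ hnp) hym hxy
  have p1 := hpos.tensorFunctional_pos hf (P.col n x - P.one (p, n) ⊗ₜ y)
  have p2 := (hpos.tensorFunctional_pos hf (P.col p y - P.one (n, p) ⊗ₜ x)).1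
  rw [e1] at p1
  rw [e2] at p2
  -- Both passages `x ↦ y` and `y ↦ x` are contractions, so the norms agree and the Pythagorean
  -- defect of `x` is zero.
  have h2 : φ (star x * x) - φ (star y * y) = 0 :=
    le_antisymm (by rw [← neg_sub]; exact neg_nonpos.2 p2) p1.1
  -- Definiteness identifies the column of `x` with `1(p,n) ⊗ y`; the counit turns this into `x =
  -- ε(y)1(p,n)`, and `φ(x) = φ(a)` determines the scalar.
  have h3 := congrArg (sliceR P.counit) (sub_eq_zero.1 (p1.2 h2))
  rw [P.sliceR_counit_col, right_unitLo hxm, if_pos rfl, sliceR_tmul] at h3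
  by_cases hmn : n = m
  · subst hmn
    have h4 := congrArg φ h3
    rw [map_smul, h1 _ _ hpn, smul_eq_mul, _root_.mul_one, hxa] at h4
    rw [h3, h4]
  · rw [P.counit_support _ _ _ _ (Or.inl hmn) y hym, zero_smul] at h3
    exact absurd h3 hx0

/-- Normalization of a faithful positive left invariant functional. -/
theorem IsLeftInvariant.exists_integral (hφ : P.IsLeftInvariant φ) (hpos : IsPositive φ)
    (hf : IsFaithful φ) (hP : P.IsPartialHopfStar) : ∃ γ : I → ℝ, (∀ s, 0 < γ s) ∧
      P.IsLeftInvariant (𝒜.rescale γ φ) ∧ P.IsRightInvariant (𝒜.rescale γ φ) ∧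
      IsFaithful (𝒜.rescale γ φ) ∧ IsPositive (𝒜.rescale γ φ) ∧
      ∀ r s, P.one (r, s) ≠ 0 → 𝒜.rescale γ φ (P.one (r, s)) = 1 := by
  have hA := hP.2.1
  -- Each unit is a self-adjoint projection, so positivity and faithfulness give `φ(1(s,s)) > 0`;
  -- its inverse is the factor `γ s`.
  have h0 : ∀ s, star (P.one (s, s)) * P.one (s, s) = P.one (s, s) := fun s => by
    have h := P.units.star_one hA (s, s)
    change star (P.one (s, s)) = P.one (s, s) at h
    rw [h, P.one_mul _ _ _ (P.one_mem _)]
  have h1 : ∀ s, 0 ≤ φ (P.one (s, s)) := fun s => h0 s ▸ hpos (P.one (s, s))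
  have h2 : ∀ s, φ (P.one (s, s)) ≠ 0 := fun s h =>
    P.one_ne_zero s (hpos.eq_zero_of_faithful hf (by rw [h0, h]))
  have h3 : ∀ s, φ (P.one (s, s)) = ((φ (P.one (s, s))).re : ℂ) := fun s =>
    Complex.ext rfl (Complex.le_def.1 (h1 s)).2.symm
  have h4 : ∀ s, 0 < (φ (P.one (s, s))).re := fun s =>
    lt_of_le_of_ne (Complex.le_def.1 (h1 s)).1 fun h => h2 s (by rw [h3, ← h]; rfl)
  have hγ : ∀ s, 0 < ((φ (P.one (s, s))).re)⁻¹ := fun s => inv_pos.2 (h4 s)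
  have h5 : ∀ r s, P.one (r, s) ≠ 0 →
      𝒜.rescale (fun s => ((φ (P.one (s, s))).re)⁻¹) φ (P.one (r, s)) = 1 := by
    intro r s h
    rw [rescale_apply _ φ (P.one_mem (r, s)), hφ.apply_one_eq h, Complex.ofReal_inv, ← h3]
    exact inv_mul_cancel₀ (h2 s)
  have hpos' := hφ.1.isPositive_rescale hA P.units hγ hpos
  have hf' := hφ.1.isFaithful_rescale P.units hγ hf
  exact ⟨_, hγ, hφ.rescale _, (hφ.rescale _).isRightInvariant hpos' hf' hP h5, hf', hpos', h5⟩

end PartialBialgebra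

end PartialQG

/-! ### The equivalence of the two notions. -/

namespace PartialQG

open Multiplier PartialAlgebra

variable {I A : Type*} [NonUnitalRing A] [Module ℂ A] [IsScalarTower ℂ A A] [SMulCommClass ℂ A A]
  [StarRing A] [StarModule ℂ A] {𝒜 : PartialAlgebra (I × I) A}

/-- Faithfulness is not part of (II) and comes from `IsAntipode.isFaithful`. -/
theorem PartialBialgebra.IsPartialCompactQuantumGroup.isStarAlgebraicQuantumGroup
    {P : PartialBialgebra 𝒜} (hP : P.IsPartialCompactQuantumGroup) :
    P.toMultiplierBialgebra.IsStarAlgebraicQuantumGroup := by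
  obtain ⟨h1, φ, h2, hpos⟩ := hP
  obtain ⟨hl, -, h3⟩ := P.isInvariantIntegral_iff.1 h2
  obtain ⟨S, hS⟩ := h1.1
  exact ⟨h1.isHopfStar, φ, P.toMultiplierBialgebra_corresponds.isLeftInvariant_iff.2 hl,
    hS.isFaithful hl h3 hpos, hpos⟩

/-- Neither right invariance nor normalization is part of (I); `exists_integral` supplies both. -/
theorem Corresponds.isPartialCompactQuantumGroup {H : RegularPartialMultiplierBialgebra 𝒜}
    {P : PartialBialgebra 𝒜} (h : Corresponds H P) (hH : H.IsStarAlgebraicQuantumGroup) :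
    P.IsPartialCompactQuantumGroup := by
  obtain ⟨h1, φ, hl, hf, hpos⟩ := hH
  have hP := h.isPartialHopfStar h1
  obtain ⟨γ, -, hl', hr', -, hpos', h2⟩ :=
    (h.isLeftInvariant_iff.1 hl).exists_integral hpos hf hP
  exact ⟨hP, _, P.isInvariantIntegral_iff.2 ⟨hl', hr', fun k => h2 _ _ (P.one_ne_zero k)⟩, hpos'⟩

theorem RegularPartialMultiplierBialgebra.IsStarAlgebraicQuantumGroup.exists_corresponds
    {H : RegularPartialMultiplierBialgebra 𝒜}
    (hH : H.IsStarAlgebraicQuantumGroup ∧ H.IsCompactType) :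
    ∃ P : {P : PartialBialgebra 𝒜 // P.IsPartialCompactQuantumGroup}, Corresponds H P.1 := by
  obtain ⟨P, hP⟩ := hH.2.exists_corresponds
  exact ⟨⟨P, hP.isPartialCompactQuantumGroup hH.1⟩, hP⟩

/-- The equivalence between partial `*`-algebraic quantum groups of compact type and partial
compact quantum groups. -/
noncomputable def compactTypeEquiv (𝒜 : PartialAlgebra (I × I) A) :
    {H : RegularPartialMultiplierBialgebra 𝒜 //
      H.IsStarAlgebraicQuantumGroup ∧ H.IsCompactType} ≃
        {P : PartialBialgebra 𝒜 // P.IsPartialCompactQuantumGroup} where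
  toFun H :=
    (RegularPartialMultiplierBialgebra.IsStarAlgebraicQuantumGroup.exists_corresponds H.2).choose
  invFun P := ⟨P.1.toMultiplierBialgebra, P.2.isStarAlgebraicQuantumGroup,
    P.1.toMultiplierBialgebra_isCompactType⟩
  left_inv H := Subtype.ext (Corresponds.left_unique
    (PartialBialgebra.toMultiplierBialgebra_corresponds _)
    (RegularPartialMultiplierBialgebra.IsStarAlgebraicQuantumGroup.exists_corresponds
      H.2).choose_spec)
  right_inv P := Subtype.ext (Corresponds.right_unique
    (RegularPartialMultiplierBialgebra.IsStarAlgebraicQuantumGroup.exists_corresponds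
      ⟨P.2.isStarAlgebraicQuantumGroup, P.1.toMultiplierBialgebra_isCompactType⟩).choose_spec
    P.1.toMultiplierBialgebra_corresponds)

theorem corresponds_compactTypeEquiv (H : {H : RegularPartialMultiplierBialgebra 𝒜 //
    H.IsStarAlgebraicQuantumGroup ∧ H.IsCompactType}) :
    Corresponds H.1 (compactTypeEquiv 𝒜 H).1 :=
  (RegularPartialMultiplierBialgebra.IsStarAlgebraicQuantumGroup.exists_corresponds
    H.2).choose_spec

end PartialQG

theorem mainTheorem10 {I : Type*} {A : Type*} [NonUnitalRing A] [Module ℂ A]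
    [IsScalarTower ℂ A A] [SMulCommClass ℂ A A] [StarRing A] [StarModule ℂ A]
    (𝒜 : PartialQG.PartialAlgebra (I × I) A) :
    ∃ e : {H : PartialQG.RegularPartialMultiplierBialgebra 𝒜 //
            H.IsStarAlgebraicQuantumGroup ∧ H.IsCompactType} ≃
          {P : PartialQG.PartialBialgebra 𝒜 // P.IsPartialCompactQuantumGroup},
      (∀ H, PartialQG.Corresponds H.1 (e H).1) ∧
      ∀ H, ∀ φ : A →ₗ[ℂ] ℂ,
        H.1.IsLeftInvariant φ → PartialQG.IsFaithful φ → PartialQG.IsPositive φ →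
        ∃ φ' : A →ₗ[ℂ] ℂ,
          (∃ γ : I → ℝ, (∀ s, 0 < γ s) ∧ ∀ s, ∀ a ∈ 𝒜.loR s, φ' a = (γ s : ℂ) * φ a) ∧
          H.1.IsLeftInvariant φ' ∧ H.1.IsRightInvariant φ' ∧
          PartialQG.IsFaithful φ' ∧ PartialQG.IsPositive φ' ∧
          (∀ r s, H.1.Hyper r s → ∀ u, PartialQG.Multiplier.ofElem u = 𝒜.unitC r s → φ' u = 1) ∧
          (e H).1.IsInvariantIntegral φ' := by
  refine ⟨PartialQG.compactTypeEquiv 𝒜, PartialQG.corresponds_compactTypeEquiv,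
    fun H φ hl hf hpos => ?_⟩
  have h := PartialQG.corresponds_compactTypeEquiv H
  obtain ⟨γ, hγ, hl', hr', hf', hpos', h1⟩ :=
    (h.isLeftInvariant_iff.1 hl).exists_integral hpos hf (h.isPartialHopfStar H.2.1.1)
  refine ⟨𝒜.rescale γ φ, ⟨γ, hγ, fun s a ha => PartialQG.PartialAlgebra.rescale_apply_of_mem γ φ ha⟩,
    h.isLeftInvariant_iff.2 hl', h.isRightInvariant hr', hf', hpos', fun r s hrs u hu => ?_,
    ((PartialQG.compactTypeEquiv 𝒜 H).1.isInvariantIntegral_iff).2 ⟨hl', hr', fun k =>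
      h1 _ _ (PartialQG.PartialBialgebra.one_ne_zero _ k)⟩⟩
  -- Local units make `A → M(A)` injective, so the element representing a base unit is unique.
  have h2 : u = (PartialQG.compactTypeEquiv 𝒜 H).1.one (r, s) :=
    PartialQG.Multiplier.ofElem_injective
      (PartialQG.PartialBialgebra.locallyUnital (PartialQG.compactTypeEquiv 𝒜 H).1)
      (hu.trans (h.1 r s).symm)
  rw [h2]
  refine h1 r s fun h3 => hrs ?_
  rw [← h.1 r s, h3, map_zero]
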